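/- Let $(\mathcal A,\mathcal B,E)$ be an operator-valued probability space: $\mathcal A$ is a unital complex algebra, $\mathcal B\subseteq\mathcal A$ a unital subalgebra, and $E:\mathcal A\to\mathcal B$ a linear map with $E(b)=b$ and $E(bab')=bE(a)b'$ for all $b,b'\in\mathcal B$, $a\in\mathcal A$. Let $NC(n)$ be the set of non-crossing partitions of $[n]=\{1,\dots,n\}$, $I(n)$ the set of interval partitions (all blocks are intervals), and $NC_{irr}(n)$ the set of irreducible non-crossing partitions, those in which $1$ and $n$ lie in the same block. Write $|\pi|$ for the number of blocks of $\pi$. For a sequence of maps $f_n:\mathcal A^n\to\mathcal B$, define $f_\pi$ for $\pi\in NC(n)$ recursively: $f_{1_n}=f_n$ for the one-block partition $1_n$; otherwise let $V=\{l+1,\dots,l+k\}$ be the block of $\pi$ with the largest minimum (deleting blocks in this order, each is an interval of the remaining points, with $l\ge 1$) and put $f_\pi(x_1,\dots,x_n)=f_{\pi\setminus V}(x_1,\dots,x_{l-1},x_l f_k(x_{l+1},\dots,x_{l+k}),x_{l+k+1},\dots,x_n)$. (The order of removal is irrelevant for the $\mathcal B$-bimodule families considered here.) A block $V$ is nested in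 a block $W$ if $V\subseteq[\min W,\max W]$. Let $$\tau(\pi)!=\prod_{V\in\pi}\bigl|\{W\in\pi: W\subseteq[\min V,\max V]\}\bigr|,\qquad \omega(\pi)=\sum_{k=1}^n\frac{(-1)^{k+1}}{k}\,\omega_k(\pi),$$ where $\omega_k(\pi)$ is the number of surjective maps $f$ from the set of blocks of $\pi$ onto $[k]$ such that $f(V)<f(W)$ whenever $V\neq W$ and $V$ is nested in $W$. The free, Boolean and monotone cumulants $r_n,\beta_n,h_n:\mathcal A^n\to\mathcal B$ are defined recursively by the formulas $$E(a_1\cdots a_n)=\sum_{\pi\in NC(n)}r_\pi(a_1,\dots,a_n)=\sum_{\pi\in I(n)}\beta_\pi(a_1,\dots,a_n)=\sum_{\pi\in NC(n)}\frac1{\tau(\pi)!}\,h_\pi(a_1,\dots,a_n)\qquad(n\ge1,\ a_i\in\mathcal A).$$ Then for every $n\ge1$ and all $a_1,\dots,a_n\in\mathcal A$ (arguments omitted): $$\beta_n=\sum_{\pi\in NC_{irr}(n)}\frac{1}{\tau(\pi)!}\,h_\pi,\qquad r_n=\sum_{\pi\in NC_{irr}(n)}\frac{(-1)^{|\pi|-1}}{\tau(\pi)!}\,h_\pi,$$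 $$h_n=\sum_{\pi\in NC_{irr}(n)}\omega(\pi)\,\beta_\pi,\qquad h_n=\sum_{\pi\in NC_{irr}(n)}(-1)^{|\pi|-1}\omega(\pi)\,r_\pi .$$ -/

import Mathlib

namespace OVCumulant

/-- A conditional expectation `E : A → B` onto a unital subalgebra `B` of a unital complex
algebra `A`: a linear map with `E(b) = b` and `E(b a b') = b E(a) b'`. The data
`(A, B, E)` is an operator-valued probability space. -/
structure ConditionalExpectation {A : Type*} [Ring A] [Algebra ℂ A] (B : Subalgebra ℂ A) where
  toLinearMap : A →ₗ[ℂ] B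
  map_coe : ∀ b : B, toLinearMap (b : A) = b
  map_bimodule : ∀ (b b' : B) (a : A),
    toLinearMap ((b : A) * a * (b' : A)) = b * toLinearMap a * b'

/-- Partitions of `{0, …, n-1}` (that is, of `[n]`, shifted by one). -/
abbrev SetPart (n : ℕ) : Type := Finpartition (Finset.univ : Finset (Fin n))

/-- No two distinct blocks cross. -/
def SetPart.IsNoncrossing {n : ℕ} (π : SetPart n) : Prop :=
  ∀ V ∈ π.parts, ∀ W ∈ π.parts, V ≠ W →
    ¬ ∃ a ∈ V, ∃ b ∈ W, ∃ c ∈ V, ∃ d ∈ W, a < b ∧ b < c ∧ c < d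

/-- All blocks are intervals. -/
def SetPart.IsInterval {n : ℕ} (π : SetPart n) : Prop :=
  ∀ V ∈ π.parts, ∀ i ∈ V, ∀ j ∈ V, ∀ k, i ≤ k → k ≤ j → k ∈ V

/-- The first and the last element lie in the same block. -/
def SetPart.IsIrreducible {n : ℕ} (π : SetPart n) : Prop :=
  ∃ V ∈ π.parts, ∀ i : Fin n, ((i : ℕ) = 0 ∨ (i : ℕ) + 1 = n) → i ∈ V

instance {n : ℕ} (π : SetPart n) : Decidable π.IsNoncrossing := by
  unfold SetPart.IsNoncrossing; infer_instance

instance {n : ℕ} (π : SetPart n) : Decidable π.IsInterval := by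
  unfold SetPart.IsInterval; infer_instance

instance {n : ℕ} (π : SetPart n) : Decidable π.IsIrreducible := by
  unfold SetPart.IsIrreducible; infer_instance

/-- Non-crossing partitions. -/
def NC (n : ℕ) : Finset (SetPart n) := Finset.univ.filter fun π => π.IsNoncrossing

/-- Interval partitions. -/
def IntPart (n : ℕ) : Finset (SetPart n) :=
  Finset.univ.filter fun π => π.IsNoncrossing ∧ π.IsInterval

/-- Irreducible non-crossing partitions. -/
def NCirr (n : ℕ) : Finset (SetPart n) :=
  Finset.univ.filter fun π => π.IsNoncrossing ∧ π.IsIrreducible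

/-- `W ⊆ [min V, max V]`: every element of `W` lies between two elements of `V`. -/
def Nested {n : ℕ} (W V : Finset (Fin n)) : Prop :=
  ∀ w ∈ W, ∃ a ∈ V, ∃ b ∈ V, a ≤ w ∧ w ≤ b

instance {n : ℕ} (W V : Finset (Fin n)) : Decidable (Nested W V) := by
  unfold Nested; infer_instance

/-- The tree factorial `τ(π)! = ∏_{V ∈ π} #{W ∈ π : W ⊆ [min V, max V]}`. -/
def treeFactorial {n : ℕ} (π : SetPart n) : ℕ :=
  ∏ V ∈ π.parts, (π.parts.filter fun W => Nested W V).card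

/-- The number of increasing colorings of the blocks of `π` that use each of exactly `k` colors:
a block nested inside another block has a strictly smaller color. -/
def increasingColorings {n : ℕ} (k : ℕ) (π : SetPart n) : ℕ :=
  Fintype.card {f : π.parts → Fin k // Function.Surjective f ∧
    ∀ V W : π.parts, V ≠ W → Nested (V : Finset (Fin n)) (W : Finset (Fin n)) → f V < f W}

/-- The coefficient `ω(π) = ∑_{k=1}^n (-1)^{k+1}/k ω_k(π)`. -/
def muruaOmega {n : ℕ} (π : SetPart n) : ℚ :=
  ∑ k ∈ Finset.Icc 1 n, (-1) ^ (k + 1) / (k : ℚ) * (increasingColorings k π : ℚ)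

section Multiplicative

variable {A : Type*} [Ring A] [Algebra ℂ A] {B : Subalgebra ℂ A}

/-- `f_{|V|}` evaluated at the entries of `x` with index in `V`, in increasing order. -/
def blockEval (f : ∀ k, (Fin k → A) → B) {n : ℕ} (V : Finset (Fin n)) (x : Fin n → A) : B :=
  f V.card fun i => x (V.orderEmbOfFin rfl i)

/-- The minima of the blocks of `π`, in decreasing order. -/
def blockMinima {n : ℕ} (π : SetPart n) : List (Fin n) :=
  (List.finRange n).reverse.filter fun m => ∀ i ∈ π.part m, m ≤ i

/-- The recursion for `f_π`: given the minima (in decreasing order) of the blocks of `π` that are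
still present, delete the block `V` with the largest minimum `m` (among the blocks of a
non-crossing partition it is an interval of the remaining points, and `m - 1` is the remaining
point just before it) and replace `x_{m-1}` by `x_{m-1} f_{|V|}(x_m, …)`; when only one block is
left, apply `f` to its entries. -/
def evalBlocks (f : ∀ k, (Fin k → A) → B) {n : ℕ} (π : SetPart n) :
    List (Fin n) → (Fin n → A) → B
  | [], _ => 0
  | [m], x => blockEval f (π.part m) x
  | m :: m' :: L, x => evalBlocks f π (m' :: L) fun l =>
      if (l : ℕ) + 1 = m then x l * (blockEval f (π.part m) x : A) else x l

/-- The multiplicative family `f_π` of a sequence `f_k : A^k → B`. -/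
def multFamily (f : ∀ k, (Fin k → A) → B) {n : ℕ} (π : SetPart n) (x : Fin n → A) : B :=
  evalBlocks f π (blockMinima π) x

lemma blockEval_congr {f g : ∀ k, (Fin k → A) → B} {n : ℕ} {V : Finset (Fin n)}
    (h : f V.card = g V.card) (x : Fin n → A) : blockEval f V x = blockEval g V x := by
  simp only [blockEval, h]

lemma multFamily_congr {f g : ∀ k, (Fin k → A) → B} {n : ℕ} (π : SetPart n)
    (h : ∀ V ∈ π.parts, f V.card = g V.card) (x : Fin n → A) :
    multFamily f π x = multFamily g π x := by
  have hp : ∀ m, π.part m ∈ π.parts := fun m => π.part_mem.2 (Finset.mem_univ m)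
  have key : ∀ (L : List (Fin n)) (x : Fin n → A), evalBlocks f π L x = evalBlocks g π L x := by
    intro L
    induction L with
    | nil => intro x; rfl
    | cons m L ih =>
      intro x
      cases L with
      | nil => exact blockEval_congr (h _ (hp m)) x
      | cons m' L =>
        simp only [evalBlocks]
        rw [ih, blockEval_congr (h _ (hp m)) x]
  exact key _ x

lemma top_parts {n : ℕ} (hn : 1 ≤ n) : (⊤ : SetPart n).parts = {Finset.univ} := by
  have : NeZero n := ⟨by omega⟩
  have hne : (Finset.univ : Finset (Fin n)) ≠ ⊥ := Finset.univ_nonempty.ne_empty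
  change (dite _ _ _ : SetPart n).parts = _
  rw [dif_neg hne]
  rfl

lemma card_lt_of_ne_top {n : ℕ} (hn : 1 ≤ n) {π : SetPart n} (hπ : π ≠ ⊤) {V : Finset (Fin n)}
    (hV : V ∈ π.parts) : V.card < n := by
  by_contra hlt
  have hc : V.card = Fintype.card (Fin n) := by
    rw [Fintype.card_fin]
    exact le_antisymm (by simpa using V.card_le_univ) (not_lt.1 hlt)
  have hVu : V = Finset.univ := (Finset.card_eq_iff_eq_univ V).1 hc
  subst hVu
  apply hπ
  apply le_antisymm le_top
  intro W hW
  rw [top_parts hn, Finset.mem_singleton] at hW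
  exact ⟨_, hV, hW.le⟩

lemma multFamily_top (f : ∀ k, (Fin k → A) → B) {n : ℕ} (hn : 1 ≤ n) (x : Fin n → A) :
    multFamily f (⊤ : SetPart n) x = f n x := by
  have hpart : ∀ m, (⊤ : SetPart n).part m = Finset.univ := fun m => by
    have := (⊤ : SetPart n).part_mem.2 (Finset.mem_univ m)
    rwa [top_parts hn, Finset.mem_singleton] at this
  have hb : blockEval f (Finset.univ : Finset (Fin n)) x = f n x := by
    have aux : ∀ (k : ℕ) (h : (Finset.univ : Finset (Fin n)).card = k),
        blockEval f (Finset.univ : Finset (Fin n)) x =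
          f k fun i => x ((Finset.univ : Finset (Fin n)).orderEmbOfFin h i) := by
      intro k h; subst h; rfl
    rw [aux n (by simp)]
    have : (id : Fin n → Fin n) = (Finset.univ : Finset (Fin n)).orderEmbOfFin (by simp) :=
      Finset.orderEmbOfFin_unique _ (fun i => Finset.mem_univ _) strictMono_id
    rw [← this]; rfl
  have hm : blockMinima (⊤ : SetPart n) = [⟨0, hn⟩] := by
    obtain ⟨k, rfl⟩ : ∃ k, n = k + 1 := ⟨n - 1, by omega⟩
    unfold blockMinima
    rw [List.filter_reverse]
    have : (List.finRange (k + 1)).filter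
        (fun m => decide (∀ i ∈ (⊤ : SetPart (k + 1)).part m, m ≤ i)) = [0] := by
      rw [List.finRange_succ, List.filter_cons_of_pos (by simp), List.filter_eq_nil_iff.2]
      intro m hmem
      obtain ⟨j, -, rfl⟩ := List.mem_map.1 hmem
      simp only [hpart, decide_eq_true_eq, not_forall]
      exact ⟨0, Finset.mem_univ _, by simp⟩
    rw [this]; rfl
  rw [multFamily, hm]
  simp only [evalBlocks, hpart, hb]

end Multiplicative

section Cumulants

variable {A : Type*} [Ring A] [Algebra ℂ A] {B : Subalgebra ℂ A}

/-- The cumulants `c_n` determined recursively by the moment-cumulant formula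
`E(x_1 ⋯ x_n) = ∑_{π ∈ C n} w(π) c_π(x_1, …, x_n)`, for classes `C n` of partitions that contain
the one-block partition, with weight `w = 1`: the term of the one-block partition is `c_n`, and the
other terms involve only `c_k` with `k < n`. The formula itself is `cumulant_spec` below. -/
noncomputable def cumulant (E : ConditionalExpectation B) (C : ∀ n, Finset (SetPart n))
    (w : ∀ n, SetPart n → ℂ) (n : ℕ) (x : Fin n → A) : B :=
  E.toLinearMap (List.ofFn x).prod -
    ∑ π ∈ (C n).erase ⊤,
      w n π • multFamily (fun k y => if _h : k < n then cumulant E C w k y else 0) π x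
termination_by n

lemma cumulant_spec (E : ConditionalExpectation B) (C : ∀ n, Finset (SetPart n))
    (w : ∀ n, SetPart n → ℂ) {n : ℕ} (hn : 1 ≤ n) (hC : ⊤ ∈ C n) (hw : w n ⊤ = 1)
    (x : Fin n → A) :
    E.toLinearMap (List.ofFn x).prod = ∑ π ∈ C n, w n π • multFamily (cumulant E C w) π x := by
  rw [← Finset.add_sum_erase _ _ hC, hw, one_smul, multFamily_top _ hn, cumulant,
    sub_add_eq_add_sub, eq_sub_iff_add_eq]
  congr 1
  refine Finset.sum_congr rfl fun π hπ => ?_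
  congr 1
  refine multFamily_congr π (fun V hV => ?_) x
  have := card_lt_of_ne_top hn (Finset.ne_of_mem_erase hπ) hV
  funext y
  rw [dif_pos this]

/-- The moment-cumulant formula has no other solution. -/
lemma cumulant_unique (E : ConditionalExpectation B) (C : ∀ n, Finset (SetPart n))
    (w : ∀ n, SetPart n → ℂ) (hC : ∀ n, 1 ≤ n → ⊤ ∈ C n) (hw : ∀ n, 1 ≤ n → w n ⊤ = 1)
    (c : ∀ n, (Fin n → A) → B)
    (hc : ∀ n, 1 ≤ n → ∀ x : Fin n → A,
      E.toLinearMap (List.ofFn x).prod = ∑ π ∈ C n, w n π • multFamily c π x)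
    (n : ℕ) (hn : 1 ≤ n) : c n = cumulant E C w n := by
  induction n using Nat.strong_induction_on with
  | _ n ih =>
    funext x
    have h := (hc n hn x).symm.trans (cumulant_spec E C w hn (hC n hn) (hw n hn) x)
    rw [← Finset.add_sum_erase _ _ (hC n hn), ← Finset.add_sum_erase (C n) _ (hC n hn),
      hw n hn, one_smul, one_smul, multFamily_top _ hn, multFamily_top _ hn] at h
    refine add_right_cancel (h.trans (congrArg _ (Finset.sum_congr rfl fun π hπ => ?_)))
    congr 1
    refine multFamily_congr π (fun V hV => (ih _ ?_ ?_).symm) x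
    · exact card_lt_of_ne_top hn (Finset.ne_of_mem_erase hπ) hV
    · exact (π.nonempty_of_mem_parts hV).card_pos

/-- Operator-valued free cumulants. -/
noncomputable def freeCumulant (E : ConditionalExpectation B) : ∀ n, (Fin n → A) → B :=
  cumulant E NC fun _ _ => 1

/-- Operator-valued Boolean cumulants. -/
noncomputable def booleanCumulant (E : ConditionalExpectation B) : ∀ n, (Fin n → A) → B :=
  cumulant E IntPart fun _ _ => 1

/-- Operator-valued monotone cumulants. -/
noncomputable def monotoneCumulant (E : ConditionalExpectation B) : ∀ n, (Fin n → A) → B :=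
  cumulant E NC fun _ π => 1 / (treeFactorial π : ℂ)

lemma isNoncrossing_top {n : ℕ} (hn : 1 ≤ n) : (⊤ : SetPart n).IsNoncrossing := by
  intro V hV W hW hne
  rw [top_parts hn, Finset.mem_singleton] at hV hW
  exact absurd (hV.trans hW.symm) hne

lemma isInterval_top {n : ℕ} (hn : 1 ≤ n) : (⊤ : SetPart n).IsInterval := by
  intro V hV
  rw [top_parts hn, Finset.mem_singleton] at hV
  simp [hV]

lemma treeFactorial_top {n : ℕ} (hn : 1 ≤ n) : treeFactorial (⊤ : SetPart n) = 1 := by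
  have : Nested (Finset.univ : Finset (Fin n)) Finset.univ :=
    fun w hw => ⟨w, hw, w, hw, le_rfl, le_rfl⟩
  simp [treeFactorial, top_parts hn, Finset.filter_singleton, this]

/-- The free moment-cumulant formula. -/
theorem moment_free (E : ConditionalExpectation B) {n : ℕ} (hn : 1 ≤ n) (x : Fin n → A) :
    E.toLinearMap (List.ofFn x).prod = ∑ π ∈ NC n, multFamily (freeCumulant E) π x := by
  rw [cumulant_spec E NC (fun _ _ => 1) hn (by simp [NC, isNoncrossing_top hn]) rfl]
  simp only [one_smul, freeCumulant]

/-- The Boolean moment-cumulant formula. -/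
theorem moment_boolean (E : ConditionalExpectation B) {n : ℕ} (hn : 1 ≤ n) (x : Fin n → A) :
    E.toLinearMap (List.ofFn x).prod = ∑ π ∈ IntPart n, multFamily (booleanCumulant E) π x := by
  rw [cumulant_spec E IntPart (fun _ _ => 1) hn
    (by simp [IntPart, isNoncrossing_top hn, isInterval_top hn]) rfl]
  simp only [one_smul, booleanCumulant]

/-- The monotone moment-cumulant formula. -/
theorem moment_monotone (E : ConditionalExpectation B) {n : ℕ} (hn : 1 ≤ n) (x : Fin n → A) :
    E.toLinearMap (List.ofFn x).prod =
      ∑ π ∈ NC n, (1 / (treeFactorial π : ℂ)) • multFamily (monotoneCumulant E) π x := by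
  rw [cumulant_spec E NC (fun _ π => 1 / (treeFactorial π : ℂ)) hn
    (by simp [NC, isNoncrossing_top hn]) (by simp [treeFactorial_top hn])]
  rfl

end Cumulants

end OVCumulant

open OVCumulant

/-!
All four formulas come from one flow. Let `h` be the monotone cumulants and let
`b_t = ∑_{π irreducible} t^{|π|} / τ(π)! · h_π` and `M_t = ∑_π t^{|π|} / τ(π)! · h_π`, so that `M_1`
is the moment functional. Splitting off the blocks up to the end of the first block gives
`M_t = 1 + b_t M_t` (a sum over all ways to cut the word in two). If `π` is irreducible, its first
block contributes the factor `|π|` to `τ(π)!`, so `∂ₜ t^{|π|} / τ(π)!` is the product of the weights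
of the partitions in the gaps of that block. Hence `∂ₜ b_t = h ◁ M_t`, where `f ◁ M` (`nest`) inserts
values of `M` into the gaps between the arguments of `f` (`isFlow_hookWeight`).

Expanding `∂ₜ (f ◁ M_t)` shows that the derivative is `(Y f) ◁ M_t`, where `Y` (`insertion`) inserts
one `h` at an interior place of `f`. Hence `b_t` has an explicit Taylor polynomial
`∑ t^{k+1} / (k+1)! · Y^k h` (`IsFlow.boolean_taylor`), and `b` satisfies the semigroup law
`b_{s+t} = b_t + b_s ◁ M_t` (`IsFlow.semigroup`). The cumulants are read off as follows.

* `M_1 = 1 + b_1 M_1` is the Boolean moment-cumulant formula, so the Boolean cumulants are `b_1`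
  (`treeSum_interval`, `booleanCumulant_eq_flow`).
* The semigroup law at `s = -1`, `t = 1` gives `b_1 = (-b_{-1}) ◁ M_1`, which with `M_1 = 1 + b_1 M_1`
  is the free moment-cumulant formula for `-b_{-1}`; so the free cumulants are `-b_{-1}`
  (`IsFlow.treeSum_one`, `freeCumulant_eq_flow`).
* Summing `(b_t)_π` over irreducible `π`, weighted with the number of increasing colorings of the
  blocks of `π` by `N` colors, is an `N`-fold iteration of the semigroup law and gives `b_{tN}`
  (`IsFlow.irrSum_colorings`). Both sides are polynomials in `N`. The coefficient of `N` is
  `∑ ω(π) (b_t)_π` on the left, since the number of colorings is `∑_k N.choose k * ω_k(π)` and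
  the coefficient of `N` in `N.choose k` is `(-1)^{k+1} / k`; on the right it is `t h`
  (`sum_NCirr_muruaOmega`). The times `t = 1` and `t = -1` give the last two formulas.

Partitions are handled as binary trees, whose nodes are the points: the left subtree of a point is
the partition of the points between it and the next point of its block, the right subtree is the
rest of its block with everything that follows; if the point is the last one of its block, the right
subtree is empty and the left one is the partition of all points after it. The value of a tree is
the multiplicative family of the partition (`multFamily_eq_treeVal`). Maps `A^k → B` for all `k` are
collected into functionals on words in `A`, and the Boolean, free and monotone cumulants are
multilinear and right `B`-modular as such (`exists_functional_cumulant`).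
-/

namespace OVCumulant

/-! ### Sums over the factorizations of a word -/

section SplitSum

variable {α W W' : Type*} [AddCommMonoid W] [AddCommMonoid W']

/-- The sum of `Φ u v` over all factorizations `l = u ++ v`. -/
def splitSum : (List α → List α → W) → List α → W
  | Φ, [] => Φ [] []
  | Φ, x :: xs => Φ [] (x :: xs) + splitSum (fun u v => Φ (x :: u) v) xs

@[simp] lemma splitSum_nil (Φ : List α → List α → W) : splitSum Φ [] = Φ [] [] := rfl

lemma splitSum_cons (Φ : List α → List α → W) (x : α) (xs : List α) :
    splitSum Φ (x :: xs) = Φ [] (x :: xs) + splitSum (fun u v => Φ (x :: u) v) xs := rfl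

lemma splitSum_congr {Φ Ψ : List α → List α → W} {l : List α}
    (h : ∀ u v, u ++ v = l → Φ u v = Ψ u v) : splitSum Φ l = splitSum Ψ l := by
  induction l generalizing Φ Ψ with
  | nil => exact h [] [] rfl
  | cons x xs ih =>
    rw [splitSum_cons, splitSum_cons, h [] _ rfl]
    exact congrArg _ (ih fun u v huv => h (x :: u) v (by simp [huv]))

@[simp] lemma splitSum_zero (l : List α) : splitSum (fun _ _ => (0 : W)) l = 0 := by
  induction l with
  | nil => rfl
  | cons x xs ih => rw [splitSum_cons, ih, add_zero]

lemma splitSum_eq_zero {Φ : List α → List α → W} {l : List α}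
    (h : ∀ u v, u ++ v = l → Φ u v = 0) : splitSum Φ l = 0 :=
  (splitSum_congr h).trans (splitSum_zero l)

lemma splitSum_add (Φ Ψ : List α → List α → W) (l : List α) :
    splitSum (fun u v => Φ u v + Ψ u v) l = splitSum Φ l + splitSum Ψ l := by
  induction l generalizing Φ Ψ with
  | nil => rfl
  | cons x xs ih => simp only [splitSum_cons, ih]; exact add_add_add_comm _ _ _ _

lemma map_splitSum {F : Type*} [FunLike F W W'] [AddMonoidHomClass F W W'] (g : F)
    (Φ : List α → List α → W) (l : List α) :
    g (splitSum Φ l) = splitSum (fun u v => g (Φ u v)) l := by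
  induction l generalizing Φ with
  | nil => rfl
  | cons x xs ih => simp only [splitSum_cons, map_add, ih]

lemma splitSum_sum {ι : Type*} (s : Finset ι) (Φ : ι → List α → List α → W) (l : List α) :
    splitSum (fun u v => ∑ i ∈ s, Φ i u v) l = ∑ i ∈ s, splitSum (Φ i) l := by
  induction l generalizing Φ with
  | nil => rfl
  | cons x xs ih => simp only [splitSum_cons, ih, Finset.sum_add_distrib]

lemma splitSum_assoc (Ψ : List α → List α → List α → W) (l : List α) :
    splitSum (fun u v => splitSum (fun a b => Ψ a b v) u) l =
      splitSum (fun a w => splitSum (fun b v => Ψ a b v) w) l := by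
  induction l generalizing Ψ with
  | nil => rfl
  | cons x xs ih => simp only [splitSum_cons, splitSum_nil, splitSum_add, ih, add_assoc]

lemma splitSum_append_cons (Φ : List α → List α → W) (l₁ : List α) (y : α) (l₂ : List α) :
    splitSum Φ (l₁ ++ y :: l₂) = splitSum (fun u v => Φ u (v ++ y :: l₂)) l₁ +
      splitSum (fun u v => Φ (l₁ ++ y :: u) v) l₂ := by
  induction l₁ generalizing Φ with
  | nil => rfl
  | cons x xs ih => simp only [splitSum_cons, List.cons_append, ih, add_assoc]

lemma splitSum_right_nil [DecidableEq α] (φ : List α → W) (l : List α) :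
    splitSum (fun u v => if v = [] then φ u else 0) l = φ l := by
  induction l generalizing φ with
  | nil => rfl
  | cons x xs ih => rw [splitSum_cons, ih fun u => φ (x :: u)]; simp

lemma splitSum_left_nil (φ : List α → W) (l : List α) :
    splitSum (fun u v => if u = [] then φ v else 0) l = φ l := by
  cases l with
  | nil => rfl
  | cons x xs => rw [splitSum_cons]; simp

lemma splitSum_mul {S : Type*} [NonUnitalNonAssocSemiring S] (Φ : List α → List α → S)
    (l : List α) (b : S) : splitSum Φ l * b = splitSum (fun u v => Φ u v * b) l :=
  map_splitSum (AddMonoidHom.mulRight b) Φ l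

lemma smul_splitSum [Module ℂ W] (c : ℂ) (Φ : List α → List α → W) (l : List α) :
    c • splitSum Φ l = splitSum (fun u v => c • Φ u v) l :=
  map_splitSum (DistribSMul.toAddMonoidHom W c) Φ l

end SplitSum

section IsLinearMap

variable {V W : Type*} [AddCommGroup V] [Module ℂ V] [AddCommGroup W] [Module ℂ W]

lemma isLinearMap_zero : IsLinearMap ℂ (fun _ : V => (0 : W)) :=
  (0 : V →ₗ[ℂ] W).isLinear

lemma isLinearMap_add {f g : V → W} (hf : IsLinearMap ℂ f) (hg : IsLinearMap ℂ g) :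
    IsLinearMap ℂ (fun y => f y + g y) :=
  (hf.mk' f + hg.mk' g).isLinear

lemma isLinearMap_comp {U : Type*} [AddCommGroup U] [Module ℂ U] (g : W →ₗ[ℂ] U) {f : V → W}
    (hf : IsLinearMap ℂ f) : IsLinearMap ℂ (fun y => g (f y)) :=
  (g ∘ₗ hf.mk' f).isLinear

lemma isLinearMap_sum {ι : Type*} (s : Finset ι) {f : ι → V → W}
    (hf : ∀ i ∈ s, IsLinearMap ℂ (f i)) : IsLinearMap ℂ (fun y => ∑ i ∈ s, f i y) := by
  classical
  induction s using Finset.induction_on with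
  | empty => simpa using isLinearMap_zero
  | insert i s hi ih =>
    simp only [Finset.sum_insert hi]
    exact isLinearMap_add (hf i (Finset.mem_insert_self i s))
      (ih fun j hj => hf j (Finset.mem_insert_of_mem hj))

lemma isLinearMap_splitSum {α : Type*} (l : List α) {Φ : V → List α → List α → W}
    (h : ∀ u v, IsLinearMap ℂ (fun y => Φ y u v)) :
    IsLinearMap ℂ (fun y => splitSum (Φ y) l) := by
  induction l generalizing Φ with
  | nil => exact h [] []
  | cons x xs ih => exact isLinearMap_add (h _ _) (ih fun u v => h (x :: u) v)

end IsLinearMap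

/-! ### Multilinear functionals on words -/

section Functionals

variable {A : Type*} [Ring A] [Algebra ℂ A] {B : Subalgebra ℂ A}

/-- The functionals on words in `A` with values in `B` that are `ℂ`-linear in each letter; a
sequence of multilinear maps `f_n : A^n → B`, together with a constant `f_0`. -/
def multilinearFunctionals (B : Subalgebra ℂ A) : Submodule ℂ (List A → B) where
  carrier := {f | ∀ l₁ l₂, IsLinearMap ℂ fun y => f (l₁ ++ y :: l₂)}
  add_mem' hf hg l₁ l₂ := isLinearMap_add (hf l₁ l₂) (hg l₁ l₂)
  zero_mem' _ _ := isLinearMap_zero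
  smul_mem' c _ hf l₁ l₂ := isLinearMap_comp (LinearMap.lsmul ℂ B c) (hf l₁ l₂)

/-- The type of multilinear functionals on words. -/
abbrev MLF (B : Subalgebra ℂ A) : Type _ := multilinearFunctionals B

instance : CoeFun (MLF B) fun _ => List A → B := ⟨Subtype.val⟩

/-- Evaluation of functionals at a fixed word. -/
def evalAt (l : List A) : MLF B →ₗ[ℂ] B := LinearMap.proj l ∘ₗ (multilinearFunctionals B).subtype

@[simp] lemma evalAt_apply (l : List A) (f : MLF B) : evalAt l f = f l := rfl

/-- The functional `l ↦ f (y :: l)`, as a bilinear map in `y` and `f`. -/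
def consLeft : A →ₗ[ℂ] MLF B →ₗ[ℂ] MLF B :=
  LinearMap.mk₂ ℂ (fun y f => ⟨fun l => f (y :: l), fun l₁ l₂ => f.2 (y :: l₁) l₂⟩)
    (fun y z f => Subtype.ext (funext fun l => (f.2 [] l).map_add y z))
    (fun c y f => Subtype.ext (funext fun l => (f.2 [] l).map_smul c y))
    (fun _ _ _ => rfl) (fun _ _ _ => rfl)

@[simp] lemma consLeft_apply (y : A) (f : MLF B) (l : List A) : consLeft y f l = f (y :: l) := rfl

/-- The functional `l ↦ f (x * b :: l)`, as a bilinear map in `b` and `f`. -/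
def plug (x : A) : B →ₗ[ℂ] MLF B →ₗ[ℂ] MLF B :=
  consLeft ∘ₗ LinearMap.mulLeft ℂ x ∘ₗ B.val.toLinearMap

@[simp] lemma plug_apply (x : A) (b : B) (f : MLF B) (l : List A) :
    plug x b f l = f (x * (b : A) :: l) := rfl

lemma plug_mul (x : A) (b c : B) (f : MLF B) :
    plug (x * (b : A)) c f = plug x (b * c) f := by
  apply Subtype.ext; funext l
  simp [mul_assoc]

/-- Right `B`-linearity in the last letter. -/
def IsRightModular (f : List A → B) : Prop :=
  ∀ (l : List A) (x : A) (b : B), f (l ++ [x * (b : A)]) = f (l ++ [x]) * b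

lemma IsRightModular.plug {f : MLF B} (hf : IsRightModular f) (x : A) (b : B) :
    IsRightModular (plug x b f) :=
  fun l y c => hf (x * (b : A) :: l) y c

lemma IsRightModular.singleton {f : MLF B} (hf : IsRightModular f) (x : A) (b : B) :
    f [x * (b : A)] = f [x] * b := hf [] x b

/-- Replace the constant of a functional by `1`. -/
def unitize (f : MLF B) : MLF B :=
  ⟨fun l => if l = [] then 1 else f l, fun l₁ l₂ => by simpa using f.2 l₁ l₂⟩

@[simp] lemma unitize_nil (f : MLF B) : unitize f [] = 1 := rfl

lemma unitize_of_ne_nil (f : MLF B) {l : List A} (hl : l ≠ []) : unitize f l = f l := if_neg hl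

lemma IsRightModular.unitize {f : MLF B} (hf : IsRightModular f) :
    IsRightModular (unitize f) := by
  intro l x b
  rw [unitize_of_ne_nil _ (by simp), unitize_of_ne_nil _ (by simp), hf]

/-! ### Nested insertion -/

section Nest

variable (M : List A → B)

/-- Auxiliary recursion for `nest`: `x` is the last letter that was selected and `u` collects the
letters read since. -/
def nestAux : List A → A → List A → MLF B →ₗ[ℂ] B
  | [], x, u => if u = [] then evalAt [x] else 0
  | z :: zs, x, u => nestAux zs x (u ++ [z]) + nestAux zs z [] ∘ₗ plug x (M u)

/-- `nest M l f` is the sum, over the subsequences `x_{i₁}, …, x_{i_k}` of `l` that contain the first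
and the last letter, of `f (x_{i₁} M(u₁), …, x_{i_{k-1}} M(u_{k-1}), x_{i_k})`, where `u_j` is
the word formed by the letters strictly between `x_{i_j}` and `x_{i_{j+1}}`. -/
def nest : List A → MLF B →ₗ[ℂ] B
  | [] => 0
  | x :: xs => nestAux M xs x []

@[simp] lemma nest_nil (f : MLF B) : nest M [] f = 0 := rfl

lemma nestAux_eq (xs : List A) (x : A) (u : List A) (f : MLF B) :
    nestAux M xs x u f = (if u ++ xs = [] then f [x] else 0) +
      splitSum (fun a v => nest M v (plug x (M (u ++ a)) f)) xs := by
  induction xs generalizing x u f with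
  | nil => by_cases hu : u = [] <;> simp [nestAux, hu]
  | cons z zs ih =>
    rw [nestAux, LinearMap.add_apply, ih, splitSum_cons]
    simp [nest, add_comm]

lemma nest_cons (x : A) (xs : List A) (f : MLF B) :
    nest M (x :: xs) f = (if xs = [] then f [x] else 0) +
      splitSum (fun u v => nest M v (plug x (M u) f)) xs := by
  rw [nest, nestAux_eq]; rfl

variable {M}

/-- `nest M l f` involves `f` only on non-empty words not longer than `l`. -/
lemma nest_congr {l : List A} {f g : MLF B}
    (h : ∀ l', l' ≠ [] → l'.length ≤ l.length → f l' = g l') : nest M l f = nest M l g := by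
  induction hn : l.length using Nat.strong_induction_on generalizing l f g with
  | _ n ih =>
    cases l with
    | nil => rfl
    | cons x xs =>
      rw [nest_cons, nest_cons, h [x] (by simp) (by simp)]
      congr 1
      refine splitSum_congr fun u v huv => ih v.length ?_ (fun l' _ hle => ?_) rfl
      · rw [← hn, ← huv]; simp
      · exact h _ (by simp) (by rw [← huv]; simp; omega)

/-- `nest M l f` involves `M` only on words shorter than `l`. -/
lemma nest_congr_left {M' : List A → B} {l : List A} (f : MLF B)
    (h : ∀ u, u.length < l.length → M u = M' u) : nest M l f = nest M' l f := by
  induction hn : l.length using Nat.strong_induction_on generalizing l f with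
  | _ n ih =>
    cases l with
    | nil => rfl
    | cons x xs =>
      rw [nest_cons, nest_cons]
      congr 1
      refine splitSum_congr fun u v huv => ?_
      rw [h u (by rw [← huv]; simp)]
      refine ih v.length ?_ _ (fun u' hu' => h u' (hu'.trans ?_)) rfl
      · rw [← hn, ← huv]; simp
      · rw [← huv]; simp

/-- If `M` vanishes on non-empty words then nested insertion does nothing. -/
lemma nest_unit (h1 : M [] = 1) (h0 : ∀ u, u ≠ [] → M u = 0) {l : List A} (hl : l ≠ [])
    (f : MLF B) : nest M l f = f l := by
  induction l generalizing f with
  | nil => exact absurd rfl hl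
  | cons x xs ih =>
    have key : splitSum (fun u v => nest M v (plug x (M u) f)) xs = nest M xs (plug x 1 f) := by
      rw [← splitSum_left_nil (fun v => nest M v (plug x 1 f)) xs]
      refine splitSum_congr fun u v _ => ?_
      by_cases hu : u = []
      · simp [hu, h1]
      · simp [hu, h0 u hu]
    rw [nest_cons, key]
    by_cases hxs : xs = []
    · simp [hxs]
    · rw [ih hxs, if_neg hxs, zero_add]; simp

end Nest

/-! ### Insertion of one block -/

section Insertion

/-- The sum of `f (y h(u), v)` over the factorizations `l = u ++ v` into non-empty words. -/
def insertAfter (h : MLF B) (y : A) (f : MLF B) : MLF B :=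
  ⟨fun l => splitSum (fun u v => if u = [] ∨ v = [] then 0 else f (y * (h u : A) :: v)) l, by
    intro l₁ l₂
    simp only [splitSum_append_cons]
    refine isLinearMap_add (isLinearMap_splitSum _ fun u v => ?_)
      (isLinearMap_splitSum _ fun u v => ?_)
    · by_cases hu : u = []
      · simpa [hu] using isLinearMap_zero
      · simpa [hu] using f.2 (y * (h u : A) :: v) l₂
    · by_cases hv : v = []
      · simpa [hv] using isLinearMap_zero
      · simpa [hv] using isLinearMap_comp ((evalAt v ∘ₗ (plug y).flip f)) (h.2 l₁ u)⟩

lemma insertAfter_apply (h : MLF B) (y : A) (f : MLF B) (l : List A) :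
    insertAfter h y f l =
      splitSum (fun u v => if u = [] ∨ v = [] then 0 else f (y * (h u : A) :: v)) l := rfl

/-- Recursion for `insertion`. -/
def insertionFun (h : MLF B) : List A → MLF B → B
  | [], _ => 0
  | x :: xs, f => insertionFun h xs (consLeft x f) + insertAfter h x f xs

lemma insertionFun_linear (h : MLF B) (l : List A) :
    IsLinearMap ℂ fun f => insertionFun h l f := by
  induction l with
  | nil => exact isLinearMap_zero
  | cons x xs ih =>
    refine isLinearMap_add ((ih.mk' _ ∘ₗ consLeft x).isLinear) ?_
    simp only [insertAfter_apply]
    refine isLinearMap_splitSum _ fun u v => ?_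
    by_cases hu : u = [] ∨ v = []
    · simpa [hu] using isLinearMap_zero
    · simp only [if_neg hu]
      exact (evalAt v ∘ₗ plug x (h u)).isLinear

/-- The derivation-like operator that inserts one block `h` at all possible inner places:
`insertion h f (x₁, …, x_n) = ∑_{1 ≤ i < j < n} f (x₁, …, x_i h(x_{i+1}, …, x_j), …, x_n)`. -/
def insertion (h f : MLF B) : MLF B :=
  ⟨fun l => insertionFun h l f, by
    intro l₁
    induction l₁ generalizing f with
    | nil =>
      intro l₂
      refine isLinearMap_add
        (((insertionFun_linear h l₂).mk' _ ∘ₗ consLeft.flip f).isLinear) ?_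
      simp only [insertAfter_apply]
      refine isLinearMap_splitSum _ fun u v => ?_
      by_cases hu : u = [] ∨ v = []
      · simpa [hu] using isLinearMap_zero
      · simp only [if_neg hu]
        exact (evalAt v ∘ₗ consLeft.flip f ∘ₗ LinearMap.mulRight ℂ (h u : A)).isLinear
    | cons x xs ih => exact fun l₂ => isLinearMap_add (ih _ l₂) ((insertAfter h x f).2 xs l₂)⟩

@[simp] lemma insertion_nil (h f : MLF B) : insertion h f [] = 0 := rfl

lemma insertion_cons (h f : MLF B) (x : A) (xs : List A) :
    insertion h f (x :: xs) = insertion h (consLeft x f) xs + insertAfter h x f xs := rfl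

@[simp] lemma insertion_singleton (h f : MLF B) (x : A) : insertion h f [x] = 0 := by
  simp [insertion_cons, insertAfter_apply]

lemma plug_insertion (h f : MLF B) (x : A) (b : B) :
    plug x b (insertion h f) = insertion h (plug x b f) + insertAfter h (x * (b : A)) f := rfl

/-- `insertion h` lowers the number of letters seen by `f`. -/
lemma insertion_eq_zero {h f : MLF B} {n : ℕ}
    (hf : ∀ l : List A, l ≠ [] → l.length ≤ n → f l = 0)
    (l : List A) (hl : l.length ≤ n + 1) : insertion h f l = 0 := by
  induction l generalizing f n with
  | nil => rfl
  | cons x xs ih =>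
    rw [insertion_cons, insertAfter_apply, splitSum_eq_zero, add_zero]
    · rcases n with _ | n
      · have : xs = [] := by simpa using hl
        rw [this]; rfl
      · exact ih (n := n) (fun l hl hle => hf (x :: l) (by simp) (by simpa using hle))
          (by simpa using hl)
    · intro u v huv
      split_ifs with huv'
      · rfl
      · refine hf _ (by simp) ?_
        have : 0 < u.length := List.length_pos_iff.2 fun hu => huv' (Or.inl hu)
        have := congrArg List.length huv
        simp at this hl ⊢
        omega

lemma iterate_insertion_eq_zero (h f : MLF B) {n : ℕ} {l : List A} (hl : l ≠ [])
    (hn : l.length ≤ n) : (insertion h)^[n] f l = 0 := by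
  induction n generalizing l with
  | zero => exact absurd (List.length_eq_zero_iff.1 (by omega)) hl
  | succ n ih =>
    rw [Function.iterate_succ_apply']
    exact insertion_eq_zero (fun l' hl' hn' => ih hl' hn') l hn

/-- Nested insertion into `insertAfter`: the inserted `h` becomes `nest M · h`, followed by `M`. -/
lemma nest_insertAfter (M : List A → B) {h : MLF B} (hh : IsRightModular h) (y : A) (f : MLF B)
    (l : List A) :
    nest M l (insertAfter h y f) = splitSum (fun p q =>
      nest M q (plug y (splitSum (fun a s => nest M a h * M s) p) f)) l := by
  induction hn : l.length using Nat.strong_induction_on generalizing l h with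
  | _ n ih =>
    cases l with
    | nil => rfl
    | cons z zs =>
      -- Either the inserted block continues after `z`, with `plug z b h` in place of `h`, or `z` is its
      -- only letter; in the latter case right modularity turns `h [z * b]` into `h [z] * b`.
      have e1 : ∀ (b : B) (w : List A), nest M w (plug z b (insertAfter h y f)) =
          nest M w (insertAfter (plug z b h) y f) + nest M w (plug y (h [z] * b) f) := by
        intro b w
        rw [← map_add]
        refine nest_congr fun l' hl' _ => ?_
        have e2 : splitSum (fun u v => if u = [] then (if v = [] then 0 else
            f (y * (h [z] * b : B) :: v)) else 0) l' = f (y * (h [z] * b : B) :: l') := by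
          rw [splitSum_left_nil fun v => if v = [] then 0 else f (y * (h [z] * b : B) :: v),
            if_neg hl']
        change insertAfter h y f (z * (b : A) :: l') = insertAfter (plug z b h) y f l' +
          f (y * (h [z] * b : B) :: l')
        rw [← e2, insertAfter_apply, insertAfter_apply, splitSum_cons, if_pos (Or.inl rfl),
          zero_add, ← splitSum_add]
        refine splitSum_congr fun u v _ => ?_
        by_cases hu : u = []
        · simp [hu, hh.singleton]
        · simp [hu]
      rw [nest_cons, splitSum_cons]
      have e3 : insertAfter h y f [z] = 0 := by simp [insertAfter_apply, splitSum_cons]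
      have e4 : splitSum (fun a s => nest M a h * M s) [] = 0 := by simp
      rw [e3, e4, ite_self, zero_add, map_zero, LinearMap.zero_apply, map_zero, zero_add]
      simp only [e1, splitSum_add]
      -- The right-hand side splits in the same way, by the second letter of the inserted block.
      have e5 : ∀ p, splitSum (fun a s => nest M a h * M s) (z :: p) =
          splitSum (fun s w => splitSum (fun a t => nest M a (plug z (M s) h) * M t) w) p +
            h [z] * M p := by
        intro p
        rw [splitSum_cons, nest_nil, zero_mul, zero_add, ← splitSum_assoc,
          ← splitSum_left_nil (fun s => h [z] * M s) p, ← splitSum_add]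
        refine splitSum_congr fun a s _ => ?_
        rw [nest_cons, add_mul, add_comm]
        congr 1
        · exact map_splitSum (AddMonoidHom.mulRight (M s)) _ a
        · split_ifs <;> simp
      simp only [e5, map_add, LinearMap.add_apply, splitSum_add]
      congr 1
      simp only [map_splitSum (plug y)]
      have e6 : ∀ (Φ : List A → List A → MLF B →ₗ[ℂ] MLF B) (p q : List A),
          nest M q (splitSum Φ p f) = splitSum (fun s w => nest M q (Φ s w f)) p := by
        intro Φ p q
        exact map_splitSum (nest M q ∘ₗ LinearMap.applyₗ f) Φ p
      simp only [e6]
      rw [splitSum_assoc]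
      refine splitSum_congr fun s w hw => ?_
      rw [ih w.length (by rw [← hn, ← hw]; simp) (hh.plug z (M s)) w rfl]
      refine splitSum_congr fun p q _ => ?_
      rw [map_splitSum (plug y)]
      rw [e6]

end Insertion

end Functionals

/-! ### Polynomial functions and their derivatives -/

section PolyDeriv

variable {W W' U : Type*} [AddCommGroup W] [Module ℂ W] [AddCommGroup W'] [Module ℂ W']
  [AddCommGroup U] [Module ℂ U]

/-- `PolyDeriv φ φ'`: the function `φ : ℂ → W` is a polynomial with coefficients in the complex
vector space `W`, and `φ'` is its derivative. No topology on `W` is involved. -/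
inductive PolyDeriv : (ℂ → W) → (ℂ → W) → Prop
  | const (c : W) : PolyDeriv (fun _ => c) (fun _ => 0)
  | add {φ φ' χ χ' : ℂ → W} : PolyDeriv φ φ' → PolyDeriv χ χ' →
      PolyDeriv (fun t => φ t + χ t) (fun t => φ' t + χ' t)
  | smul {φ φ' : ℂ → W} : PolyDeriv φ φ' → PolyDeriv (fun t => t • φ t) (fun t => φ t + t • φ' t)

namespace PolyDeriv

lemma congr {φ φ' χ χ' : ℂ → W} (h : PolyDeriv φ φ') (h1 : ∀ t, φ t = χ t)
    (h2 : ∀ t, φ' t = χ' t) : PolyDeriv χ χ' := by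
  obtain rfl : φ = χ := funext h1
  obtain rfl : φ' = χ' := funext h2
  exact h

lemma map (L : W →ₗ[ℂ] U) {φ φ' : ℂ → W} (h : PolyDeriv φ φ') :
    PolyDeriv (fun t => L (φ t)) (fun t => L (φ' t)) := by
  induction h with
  | const c => exact (const (L c)).congr (fun _ => rfl) (fun _ => by simp)
  | add _ _ h1 h2 => exact (h1.add h2).congr (fun _ => by simp) (fun _ => by simp)
  | smul _ h => exact h.smul.congr (fun _ => by simp) (fun _ => by simp)

lemma bilin (L : W →ₗ[ℂ] W' →ₗ[ℂ] U) {φ φ' : ℂ → W} {χ χ' : ℂ → W'} (h : PolyDeriv φ φ')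
    (hχ : PolyDeriv χ χ') :
    PolyDeriv (fun t => L (φ t) (χ t)) (fun t => L (φ' t) (χ t) + L (φ t) (χ' t)) := by
  induction h with
  | const c => exact (hχ.map (L c)).congr (fun _ => rfl) (fun _ => by simp)
  | add _ _ h1 h2 =>
    exact (h1.add h2).congr (fun _ => by simp) (fun _ => by simp; abel)
  | smul _ h => exact h.smul.congr (fun _ => by simp) (fun _ => by simp; abel)

lemma sum {ι : Type*} (s : Finset ι) {φ φ' : ι → ℂ → W} (h : ∀ i ∈ s, PolyDeriv (φ i) (φ' i)) :
    PolyDeriv (fun t => ∑ i ∈ s, φ i t) (fun t => ∑ i ∈ s, φ' i t) := by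
  classical
  induction s using Finset.induction_on with
  | empty => simpa using const (0 : W)
  | insert i s hi ih =>
    simp only [Finset.sum_insert hi]
    exact (h i (Finset.mem_insert_self i s)).add
      (ih fun j hj => h j (Finset.mem_insert_of_mem hj))

lemma splitSum {α : Type*} {l : List α} {φ φ' : ℂ → List α → List α → W}
    (h : ∀ u v, u ++ v = l → PolyDeriv (fun t => φ t u v) (fun t => φ' t u v)) :
    PolyDeriv (fun t => splitSum (φ t) l) (fun t => OVCumulant.splitSum (φ' t) l) := by
  induction l generalizing φ φ' with
  | nil => exact h [] [] rfl
  | cons x xs ih => exact (h _ _ rfl).add (ih fun u v huv => h (x :: u) v (by simp [huv]))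

lemma pow (k : ℕ) (c : W) :
    PolyDeriv (fun t : ℂ => t ^ (k + 1) • c) (fun t => ((k + 1 : ℂ) * t ^ k) • c) := by
  induction k with
  | zero => exact (const c).smul.congr (fun t => by simp) (fun t => by simp)
  | succ k ih =>
    refine ih.smul.congr (fun t => ?_) (fun t => ?_)
    · rw [smul_smul]; congr 1; ring
    · rw [smul_smul, ← add_smul]; congr 1; push_cast; ring

lemma hasDerivAt (ℓ : W →ₗ[ℂ] ℂ) {φ φ' : ℂ → W} (h : PolyDeriv φ φ') (t : ℂ) :
    HasDerivAt (fun t => ℓ (φ t)) (ℓ (φ' t)) t := by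
  induction h with
  | const c => simpa using hasDerivAt_const t (ℓ c)
  | add _ _ h1 h2 => simp only [map_add]; exact h1.add h2
  | smul _ h =>
    simp only [map_add, map_smul, smul_eq_mul]
    exact ((hasDerivAt_id t).mul h).congr_deriv (by simp)

/-- A polynomial is determined by its derivative and its value at `0`. -/
lemma unique {φ χ φ' : ℂ → W} (h1 : PolyDeriv φ φ') (h2 : PolyDeriv χ φ') (h0 : φ 0 = χ 0)
    (t : ℂ) : φ t = χ t := by
  rw [← sub_eq_zero, ← Module.forall_dual_apply_eq_zero_iff ℂ]
  intro ℓ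
  have hd : ∀ s, HasDerivAt (fun s => ℓ (φ s) - ℓ (χ s)) 0 s := fun s =>
    ((h1.hasDerivAt ℓ s).sub (h2.hasDerivAt ℓ s)).congr_deriv (sub_self _)
  have := is_const_of_deriv_eq_zero (fun s => (hd s).differentiableAt) (fun s => (hd s).deriv) t 0
  simpa [h0] using this

end PolyDeriv

end PolyDeriv

/-! ### The one-parameter semigroup generated by the insertion of a block -/

section Flow

variable {A : Type*} [Ring A] [Algebra ℂ A] {B : Subalgebra ℂ A}

/-- A flow with generator `h`: Boolean-type functionals `b t` and moment-type functionals `M t`,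
related by `M t = (1 - b t)⁻¹`, that start at `b 0 = 0` and solve the differential equation
`∂ₜ b t = nest (M t) · h`. -/
structure IsFlow (h : MLF B) (b : ℂ → MLF B) (M : ℂ → List A → B) : Prop where
  nil : ∀ t, b t [] = 0
  zero : ∀ l, b 0 l = 0
  moment : ∀ t l, M t l = (if l = [] then 1 else 0) + splitSum (fun a c => b t a * M t c) l
  deriv : ∀ l, PolyDeriv (fun t => b t l) (fun t => nest (M t) l h)

namespace IsFlow

variable {h : MLF B} {b : ℂ → MLF B} {M : ℂ → List A → B}

lemma moment_nil (H : IsFlow h b M) (t : ℂ) : M t [] = 1 := by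
  rw [H.moment]; simp [H.nil]

lemma moment_zero (H : IsFlow h b M) {l : List A} (hl : l ≠ []) : M 0 l = 0 := by
  rw [H.moment, if_neg hl, splitSum_eq_zero, add_zero]
  intro u v _
  rw [H.zero, zero_mul]

/-- The derivative of `M = (1 - b)⁻¹` is `M b' M`. -/
lemma moment_deriv (H : IsFlow h b M) (l : List A) :
    PolyDeriv (fun t => M t l) (fun t => splitSum (fun a s => M t a *
      splitSum (fun p q => nest (M t) p h * M t q) s) l) := by
  induction hn : l.length using Nat.strong_induction_on generalizing l with
  | _ n ih =>
    have hsum : PolyDeriv (fun t => splitSum (fun a c => b t a * M t c) l)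
        (fun t => splitSum (fun a c => nest (M t) a h * M t c + b t a * splitSum (fun a s => M t a *
          splitSum (fun p q => nest (M t) p h * M t q) s) c) l) := by
      refine PolyDeriv.splitSum fun u v huv => ?_
      by_cases hu : u = []
      · subst hu
        exact (PolyDeriv.const 0).congr (fun t => by simp [H.nil]) (fun t => by simp [H.nil])
      · have : 0 < u.length := List.length_pos_iff.2 hu
        -- Since `b` has no constant term, the induction hypothesis applies to the shorter word `v`.
        exact (H.deriv u).bilin (LinearMap.mul ℂ B)
          (ih v.length (by rw [← hn, ← huv]; simp; omega) v rfl)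
    refine ((PolyDeriv.const (if l = [] then (1 : B) else 0)).add hsum).congr
      (fun t => (H.moment t l).symm) (fun t => ?_)
    -- `M b' M = b' M + b (M b' M)`, by `M = 1 + b M`.
    have e : ∀ a s, M t a * splitSum (fun p q => nest (M t) p h * M t q) s =
        (if a = [] then splitSum (fun p q => nest (M t) p h * M t q) s else 0) +
          splitSum (fun p q => b t p *
            (M t q * splitSum (fun p q => nest (M t) p h * M t q) s)) a := by
      intro a s
      rw [H.moment t a, add_mul]
      congr 1
      · split_ifs <;> simp
      · refine (map_splitSum (AddMonoidHom.mulRight _) _ a).trans (splitSum_congr fun p q _ => ?_)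
        simp [mul_assoc]
    rw [splitSum_congr fun a s _ => e a s, splitSum_add, splitSum_add, zero_add, splitSum_left_nil,
      splitSum_assoc]
    congr 1
    refine splitSum_congr fun p w _ => ?_
    exact map_splitSum (AddMonoidHom.mulLeft (b t p)) _ w

/-- Nested insertion of the flow is differentiated by the insertion of one block. -/
lemma nest_deriv (H : IsFlow h b M) (hh : IsRightModular h) (l : List A) {f f' : ℂ → MLF B}
    (hf : PolyDeriv f f') :
    PolyDeriv (fun t => nest (M t) l (f t))
      (fun t => nest (M t) l (f' t) + nest (M t) l (insertion h (f t))) := by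
  induction hn : l.length using Nat.strong_induction_on generalizing l f f' with
  | _ n ih =>
    cases l with
    | nil => exact (PolyDeriv.const 0).congr (fun _ => rfl) (fun _ => by simp)
    | cons x xs =>
      have h1 : PolyDeriv (fun t => if xs = [] then f t [x] else 0)
          (fun t => if xs = [] then f' t [x] else 0) := by
        split_ifs
        · exact hf.map (evalAt [x])
        · exact PolyDeriv.const 0
      have h2 := PolyDeriv.splitSum (l := xs) fun u v huv =>
        ih v.length (by rw [← hn, ← huv]; simp) v
          ((H.moment_deriv u).bilin (plug x) hf) rfl
      refine (h1.add h2).congr (fun t => (nest_cons _ _ _ _).symm) (fun t => ?_)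
      -- Differentiating the gap after `x` inserts `M b' M` there. This is a gap filled with `M`, followed
      -- by a nested `h`, followed by `M`, which is what `insertAfter` produces.
      have e : splitSum (fun u v => nest (M t) v (plug x (splitSum (fun a s => M t a *
            splitSum (fun p q => nest (M t) p h * M t q) s) u) (f t))) xs =
          splitSum (fun u v => nest (M t) v (insertAfter h (x * (M t u : A)) (f t))) xs := by
        simp only [nest_insertAfter _ hh, plug_mul]
        rw [← splitSum_assoc]
        refine splitSum_congr fun u v _ => ?_
        exact map_splitSum (nest (M t) v ∘ₗ LinearMap.applyₗ (f t) ∘ₗ plug x) _ u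
      simp only [nest_cons, plug_insertion, map_add, splitSum_add, insertion_singleton, ite_self,
        e]
      abel

/-- By induction on `n`: both sides have the derivative given by the formula for `insertion h f`, and
they agree at `t = 0`, where `M` is the unit. -/
lemma nest_taylor_of_vanish (H : IsFlow h b M) (hh : IsRightModular h) {l : List A} (hl : l ≠ [])
    (n : ℕ) (f : MLF B)
    (hf : ∀ l', l' ≠ [] → l'.length ≤ l.length → (insertion h)^[n] f l' = 0) (t : ℂ) :
    nest (M t) l f =
      ∑ k ∈ Finset.range n, (t ^ k / (k.factorial : ℂ)) • (insertion h)^[k] f l := by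
  induction n generalizing f t with
  | zero =>
    rw [nest_congr (g := 0) (fun l' h1 h2 => by simpa using hf l' h1 h2)]
    simp
  | succ n ih =>
    have hY := ih (insertion h f) (fun l' h1 h2 => by
      rw [← Function.iterate_succ_apply]; exact hf l' h1 h2)
    have d1 := H.nest_deriv hh l (PolyDeriv.const f)
    simp only [map_zero, zero_add, hY] at d1
    refine d1.unique (χ := fun t => ∑ k ∈ Finset.range (n + 1),
      (t ^ k / (k.factorial : ℂ)) • (insertion h)^[k] f l) ?_ ?_ t
    · have d2 := (PolyDeriv.sum (Finset.range n) fun k _ =>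
        PolyDeriv.pow k ((((k + 1).factorial : ℂ)⁻¹) • (insertion h)^[k + 1] f l)).add
          (PolyDeriv.const (f l))
      refine d2.congr (fun t => ?_) (fun t => ?_)
      · rw [Finset.sum_range_succ']
        simp [smul_smul, div_eq_mul_inv]
      · rw [add_zero]
        refine Finset.sum_congr rfl fun k _ => ?_
        rw [smul_smul, Function.iterate_succ_apply]
        congr 1
        have : (k + 1 : ℂ) ≠ 0 := by exact_mod_cast Nat.succ_ne_zero k
        have : (k.factorial : ℂ) ≠ 0 := by exact_mod_cast k.factorial_ne_zero
        rw [Nat.factorial_succ]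
        push_cast
        field_simp
    -- At time `0` nothing is inserted.
    · rw [nest_unit (H.moment_nil 0) (fun u hu => H.moment_zero hu) hl, Finset.sum_range_succ']
      simp

/-- The exponential formula: nested insertion at time `t` is `exp (t · insertion h)`. -/
lemma nest_taylor (H : IsFlow h b M) (hh : IsRightModular h) {l : List A} (hl : l ≠ [])
    {n : ℕ} (hn : l.length ≤ n) (f : MLF B) (t : ℂ) :
    nest (M t) l f =
      ∑ k ∈ Finset.range n, (t ^ k / (k.factorial : ℂ)) • (insertion h)^[k] f l :=
  H.nest_taylor_of_vanish hh hl n f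
    (fun _ h1 h2 => iterate_insertion_eq_zero h f h1 (h2.trans hn)) t

/-- The integrated exponential formula for `b`. -/
lemma boolean_taylor (H : IsFlow h b M) (hh : IsRightModular h) {l : List A} (hl : l ≠ [])
    {n : ℕ} (hn : l.length ≤ n) (t : ℂ) :
    b t l = ∑ k ∈ Finset.range n,
      (t ^ (k + 1) / ((k + 1).factorial : ℂ)) • (insertion h)^[k] h l := by
  refine (H.deriv l).unique (χ := fun t => ∑ k ∈ Finset.range n,
      (t ^ (k + 1) / ((k + 1).factorial : ℂ)) • (insertion h)^[k] h l) ?_ ?_ t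
  · refine (PolyDeriv.sum (Finset.range n) fun k _ =>
        PolyDeriv.pow k ((((k + 1).factorial : ℂ)⁻¹) • (insertion h)^[k] h l)).congr
        (fun t => ?_) (fun t => ?_)
    · simp [smul_smul, div_eq_mul_inv]
    · rw [H.nest_taylor hh hl hn]
      refine Finset.sum_congr rfl fun k _ => ?_
      rw [smul_smul]
      congr 1
      have : (k + 1 : ℂ) ≠ 0 := by exact_mod_cast Nat.succ_ne_zero k
      have : (k.factorial : ℂ) ≠ 0 := by exact_mod_cast k.factorial_ne_zero
      rw [Nat.factorial_succ]
      push_cast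
      field_simp
  · simp [H.zero]

/-- The binomial theorem, with the term that does not involve `s` split off. -/
lemma sum_pow_div_factorial (s t : ℂ) (m : ℕ) :
    (s + t) ^ (m + 1) / ((m + 1).factorial : ℂ) = t ^ (m + 1) / ((m + 1).factorial : ℂ) +
      ∑ p ∈ Finset.HasAntidiagonal.antidiagonal m,
        t ^ p.1 / (p.1.factorial : ℂ) * (s ^ (p.2 + 1) / ((p.2 + 1).factorial : ℂ)) := by
  have hf : ∀ k : ℕ, (k.factorial : ℂ) ≠ 0 := fun k => by exact_mod_cast k.factorial_ne_zero
  have h1 : (s + t) ^ (m + 1) / ((m + 1).factorial : ℂ) =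
      ∑ p ∈ Finset.HasAntidiagonal.antidiagonal (m + 1),
        t ^ p.1 / (p.1.factorial : ℂ) * (s ^ p.2 / (p.2.factorial : ℂ)) := by
    rw [add_comm s t, Commute.add_pow' (Commute.all _ _), Finset.sum_div]
    refine Finset.sum_congr rfl fun p hp => ?_
    rw [← Finset.HasAntidiagonal.mem_antidiagonal.1 hp, nsmul_eq_mul, Nat.cast_add_choose]
    have := hf (p.1 + p.2)
    have := hf p.1
    have := hf p.2
    field_simp
  rw [h1, Finset.Nat.antidiagonal_succ']
  simp

/-- The semigroup law of the flow: by the exponential formulas, it is the binomial theorem. -/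
theorem semigroup (H : IsFlow h b M) (hh : IsRightModular h) (s t : ℂ) (l : List A) :
    b (s + t) l = b t l + nest (M t) l (b s) := by
  rcases eq_or_ne l [] with rfl | hl
  · simp [H.nil]
  set n := l.length with hn
  have hvan : ∀ k, n ≤ k → (insertion h)^[k] h l = 0 := fun k hk =>
    iterate_insertion_eq_zero h h hl hk
  have h1 : nest (M t) l (b s) = nest (M t) l (∑ k ∈ Finset.range n,
      (s ^ (k + 1) / ((k + 1).factorial : ℂ)) • (insertion h)^[k] h) := by
    refine nest_congr fun l' hl' hle => ?_
    rw [H.boolean_taylor hh hl' hle]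
    simp [hn]
  have h2 : nest (M t) l (b s) = ∑ k ∈ Finset.range n, ∑ j ∈ Finset.range n,
      (t ^ j / (j.factorial : ℂ) * (s ^ (k + 1) / ((k + 1).factorial : ℂ))) •
        (insertion h)^[j + k] h l := by
    rw [h1, map_sum]
    refine Finset.sum_congr rfl fun k _ => ?_
    rw [map_smul, H.nest_taylor hh hl hn.le, Finset.smul_sum]
    refine Finset.sum_congr rfl fun j _ => ?_
    rw [smul_smul, Function.iterate_add_apply, mul_comm]
  -- The square of summation indices may be replaced by a triangle, since iterates of order at least
  -- `n` vanish on `l`.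
  have h3 : nest (M t) l (b s) = ∑ m ∈ Finset.range n, ∑ p ∈ Finset.HasAntidiagonal.antidiagonal m,
      (t ^ p.1 / (p.1.factorial : ℂ) * (s ^ (p.2 + 1) / ((p.2 + 1).factorial : ℂ))) •
        (insertion h)^[m] h l := by
    rw [h2, Finset.sum_comm, ← Finset.sum_product', Finset.sum_sigma']
    symm
    refine Finset.sum_of_injOn (fun x => x.2) ?_ ?_ ?_ ?_
    · rintro ⟨m, p⟩ hx ⟨m', p'⟩ hx' (hpp : p = p')
      subst hpp
      simp only [Finset.coe_sigma, Set.mem_sigma_iff, Finset.mem_coe,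
        Finset.HasAntidiagonal.mem_antidiagonal] at hx hx'
      obtain rfl : m = m' := hx.2.symm.trans hx'.2
      rfl
    · rintro ⟨m, p⟩ hx
      simp only [Finset.coe_sigma, Set.mem_sigma_iff, Finset.mem_coe, Finset.mem_range,
        Finset.HasAntidiagonal.mem_antidiagonal, Finset.coe_product, Set.mem_prod] at hx ⊢
      omega
    · intro p _ hnot
      rw [hvan _ ?_, smul_zero]
      by_contra hlt
      exact hnot ⟨⟨p.1 + p.2, p⟩, by simpa using hlt, rfl⟩
    · rintro ⟨m, p⟩ hx
      simp only [Finset.mem_sigma, Finset.HasAntidiagonal.mem_antidiagonal] at hx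
      rw [← hx.2]
  rw [h3, H.boolean_taylor hh hl hn.le, H.boolean_taylor hh hl hn.le, ← Finset.sum_add_distrib]
  refine Finset.sum_congr rfl fun m _ => ?_
  rw [sum_pow_div_factorial, add_smul, Finset.sum_smul]

end IsFlow

end Flow

/-! ### Binary trees as non-crossing partitions -/

/-- Binary trees encode non-crossing partitions of a word, one node for each letter. In
`node () G R` the root is the first letter, `G` encodes the partition of the letters that directly
follow it up to the next letter of its block (up to the end of the word if there is none), and `R`
encodes the remaining letters, the rest of the block of the first letter being the first block of
`R`; thus `R = nil` if the first letter is the last one of its block. -/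
abbrev NCTree : Type := BinaryTree Unit

namespace NCTree

open BinaryTree

/-- The trees with `n` nodes. -/
abbrev ofSize (n : ℕ) : Finset NCTree := treesOfNumNodesEq n

lemma sum_ofSize_succ {W : Type*} [AddCommMonoid W] (n : ℕ) (Φ : NCTree → W) :
    ∑ T ∈ ofSize (n + 1), Φ T = ∑ p ∈ Finset.HasAntidiagonal.antidiagonal n,
      ∑ G ∈ ofSize p.1, ∑ R ∈ ofSize p.2, Φ (node () G R) := by
  rw [ofSize, treesOfNumNodesEq_succ, Finset.sum_biUnion]
  · refine Finset.sum_congr rfl fun p _ => ?_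
    rw [pairwiseNode, Finset.sum_map, Finset.sum_product]
    rfl
  · intro p _ q _ hpq
    simp only [Function.onFun, Finset.disjoint_left, pairwiseNode, Finset.mem_map,
      Finset.mem_product, Prod.exists, not_exists]
    rintro T ⟨G, R, ⟨hG, hR⟩, rfl⟩ G' R' ⟨⟨hG', hR'⟩, h⟩
    obtain ⟨-, rfl, rfl⟩ := node.inj h
    rw [mem_treesOfNumNodesEq] at hG hR hG' hR'
    exact hpq (Prod.ext (hG.symm.trans hG') (hR.symm.trans hR'))

/-- The partition of the letters after the last letter of the first block. -/
def tail : NCTree → NCTree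
  | nil => nil
  | node _ G R => if R = nil then G else tail R

/-- The restriction of the partition to the hull of the first block. -/
def core : NCTree → NCTree
  | nil => nil
  | node _ G R => if R = nil then node () nil nil else node () G (core R)

/-- The partition is irreducible: its first block contains the last letter. -/
def IsIrr (T : NCTree) : Prop := T ≠ nil ∧ tail T = nil

instance (T : NCTree) : Decidable T.IsIrr := by unfold IsIrr; infer_instance

lemma not_isIrr_nil : ¬ IsIrr nil := fun h => h.1 rfl

lemma isIrr_node {G R : NCTree} :
    IsIrr (node () G R) ↔ (R = nil ∧ G = nil) ∨ IsIrr R := by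
  by_cases hR : R = nil
  · subst hR; simp [IsIrr, tail]
  · simp [IsIrr, tail, hR]

lemma core_ne_nil {T : NCTree} (hT : T ≠ nil) : core T ≠ nil := by
  cases T with
  | nil => exact absurd rfl hT
  | node _ G R => rw [core]; split_ifs <;> simp

lemma core_isIrr {T : NCTree} (hT : T ≠ nil) : IsIrr (core T) := by
  induction T with
  | nil => exact absurd rfl hT
  | node _ G R _ ihR =>
    rw [core]
    split_ifs with hR
    · simp [isIrr_node]
    · exact isIrr_node.2 (Or.inr (ihR hR))

/-- The product of the weights `u` of the gaps of the first block. -/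
def gapProd {K : Type*} [One K] [Mul K] (u : NCTree → K) : NCTree → K
  | nil => 1
  | node _ G R => if R = nil then 1 else u G * gapProd u R

end NCTree

/-! ### Evaluation of trees -/

section TreeVal

open BinaryTree NCTree

variable {A : Type*} [Ring A] [Algebra ℂ A] {B : Subalgebra ℂ A}

/-- The value of the partition encoded by a tree, where `g` is applied to all blocks except the
first one, to which `f` is applied. Each letter `x_i` is first multiplied from the right by the
value of the partition of the gap that follows it. The value is `0` if the size of the tree is not
the length of the word. -/
def treeVal (g : MLF B) : NCTree → List A → (MLF B →ₗ[ℂ] B)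
  | nil, l => if l = [] then evalAt [] else 0
  | node _ _ _, [] => 0
  | node _ G R, x :: xs =>
      splitSum (fun u v => treeVal g R v ∘ₗ plug x (treeVal g G u g)) xs

variable (g : MLF B)

lemma treeVal_nil_nil (f : MLF B) : treeVal g nil [] f = f [] := rfl

lemma treeVal_node_nil (a : Unit) (G R : NCTree) (f : MLF B) : treeVal g (node a G R) [] f = 0 := rfl

lemma treeVal_cons (a : Unit) (G R : NCTree) (x : A) (xs : List A) (f : MLF B) :
    treeVal g (node a G R) (x :: xs) f =
      splitSum (fun u v => treeVal g R v (plug x (treeVal g G u g) f)) xs :=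
  map_splitSum (LinearMap.applyₗ (R := ℂ) f) _ xs

lemma treeVal_eq_zero {T : NCTree} {l : List A} (h : l.length ≠ T.numNodes) (f : MLF B) :
    treeVal g T l f = 0 := by
  induction T generalizing l f with
  | nil =>
    have : l ≠ [] := fun hl => h (by simp [hl])
    simp [treeVal, this]
  | node _ G R ihG ihR =>
    cases l with
    | nil => rfl
    | cons x xs =>
      rw [treeVal_cons]
      refine splitSum_eq_zero fun u v huv => ?_
      by_cases hu : u.length = G.numNodes
      · refine ihR (fun hv => h ?_) _
        rw [← huv]; simp [hu, hv]
      · rw [ihG hu]; simp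

lemma treeVal_isLinearMap (T : NCTree) (f : MLF B) (l₁ l₂ : List A) :
    IsLinearMap ℂ fun y => treeVal g T (l₁ ++ y :: l₂) f := by
  induction T generalizing f l₁ l₂ with
  | nil => simpa [treeVal] using isLinearMap_zero
  | node _ G R ihG ihR =>
    cases l₁ with
    | nil =>
      simp only [List.nil_append, treeVal_cons]
      exact isLinearMap_splitSum _ fun u v => (treeVal g R v ∘ₗ consLeft.flip f ∘ₗ
        LinearMap.mulRight ℂ (treeVal g G u g : A)).isLinear
    | cons x xs =>
      simp only [List.cons_append, treeVal_cons, splitSum_append_cons]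
      exact isLinearMap_add (isLinearMap_splitSum _ fun u v => ihR _ v l₂)
        (isLinearMap_splitSum _ fun u v =>
          isLinearMap_comp (treeVal g R v ∘ₗ (plug x).flip f) (ihG g xs u))

variable {g} in
lemma treeVal_append_mul (hg1 : g [] = 1) (hg : IsRightModular g) (T : NCTree) {f : MLF B}
    (hf : IsRightModular f) (l : List A) (y : A) (b : B) :
    treeVal g T (l ++ [y * (b : A)]) f = treeVal g T (l ++ [y]) f * b := by
  induction T generalizing f l with
  | nil => simp [treeVal]
  | node _ G R ihG ihR =>
    cases l with
    | nil =>
      simp only [List.nil_append, treeVal_cons, splitSum_nil]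
      cases R with
      | nil =>
        cases G with
        | nil =>
          simp only [treeVal_nil_nil, plug_apply, hg1]
          simpa using hf.singleton y b
        | node _ _ _ => simp [treeVal_node_nil]
      | node _ _ _ => simp [treeVal_node_nil]
    | cons x xs =>
      simp only [List.cons_append, treeVal_cons, splitSum_append_cons, splitSum_nil]
      rw [add_mul]
      congr 1
      · rw [splitSum_mul]
        exact splitSum_congr fun u v _ => ihR (hf.plug x _) v
      · cases R with
        | nil => rw [ihG hg, treeVal_nil_nil, treeVal_nil_nil, plug_apply, plug_apply,
            hf.singleton, hf.singleton, mul_assoc]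
        | node _ _ _ => simp [treeVal_node_nil]

/-- The sum of the values of all trees, with weights `p`. -/
def treeSum (p : NCTree → ℂ) (l : List A) (f : MLF B) : B :=
  ∑ T ∈ ofSize l.length, p T • treeVal g T l f

/-- The sum of the values of the irreducible trees, with weights `p`. -/
def irrSum (p : NCTree → ℂ) (l : List A) (f : MLF B) : B :=
  treeSum g (fun T => if IsIrr T then p T else 0) l f

lemma treeSum_congr {p q : NCTree → ℂ} {l : List A} {f : MLF B}
    (h : ∀ T, T.numNodes = l.length → p T = q T) : treeSum g p l f = treeSum g q l f :=
  Finset.sum_congr rfl fun T hT => by rw [h T (mem_treesOfNumNodesEq.1 hT)]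

lemma treeSum_add (p q : NCTree → ℂ) (l : List A) (f : MLF B) :
    treeSum g (fun T => p T + q T) l f = treeSum g p l f + treeSum g q l f := by
  simp only [treeSum, add_smul, Finset.sum_add_distrib]

lemma smul_treeSum (c : ℂ) (p : NCTree → ℂ) (l : List A) (f : MLF B) :
    c • treeSum g p l f = treeSum g (fun T => c * p T) l f := by
  simp only [treeSum, Finset.smul_sum, smul_smul]

lemma treeSum_nil (p : NCTree → ℂ) (f : MLF B) : treeSum g p [] f = p nil • f [] := by
  simp [treeSum, ofSize, treesOfNumNodesEq_zero, treeVal_nil_nil]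

lemma treeSum_cons (p : NCTree → ℂ) (x : A) (xs : List A) (f : MLF B) :
    treeSum g p (x :: xs) f = splitSum (fun u v => ∑ G ∈ ofSize u.length,
      treeSum g (fun R => p (node () G R)) v (plug x (treeVal g G u g) f)) xs := by
  rw [treeSum, List.length_cons, sum_ofSize_succ]
  simp only [treeVal_cons, smul_splitSum, ← splitSum_sum]
  refine splitSum_congr fun u v huv => ?_
  rw [Finset.sum_eq_single (u.length, v.length)]
  · rfl
  · rintro ⟨i, j⟩ hij hne
    rw [Finset.HasAntidiagonal.mem_antidiagonal, ← huv, List.length_append] at hij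
    refine Finset.sum_eq_zero fun G hG => Finset.sum_eq_zero fun R hR => ?_
    rw [mem_treesOfNumNodesEq] at hG hR
    by_cases hu : u.length = G.numNodes
    · rw [treeVal_eq_zero g (T := R), smul_zero]
      intro hv
      exact hne (Prod.ext (by simp_all) (by simp_all))
    · rw [treeVal_eq_zero g hu]; simp
  · intro h
    rw [Finset.HasAntidiagonal.mem_antidiagonal, ← huv, List.length_append] at h
    exact absurd rfl h

lemma irrSum_congr {p q : NCTree → ℂ} {l : List A} {f : MLF B}
    (h : ∀ T, IsIrr T → T.numNodes = l.length → p T = q T) :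
    irrSum g p l f = irrSum g q l f := by
  refine treeSum_congr g fun T hT => ?_
  by_cases hI : IsIrr T
  · simp [hI, h T hI hT]
  · simp [hI]

lemma irrSum_add (p q : NCTree → ℂ) (l : List A) (f : MLF B) :
    irrSum g (fun T => p T + q T) l f = irrSum g p l f + irrSum g q l f := by
  rw [irrSum, irrSum, irrSum, ← treeSum_add]
  refine treeSum_congr g fun T _ => ?_
  split_ifs <;> simp

lemma smul_irrSum (c : ℂ) (p : NCTree → ℂ) (l : List A) (f : MLF B) :
    c • irrSum g p l f = irrSum g (fun T => c * p T) l f := by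
  rw [irrSum, irrSum, smul_treeSum]
  refine treeSum_congr g fun T _ => ?_
  split_ifs <;> simp

@[simp] lemma irrSum_nil (p : NCTree → ℂ) (f : MLF B) : irrSum g p [] f = 0 := by
  rw [irrSum, treeSum_nil, if_neg not_isIrr_nil, zero_smul]

variable {g}

/-- Only the one-letter tree and the trees `node () G R` with irreducible `R` are irreducible. -/
lemma irrSum_cons (hg1 : g [] = 1) (p : NCTree → ℂ) (x : A) (xs : List A) (f : MLF B) :
    irrSum g p (x :: xs) f = (if xs = [] then p (node () nil nil) • f [x] else 0) +
      splitSum (fun u v => ∑ G ∈ ofSize u.length,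
        irrSum g (fun R => p (node () G R)) v (plug x (treeVal g G u g) f)) xs := by
  have h1 : ∀ T, (if IsIrr T then p T else 0) =
      (if T = node () nil nil then p T else 0) +
        (if T ≠ node () nil nil ∧ IsIrr T then p T else 0) := by
    intro T
    by_cases hT : T = node () nil nil
    · subst hT; simp [isIrr_node]
    · simp [hT]
  rw [irrSum, treeSum_congr g fun T _ => h1 T, treeSum_add]
  congr 1
  · rw [treeSum]
    simp only [ite_smul, zero_smul]
    rw [Finset.sum_ite_eq' (ofSize (x :: xs).length) (node () nil nil)
      fun T => p T • treeVal g T (x :: xs) f]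
    cases xs with
    | nil =>
      rw [if_pos (show node () nil nil ∈ ofSize [x].length from mem_treesOfNumNodesEq.2 rfl), if_pos rfl,
        treeVal_cons, splitSum_nil,
        treeVal_nil_nil, treeVal_nil_nil, plug_apply, hg1]
      simp
    | cons _ _ =>
      rw [if_neg, if_neg (by simp)]
      rw [mem_treesOfNumNodesEq]
      simp
  · rw [treeSum_cons]
    refine splitSum_congr fun u v _ => Finset.sum_congr rfl fun G _ => ?_
    refine treeSum_congr g fun R _ => ?_
    by_cases hR : IsIrr R
    · rw [if_pos hR, if_pos ⟨fun h => not_isIrr_nil ((node.inj h).2.2 ▸ hR),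
        isIrr_node.2 (Or.inr hR)⟩]
    · rw [if_neg hR, if_neg]
      rintro ⟨h1, h2⟩
      rcases isIrr_node.1 h2 with ⟨rfl, rfl⟩ | h
      · exact h1 rfl
      · exact hR h

lemma plug_treeSum (p : NCTree → ℂ) (x : A) (u : List A) (f : MLF B) :
    plug x (treeSum g p u g) f = ∑ G ∈ ofSize u.length, p G • plug x (treeVal g G u g) f := by
  simp only [treeSum, map_sum, LinearMap.sum_apply, map_smul, LinearMap.smul_apply]

/-- Irreducible trees whose weight is multiplicative over the gaps of the first block sum up to a
nested insertion. -/
lemma irrSum_gapProd (hg1 : g [] = 1) (u : NCTree → ℂ) (l : List A) (f : MLF B) :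
    irrSum g (gapProd u) l f = nest (fun w => treeSum g u w g) l f := by
  induction hn : l.length using Nat.strong_induction_on generalizing l f with
  | _ n ih =>
    cases l with
    | nil => simp
    | cons x xs =>
      rw [irrSum_cons hg1, nest_cons]
      congr 1
      · simp [gapProd]
      · refine splitSum_congr fun a v hav => ?_
        rw [plug_treeSum, map_sum]
        refine Finset.sum_congr rfl fun G _ => ?_
        rw [map_smul, ← ih v.length (by rw [← hn, ← hav]; simp) v _ rfl, smul_irrSum]
        exact irrSum_congr g fun R hR _ => by rw [gapProd, if_neg hR.1]

/-- Splitting a non-crossing partition after the last letter of its first block. -/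
lemma treeSum_core_tail (hg1 : g [] = 1) (p q : NCTree → ℂ) (l : List A) {f : MLF B}
    (hf : IsRightModular f) :
    treeSum g (fun T => if T = nil then 0 else p (core T) * q (NCTree.tail T)) l f =
      splitSum (fun a c => irrSum g p a f * treeSum g q c g) l := by
  induction hn : l.length using Nat.strong_induction_on generalizing l f p with
  | _ n ih =>
    cases l with
    | nil => simp [treeSum_nil]
    | cons x xs =>
      have e1 : ∀ G R : NCTree, (if node () G R = nil then 0 else
          p (core (node () G R)) * q (NCTree.tail (node () G R))) =
          (if R = nil then p (node () nil nil) * q G else 0) +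
            (if R = nil then 0 else p (node () G (core R)) * q (NCTree.tail R)) := by
        intro G R
        rw [if_neg (by simp), core, NCTree.tail]
        split_ifs <;> simp
      rw [treeSum_cons, splitSum_cons, irrSum_nil, zero_mul, zero_add]
      simp only [e1, treeSum_add, Finset.sum_add_distrib, splitSum_add]
      simp only [irrSum_cons hg1, add_mul, splitSum_add]
      congr 1
      · have e2 : splitSum (fun u v => (if u = [] then p (node () nil nil) • f [x] else 0) *
            treeSum g q v g) xs = p (node () nil nil) • (f [x] * treeSum g q xs g) := by
          rw [← splitSum_left_nil (fun v => p (node () nil nil) • (f [x] * treeSum g q v g)) xs]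
          refine splitSum_congr fun u v _ => ?_
          split_ifs <;> simp
        classical
        rw [e2, ← hf.singleton, ← plug_apply (l := []), plug_treeSum,
          ← splitSum_right_nil (fun u => p (node () nil nil) • (∑ G ∈ ofSize u.length,
            q G • plug x (treeVal g G u g) f : MLF B) []) xs]
        refine splitSum_congr fun u v _ => ?_
        split_ifs with hv
        · subst hv
          simp only [treeSum_nil, if_true, mul_smul, ← Finset.smul_sum]
          congr 1
          simp [-plug_apply]
        · refine Finset.sum_eq_zero fun G _ => Finset.sum_eq_zero fun R hR => ?_
          have : R ≠ nil := by
            rintro rfl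
            exact hv (List.length_eq_zero_iff.1 (mem_treesOfNumNodesEq.1 hR).symm)
          simp only [if_neg this, zero_smul]
      · simp only [splitSum_mul]
        rw [splitSum_assoc]
        refine splitSum_congr fun u v huv => ?_
        simp only [Finset.sum_mul, splitSum_sum]
        refine Finset.sum_congr rfl fun G _ => ?_
        exact ih v.length (by rw [← hn, ← huv]; simp) (fun R => p (node () G R)) v
          (hf.plug x _) rfl

/-- If the weight is multiplicative, `M = 1 + b M` holds for the sum `M` over all trees and the
sum `b` over all irreducible trees. -/
lemma treeSum_eq_unit_add (hg1 : g [] = 1) (hg : IsRightModular g) {u : NCTree → ℂ}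
    (hnil : u nil = 1) (hu : ∀ T, T ≠ nil → u T = u (core T) * u (NCTree.tail T)) (l : List A) :
    treeSum g u l g = (if l = [] then 1 else 0) +
      splitSum (fun a c => irrSum g u a g * treeSum g u c g) l := by
  rw [← treeSum_core_tail hg1 u u l hg]
  cases l with
  | nil => simp [treeSum_nil, hg1, hnil]
  | cons x xs =>
    rw [if_neg (by simp), zero_add]
    refine treeSum_congr g fun T hT => ?_
    have : T ≠ nil := by rintro rfl; simp at hT
    rw [if_neg this, hu T this]

/-- The equation `M = 1 + b M` determines `M`. -/
lemma eq_of_unit_add {b : List A → B} (hb : b [] = 0) {M M' : List A → B}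
    (hM : ∀ l, M l = (if l = [] then 1 else 0) + splitSum (fun a c => b a * M c) l)
    (hM' : ∀ l, M' l = (if l = [] then 1 else 0) + splitSum (fun a c => b a * M' c) l)
    (l : List A) : M l = M' l := by
  induction hn : l.length using Nat.strong_induction_on generalizing l with
  | _ n ih =>
    rw [hM, hM']
    congr 1
    refine splitSum_congr fun u v huv => ?_
    rcases eq_or_ne u [] with rfl | hu
    · simp [hb]
    · have := List.length_pos_iff.2 hu
      rw [ih v.length (by rw [← hn, ← huv]; simp; omega) v rfl]

/-- A sum over irreducible trees, as a multilinear functional. -/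
def irrFun (g : MLF B) (p : NCTree → ℂ) : MLF B :=
  ⟨fun l => irrSum g p l g, fun l₁ l₂ => by
    have : ∀ y : A, (l₁ ++ y :: l₂).length = l₁.length + l₂.length + 1 := fun y => by
      simp; omega
    simp only [irrSum, treeSum, this]
    exact isLinearMap_sum _ fun T _ =>
      isLinearMap_comp (LinearMap.lsmul ℂ B _) (treeVal_isLinearMap g T g l₁ l₂)⟩

@[simp] lemma irrFun_apply (p : NCTree → ℂ) (l : List A) : irrFun g p l = irrSum g p l g := rfl

lemma irrFun_isRightModular (hg1 : g [] = 1) (hg : IsRightModular g) (p : NCTree → ℂ) :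
    IsRightModular (irrFun g p) := by
  intro l x b
  simp only [irrFun_apply, irrSum, treeSum, Finset.sum_mul, smul_mul_assoc,
    ← treeVal_append_mul hg1 hg _ hg]
  simp

end TreeVal

/-! ### Weights of trees -/

namespace NCTree

open BinaryTree

/-- The number of blocks different from the first one. -/
def numRest : NCTree → ℕ
  | nil => 0
  | node _ G R => (if G = nil then 0 else numRest G + 1) + numRest R

/-- The number of blocks. -/
def numBlocks (T : NCTree) : ℕ := if T = nil then 0 else numRest T + 1

/-- The number of blocks strictly nested inside the first block. -/
def numInner : NCTree → ℕ
  | nil => 0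
  | node _ G R => if R = nil then 0 else numBlocks G + numInner R

/-- The product, over all blocks different from the first one, of the number of blocks nested in
it. -/
def hookProd : NCTree → ℕ
  | nil => 1
  | node _ G R => (numInner G + 1) * hookProd G * hookProd R

/-- The tree factorial. -/
def hook (T : NCTree) : ℕ := (numInner T + 1) * hookProd T

/-- Auxiliary recursion for `colorings`: the number of increasing colorings of the blocks strictly
nested inside the first block, all with colors less than the argument, and the number of
increasing colorings of the tail with the given number of colors. -/
def coloringsAux : NCTree → (ℕ → ℕ) × (ℕ → ℕ)
  | nil => (fun _ => 1, fun _ => 1)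
  | node _ G R =>
    if R = nil then (fun _ => 1, fun N =>
      (if G = nil then 1 else ∑ c ∈ Finset.range N, (coloringsAux G).1 c) * (coloringsAux G).2 N)
    else (fun N => ((if G = nil then 1 else ∑ c ∈ Finset.range N, (coloringsAux G).1 c) *
      (coloringsAux G).2 N) * (coloringsAux R).1 N, (coloringsAux R).2)

/-- The number of increasing colorings of the blocks with `N` colors. -/
def colorings (N : ℕ) (T : NCTree) : ℕ :=
  (if T = nil then 1 else ∑ c ∈ Finset.range N, (coloringsAux T).1 c) * (coloringsAux T).2 N

/-- All blocks are intervals. -/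
def IsInterval : NCTree → Bool
  | nil => true
  | node _ G R => if R = nil then IsInterval G else decide (G = nil) && IsInterval R

@[simp] lemma numBlocks_nil : numBlocks nil = 0 := rfl

lemma numBlocks_of_ne_nil {T : NCTree} (h : T ≠ nil) : numBlocks T = numRest T + 1 := if_neg h

lemma numRest_node (a : Unit) (G R : NCTree) :
    numRest (node a G R) = numBlocks G + numRest R := rfl

lemma hook_nil : hook nil = 1 := rfl

lemma hookProd_node (a : Unit) (G R : NCTree) :
    hookProd (node a G R) = hook G * hookProd R := rfl

lemma hookProd_pos (T : NCTree) : 0 < hookProd T := by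
  induction T with
  | nil => exact Nat.one_pos
  | node a G R hG hR => exact Nat.mul_pos (Nat.mul_pos (Nat.succ_pos _) hG) hR

lemma numInner_core (T : NCTree) : numInner (core T) = numInner T := by
  induction T with
  | nil => rfl
  | node a G R _ hR =>
    rw [core]
    by_cases h : R = nil
    · simp [h, numInner]
    · rw [if_neg h, numInner, numInner, if_neg h, if_neg (core_ne_nil h), hR]

lemma numRest_eq (T : NCTree) : numRest T = numInner T + numBlocks (tail T) := by
  induction T with
  | nil => rfl
  | node a G R _ hR =>
    rw [numRest_node, numInner, tail]
    split_ifs with h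
    · subst h; simp [numRest]
    · rw [hR, add_assoc]

lemma IsIrr.numBlocks_eq {T : NCTree} (h : IsIrr T) : numBlocks T = numInner T + 1 := by
  rw [numBlocks_of_ne_nil h.1, numRest_eq, h.2]; rfl

lemma numBlocks_eq_core_add_tail {T : NCTree} (h : T ≠ nil) :
    numBlocks T = numBlocks (core T) + numBlocks (tail T) := by
  rw [(core_isIrr h).numBlocks_eq, numInner_core, numBlocks_of_ne_nil h, numRest_eq]
  omega

/-- The blocks different from the first one are those nested inside it and those of the tail. -/
lemma hookProd_eq_core_mul_tail {T : NCTree} :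
    hookProd T = hookProd (core T) * hook (tail T) := by
  induction T with
  | nil => rfl
  | node a G R _ hR =>
    rw [hookProd_node, core, tail]
    split_ifs with h
    · subst h; simp [hookProd, numInner]
    · rw [hR, hookProd_node, mul_assoc]

lemma hook_eq_core_mul_tail {T : NCTree} : hook T = hook (core T) * hook (tail T) := by
  rw [hook, hookProd_eq_core_mul_tail (T := T), hook.eq_1 (core T), numInner_core, mul_assoc]

lemma colorings_nil (N : ℕ) : colorings N nil = 1 := rfl

lemma coloringsAux_fst_node (a : Unit) (G R : NCTree) (N : ℕ) :
    (coloringsAux (node a G R)).1 N =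
      if R = nil then 1 else colorings N G * (coloringsAux R).1 N := by
  rw [coloringsAux, colorings]; split_ifs <;> rfl

lemma coloringsAux_fst (T : NCTree) (N : ℕ) :
    (coloringsAux T).1 N = gapProd (colorings N) T := by
  induction T with
  | nil => rfl
  | node a G R _ hR => rw [coloringsAux_fst_node, gapProd, hR]

lemma coloringsAux_snd (T : NCTree) (N : ℕ) :
    (coloringsAux T).2 N = colorings N (tail T) := by
  induction T with
  | nil => rfl
  | node a G R _ hR =>
    rw [coloringsAux, tail]
    split_ifs with h
    · simp only [colorings, *, if_true]
    · simp only [colorings, *, if_false]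
    · exact hR
    · exact hR

/-- In a coloring, the color `c` of the first block bounds the colors of the blocks inside it, which
form independent families in the gaps; the tail is independent of the first block. -/
lemma colorings_eq {T : NCTree} (hT : T ≠ nil) (N : ℕ) :
    colorings N T =
      (∑ c ∈ Finset.range N, gapProd (colorings c) T) * colorings N (tail T) := by
  rw [colorings, if_neg hT, coloringsAux_snd]
  simp only [coloringsAux_fst]

lemma gapProd_core {K : Type*} [MulOneClass K] (u : NCTree → K) (T : NCTree) :
    gapProd u (core T) = gapProd u T := by
  induction T with
  | nil => rfl
  | node a G R _ hR =>
    rw [core]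
    by_cases h : R = nil
    · simp [h, gapProd]
    · rw [if_neg h, gapProd, gapProd, if_neg h, if_neg (core_ne_nil h), hR]

lemma colorings_isIrr {T : NCTree} (hT : IsIrr T) (N : ℕ) :
    colorings N T = ∑ c ∈ Finset.range N, gapProd (colorings c) T := by
  rw [colorings_eq hT.1, hT.2, colorings_nil, mul_one]

lemma colorings_eq_core_mul_tail {T : NCTree} (hT : T ≠ nil) (N : ℕ) :
    colorings N T = colorings N (core T) * colorings N (tail T) := by
  rw [colorings_eq hT, colorings_isIrr (core_isIrr hT)]
  simp only [gapProd_core]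

lemma isInterval_node (a : Unit) (G R : NCTree) : IsInterval (node a G R) =
    if R = nil then IsInterval G else decide (G = nil) && IsInterval R := rfl

lemma isInterval_eq_core_and_tail (T : NCTree) :
    IsInterval T = (IsInterval (core T) && IsInterval (tail T)) := by
  induction T with
  | nil => rfl
  | node a G R _ hR =>
    rw [isInterval_node, core, tail]
    by_cases h : R = nil
    · simp [h, isInterval_node, IsInterval]
    · rw [if_neg h, if_neg h, if_neg h, isInterval_node, if_neg (core_ne_nil h), hR, Bool.and_assoc]

/-- An irreducible interval partition has a single block, that is, all gaps are empty. -/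
lemma IsIrr.isInterval_eq {T : NCTree} (h : IsIrr T) :
    (if IsInterval T then (1 : ℂ) else 0) = gapProd (fun G => if G = nil then 1 else 0) T := by
  induction T with
  | nil => rfl
  | node a G R _ hR =>
    rw [isInterval_node, gapProd]
    rcases isIrr_node.1 h with ⟨rfl, rfl⟩ | h
    · rfl
    · rw [if_neg h.1, if_neg h.1, ← hR h]
      by_cases hG : G = nil <;> simp [hG]

/-- The weight `t ^ |π| / τ(π)!`. -/
noncomputable def hookWeight (t : ℂ) (T : NCTree) : ℂ := t ^ numBlocks T / (hook T : ℂ)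

lemma hookWeight_nil (t : ℂ) : hookWeight t nil = 1 := by simp [hookWeight, hook_nil]

lemma hookWeight_eq_core_mul_tail (t : ℂ) {T : NCTree} (hT : T ≠ nil) :
    hookWeight t T = hookWeight t (core T) * hookWeight t (tail T) := by
  rw [hookWeight, numBlocks_eq_core_add_tail hT, hook_eq_core_mul_tail, hookWeight, hookWeight,
    div_mul_div_comm, pow_add, Nat.cast_mul]

/-- The product of the weights of the gaps is the derivative of `hookWeight t T` with respect to `t`,
since the first block contributes the factor `|π| = numInner T + 1` to `τ(π)!`. -/
lemma IsIrr.gapProd_hookWeight {T : NCTree} (hT : IsIrr T) (t : ℂ) :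
    gapProd (hookWeight t) T = t ^ numInner T / (hookProd T : ℂ) := by
  induction T with
  | nil => exact absurd hT not_isIrr_nil
  | node a G R _ hR =>
    rcases isIrr_node.1 hT with ⟨rfl, rfl⟩ | h
    · simp [gapProd, numInner, hookProd]
    · rw [gapProd, if_neg h.1, hR h, numInner, if_neg h.1, hookProd_node, hookWeight,
        div_mul_div_comm, pow_add, Nat.cast_mul]

end NCTree

/-! ### The flow of a sequence of cumulants -/

section TreeFlow

open BinaryTree NCTree

variable {A : Type*} [Ring A] [Algebra ℂ A] {B : Subalgebra ℂ A} {g h : MLF B}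

/-- The sums over irreducible and over all non-crossing partitions, with weights
`t ^ |π| / τ(π)!`, form a flow. -/
lemma isFlow_hookWeight (h1 : h [] = 1) (hh : IsRightModular h) :
    IsFlow h (fun t => irrFun h (hookWeight t)) (fun t l => treeSum h (hookWeight t) l h) where
  nil t := irrSum_nil h _ h
  zero l := by
    refine (irrSum_congr h (q := fun _ => 0) fun T hT _ => ?_).trans ?_
    · simp [hookWeight, hT.numBlocks_eq]
    · simp [irrSum, treeSum]
  moment t l := treeSum_eq_unit_add h1 hh (hookWeight_nil t)
    (fun _ hT => hookWeight_eq_core_mul_tail t hT) l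
  deriv l := by
    have e : ∀ t, nest (fun l => treeSum h (hookWeight t) l h) l h =
        irrSum h (gapProd (hookWeight t)) l h := fun t => (irrSum_gapProd h1 _ l h).symm
    simp only [e, irrFun_apply, irrSum]
    unfold treeSum
    -- Each irreducible partition has weight `t ^ |π| / τ(π)!`, where `τ(π)! = |π| * hookProd T`.
    refine PolyDeriv.sum _ fun T _ => ?_
    by_cases hT : IsIrr T
    · simp only [if_pos hT]
      refine (PolyDeriv.pow (numInner T) (((hook T : ℂ)⁻¹) • treeVal h T l h)).congr
        (fun t => ?_) (fun t => ?_)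
      · rw [smul_smul, hookWeight, hT.numBlocks_eq, div_eq_mul_inv]
      · rw [smul_smul, hT.gapProd_hookWeight]
        congr 1
        have : (numInner T + 1 : ℂ) ≠ 0 := by exact_mod_cast Nat.succ_ne_zero (numInner T)
        have : (hookProd T : ℂ) ≠ 0 := by exact_mod_cast (hookProd_pos T).ne'
        rw [hook]
        push_cast
        field_simp
    · simp only [if_neg hT, zero_smul]
      exact PolyDeriv.const 0

variable {b : ℂ → MLF B} {M : ℂ → List A → B}

/-- `M = (1 - b)⁻¹` is the sum over the interval partitions of the values built from `b`. -/
lemma treeSum_interval (hg : IsRightModular g) (hg0 : g [] = 0) {m : List A → B}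
    (hm : ∀ l, m l = (if l = [] then 1 else 0) + splitSum (fun a c => g a * m c) l)
    (l : List A) :
    treeSum (unitize g) (fun T => if IsInterval T then 1 else 0) l (unitize g) = m l := by
  refine eq_of_unit_add (M := fun l => treeSum (unitize g) (fun T => if IsInterval T then 1 else 0)
    l (unitize g)) hg0 (fun l => ?_) hm l
  rw [treeSum_eq_unit_add (unitize_nil g) hg.unitize (by simp [IsInterval]) fun T _ => by
    rw [isInterval_eq_core_and_tail T]
    by_cases h1 : IsInterval (core T) <;> by_cases h2 : IsInterval (NCTree.tail T) <;>
      simp [h1, h2]]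
  congr 1
  refine splitSum_congr fun u v _ => ?_
  congr 1
  -- The irreducible interval partitions contribute only `g` itself.
  rcases eq_or_ne u [] with rfl | hu
  · rw [irrSum_nil, hg0]
  · rw [irrSum_congr _ fun T hT _ => hT.isInterval_eq, irrSum_gapProd (unitize_nil g),
      nest_unit _ _ hu, unitize_of_ne_nil _ hu]
    · simp [treeSum_nil]
    · intro w hw
      refine Finset.sum_eq_zero fun T hT => ?_
      have : T ≠ nil := by
        rintro rfl
        exact hw (List.length_eq_zero_iff.1 (mem_treesOfNumNodesEq.1 hT).symm)
      simp [this]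

lemma nest_unitize (m : List A → B) (l : List A) (f : MLF B) :
    nest m l (unitize f) = nest m l f :=
  nest_congr fun _ hl _ => unitize_of_ne_nil f hl

/-- If `M = 1 + b M` and `b = nest M · r`, then `M` is the sum over all non-crossing partitions of
the values built from `r`. -/
lemma treeSum_one_eq {r : MLF B} (hr : IsRightModular r) {m : List A → B}
    (hm : ∀ l, m l = (if l = [] then 1 else 0) + splitSum (fun a c => nest m a r * m c) l)
    (l : List A) :
    treeSum (unitize r) (fun _ => 1) l (unitize r) = m l := by
  induction hn : l.length using Nat.strong_induction_on generalizing l with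
  | _ n ih =>
    rw [treeSum_eq_unit_add (unitize_nil r) hr.unitize rfl (fun _ _ => (one_mul 1).symm), hm]
    congr 1
    refine splitSum_congr fun u v huv => ?_
    rcases eq_or_ne u [] with rfl | hu
    · simp
    · have hlen := congrArg List.length huv
      rw [List.length_append] at hlen
      have hu' := List.length_pos_iff.2 hu
      -- Irreducible partitions with arbitrary partitions in the gaps: a nested insertion of `m`.
      rw [ih v.length (by omega) v rfl, irrSum_congr (q := gapProd fun _ => 1),
        irrSum_gapProd (unitize_nil r), nest_unitize]
      · congr 1
        exact nest_congr_left r fun w hw => ih w.length (by omega) w rfl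
      · intro T _ _
        clear * -
        induction T with
        | nil => rfl
        | node a G R _ hR => rw [gapProd, ← hR]; simp

/-- The free cumulants of a flow at time `1` are `-b (-1)`. -/
lemma IsFlow.treeSum_one (H : IsFlow h b M) (hh : IsRightModular h)
    (hb : IsRightModular (b (-1))) (l : List A) :
    treeSum (unitize (-b (-1))) (fun _ => 1) l (unitize (-b (-1))) = M 1 l := by
  refine treeSum_one_eq (fun l x c => ?_) (fun l => ?_) l
  · change -(b (-1) _) = -(b (-1) _) * c
    rw [hb, neg_mul]
  -- The semigroup law for `-1 + 1 = 0`.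
  · have key : ∀ a, b 1 a = nest (M 1) a (-b (-1)) := by
      intro a
      have := H.semigroup hh (-1) 1 a
      rw [neg_add_cancel, H.zero] at this
      rw [map_neg]
      exact eq_neg_of_add_eq_zero_left this.symm
    simp only [← key]
    exact H.moment 1 l

/-- Counting increasing colorings amounts to running the flow for integer multiples of the time: an
irreducible partition colored with `N + 1` colors either does not use the last color, or its first
block has the last color and the gaps are colored with `N` colors. This is the recursion that the
semigroup law gives for `b (t * N)`. -/
lemma IsFlow.irrSum_colorings (H : IsFlow h b M) (hh : IsRightModular h) (t : ℂ)
    (hb : IsRightModular (b t)) (N : ℕ) (l : List A) :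
    irrSum (unitize (b t)) (fun T => (colorings N T : ℂ)) l (unitize (b t)) = b (t * N) l := by
  induction N generalizing l with
  | zero =>
    rw [Nat.cast_zero, mul_zero, H.zero]
    refine (irrSum_congr _ (q := fun _ => 0) fun T hT _ => ?_).trans ?_
    · simp [colorings_isIrr hT]
    · simp [irrSum, treeSum]
  | succ N ih =>
    have hM : ∀ l, treeSum (unitize (b t)) (fun T => (colorings N T : ℂ)) l (unitize (b t)) =
        M (t * N) l := by
      refine eq_of_unit_add (H.nil (t * N)) (fun l => ?_) (H.moment (t * N))
      rw [treeSum_eq_unit_add (unitize_nil (b t)) hb.unitize (by simp [colorings_nil])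
        fun T hT => by rw [colorings_eq_core_mul_tail hT, Nat.cast_mul]]
      simp only [ih]
    have e : ∀ T, IsIrr T → T.numNodes = l.length → (colorings (N + 1) T : ℂ) =
        colorings N T + gapProd (fun T => (colorings N T : ℂ)) T := by
      intro T hT _
      rw [colorings_isIrr hT, Finset.sum_range_succ, colorings_isIrr hT, Nat.cast_add]
      congr 1
      clear * -
      induction T with
      | nil => simp [gapProd]
      | node a G R _ hR => rw [gapProd, gapProd, ← hR]; push_cast; rfl
    rw [irrSum_congr _ e, irrSum_add, ih, irrSum_gapProd (unitize_nil _), nest_unitize]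
    simp only [hM]
    have : t * ((N + 1 : ℕ) : ℂ) = t + t * N := by push_cast; ring
    rw [this, H.semigroup hh]

/-! ### The linear coefficient of a polynomial in binomial form -/

lemma derivative_descPochhammer_eval_zero (k : ℕ) :
    (Polynomial.derivative (descPochhammer ℂ (k + 1))).eval 0 = (-1) ^ k * (k.factorial : ℂ) := by
  have h : ∀ k : ℕ, (descPochhammer ℂ k).eval (-1) = (-1) ^ k * (k.factorial : ℂ) := by
    intro k
    induction k with
    | zero => simp
    | succ k ih => rw [descPochhammer_succ_eval, ih, Nat.factorial_succ]; push_cast; ring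
  rw [descPochhammer_succ_left]
  simp [Polynomial.derivative_mul, Polynomial.derivative_comp, Polynomial.eval_comp, h]

open Polynomial in
/-- Comparison of the coefficients of `N`, where `N.choose k` contributes `(-1) ^ (k + 1) / k`. -/
lemma sum_eq_of_choose_eq_pow {W : Type*} [AddCommGroup W] [Module ℂ W] (n : ℕ) (hn : 1 ≤ n)
    (c d : ℕ → W)
    (h : ∀ N : ℕ, ∑ k ∈ Finset.range (n + 1), (N.choose k : ℂ) • c k =
      ∑ k ∈ Finset.range n, ((N : ℂ) ^ (k + 1)) • d k) :
    ∑ k ∈ Finset.Icc 1 n, ((-1 : ℂ) ^ (k + 1) / (k : ℂ)) • c k = d 0 := by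
  -- Applying linear functionals reduces the claim to complex polynomials.
  rw [← sub_eq_zero, ← Module.forall_dual_apply_eq_zero_iff ℂ]
  intro ℓ
  set P : ℂ[X] := ∑ k ∈ Finset.range (n + 1),
    C (ℓ (c k) / (k.factorial : ℂ)) * descPochhammer ℂ k with hP
  set Q : ℂ[X] := ∑ k ∈ Finset.range n, C (ℓ (d k)) * X ^ (k + 1) with hQ
  have hPQ : P = Q := by
    refine Polynomial.eq_of_infinite_eval_eq P Q
      ((Set.infinite_range_of_injective (Nat.cast_injective (R := ℂ))).mono ?_)
    rintro _ ⟨N, rfl⟩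
    have := congrArg ℓ (h N)
    simp only [map_sum, map_smul, smul_eq_mul] at this
    simp only [Set.mem_ofPred_eq, hP, hQ, eval_finsetSum, eval_mul, eval_C, eval_pow, eval_X]
    rw [Finset.sum_congr rfl fun k _ => mul_comm (ℓ (d k)) _, ← this]
    refine Finset.sum_congr rfl fun k _ => ?_
    rw [Nat.cast_choose_eq_descPochhammer_div]
    ring
  have hd := congrArg (fun p => (derivative p).eval 0) hPQ
  simp only [hP, hQ, derivative_sum, eval_finsetSum, derivative_C_mul, eval_mul, eval_C] at hd
  rw [Finset.sum_range_succ'] at hd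
  obtain ⟨m, rfl⟩ : ∃ m, n = m + 1 := ⟨n - 1, by omega⟩
  rw [Finset.sum_range_succ' (n := m) (f := fun k => ℓ (d k) * _)] at hd
  simp only [derivative_descPochhammer_eval_zero] at hd
  simp at hd
  rw [map_sub, ← hd, sub_eq_zero, map_sum]
  refine Finset.sum_nbij' (fun k => k - 1) (fun k => k + 1) (fun k hk => ?_) (fun k hk => ?_)
    (fun k hk => ?_) (fun k hk => ?_) (fun k hk => ?_)
  · simp only [Finset.mem_Icc, Finset.mem_range] at hk ⊢; omega
  · simp only [Finset.mem_Icc, Finset.mem_range] at hk ⊢; omega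
  · simp only [Finset.mem_Icc] at hk; omega
  · rfl
  · obtain ⟨k, rfl⟩ : ∃ j, k = j + 1 := ⟨k - 1, by simp only [Finset.mem_Icc] at hk; omega⟩
    have h1 : (k + 1 : ℂ) ≠ 0 := by exact_mod_cast Nat.succ_ne_zero k
    have h2 : (k.factorial : ℂ) ≠ 0 := by exact_mod_cast k.factorial_ne_zero
    rw [Nat.add_sub_cancel, map_smul, smul_eq_mul, Nat.factorial_succ]
    push_cast
    field_simp
    ring

end TreeFlow

/-! ### The blocks of a tree -/

/-- `P` is the set of blocks of a non-crossing partition of the interval `{a, …, b - 1}`. -/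
structure IsNCPart (P : Finset (Finset ℕ)) (a b : ℕ) : Prop where
  nonempty : ∀ V ∈ P, V.Nonempty
  cover : ∀ i, (∃ V ∈ P, i ∈ V) ↔ a ≤ i ∧ i < b
  disj : ∀ V ∈ P, ∀ W ∈ P, ∀ i, i ∈ V → i ∈ W → V = W
  noncrossing : ∀ V ∈ P, ∀ W ∈ P, V ≠ W →
    ¬ ∃ p ∈ V, ∃ q ∈ W, ∃ r ∈ V, ∃ s ∈ W, p < q ∧ q < r ∧ r < s

namespace IsNCPart

variable {P Q : Finset (Finset ℕ)} {a b m : ℕ} {V : Finset ℕ}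

lemma mem_bounds (h : IsNCPart P a b) (hV : V ∈ P) {i : ℕ} (hi : i ∈ V) : a ≤ i ∧ i < b :=
  (h.cover i).1 ⟨V, hV, hi⟩

lemma eq_empty (h : IsNCPart P a a) : P = ∅ := by
  refine Finset.eq_empty_of_forall_notMem fun V hV => ?_
  obtain ⟨i, hi⟩ := h.nonempty V hV
  have := h.mem_bounds hV hi
  omega

lemma empty (a : ℕ) : IsNCPart ∅ a a where
  nonempty := by simp
  cover i := by simp
  disj := by simp
  noncrossing := by simp

lemma insert_singleton (h : IsNCPart P (a + 1) b) (hab : a < b) :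
    IsNCPart (insert {a} P) a b where
  nonempty W hW := by
    rcases Finset.mem_insert.1 hW with rfl | hW
    · exact Finset.singleton_nonempty a
    · exact h.nonempty W hW
  cover i := by
    simp only [Finset.mem_insert, exists_eq_or_imp, Finset.mem_singleton, h.cover]
    omega
  disj W hW X hX i hi hi' := by
    rcases Finset.mem_insert.1 hW with rfl | hW <;> rcases Finset.mem_insert.1 hX with rfl | hX
    · rfl
    · have := h.mem_bounds hX hi'; simp at hi; omega
    · have := h.mem_bounds hW hi; simp at hi'; omega
    · exact h.disj W hW X hX i hi hi'
  noncrossing W hW X hX hne := by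
    rintro ⟨p, hp, q, hq, r, hr, s, hs, h1, h2, h3⟩
    rcases Finset.mem_insert.1 hW with rfl | hW <;> rcases Finset.mem_insert.1 hX with rfl | hX
    · exact hne rfl
    · simp at hp hr; omega
    · simp at hq hs; omega
    · exact h.noncrossing W hW X hX hne ⟨p, hp, q, hq, r, hr, s, hs, h1, h2, h3⟩

/-- Adding a new first point to the first block of a partition and a partition in between. -/
lemma insert_insert (hP : IsNCPart P (a + 1) m) (hQ : IsNCPart Q m b) (hV : V ∈ Q) (hm : m ∈ V)
    (ham : a < m) : IsNCPart (insert (insert a V) (P ∪ Q.erase V)) a b := by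
  have hmb : m < b := (hQ.mem_bounds hV hm).2
  -- A block of the new partition is the enlarged block or an old block of `P` or `Q`.
  have hmem : ∀ W, W ∈ insert (insert a V) (P ∪ Q.erase V) →
      W = insert a V ∨ W ∈ P ∨ (W ∈ Q ∧ W ≠ V) := by
    intro W hW
    simp only [Finset.mem_insert, Finset.mem_union, Finset.mem_erase] at hW
    tauto
  refine ⟨fun W hW => ?_, fun i => ?_, fun W hW X hX i hi hi' => ?_, fun W hW X hX hne => ?_⟩
  · rcases hmem W hW with rfl | hW | hW
    · exact Finset.insert_nonempty a V
    · exact hP.nonempty W hW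
    · exact hQ.nonempty W hW.1
  · constructor
    · rintro ⟨W, hW, hi⟩
      rcases hmem W hW with rfl | hW | hW
      · rcases Finset.mem_insert.1 hi with rfl | hi
        · omega
        · have := hQ.mem_bounds hV hi; omega
      · have := hP.mem_bounds hW hi; omega
      · have := hQ.mem_bounds hW.1 hi; omega
    · rintro ⟨h1, h2⟩
      rcases h1.eq_or_lt with rfl | h1
      · exact ⟨_, Finset.mem_insert_self _ _, Finset.mem_insert_self _ _⟩
      · rcases lt_or_ge i m with h3 | h3
        · obtain ⟨W, hW, hi⟩ := (hP.cover i).2 ⟨h1, h3⟩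
          exact ⟨W, by simp [hW], hi⟩
        · obtain ⟨W, hW, hi⟩ := (hQ.cover i).2 ⟨h3, h2⟩
          by_cases hWV : W = V
          · exact ⟨_, Finset.mem_insert_self _ _, by simp [← hWV, hi]⟩
          · exact ⟨W, by simp [hW, hWV], hi⟩
  · rcases hmem W hW with rfl | hW | hW <;> rcases hmem X hX with rfl | hX | hX
    · rfl
    · have := hP.mem_bounds hX hi'
      rcases Finset.mem_insert.1 hi with rfl | hi
      · omega
      · have := hQ.mem_bounds hV hi; omega
    · have := hQ.mem_bounds hX.1 hi'
      rcases Finset.mem_insert.1 hi with rfl | hi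
      · omega
      · exact absurd (hQ.disj _ hX.1 _ hV i hi' hi) hX.2
    · have := hP.mem_bounds hW hi
      rcases Finset.mem_insert.1 hi' with rfl | hi'
      · omega
      · have := hQ.mem_bounds hV hi'; omega
    · exact hP.disj W hW X hX i hi hi'
    · have := hP.mem_bounds hW hi; have := hQ.mem_bounds hX.1 hi'; omega
    · have := hQ.mem_bounds hW.1 hi
      rcases Finset.mem_insert.1 hi' with rfl | hi'
      · omega
      · exact absurd (hQ.disj _ hW.1 _ hV i hi hi') hW.2
    · have := hP.mem_bounds hX hi'; have := hQ.mem_bounds hW.1 hi; omega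
    · exact hQ.disj W hW.1 X hX.1 i hi hi'
  · rintro ⟨p, hp, q, hq, r, hr, s, hs, h1, h2, h3⟩
    rcases hmem W hW with rfl | hW | hW <;> rcases hmem X hX with rfl | hX | hX
    · exact hne rfl
    · have b1 := hP.mem_bounds hX hq
      have b2 := hP.mem_bounds hX hs
      rcases Finset.mem_insert.1 hr with rfl | hr
      · omega
      · have := hQ.mem_bounds hV hr; omega
    · have b1 := hQ.mem_bounds hX.1 hq
      rcases Finset.mem_insert.1 hr with rfl | hr
      · omega
      · rcases Finset.mem_insert.1 hp with hpa | hp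
        · have hqm : q ≠ m := fun h => hX.2 (hQ.disj _ hX.1 _ hV m (h ▸ hq) hm)
          exact hQ.noncrossing V hV X hX.1 hX.2.symm
            ⟨m, hm, q, hq, r, hr, s, hs, by omega, h2, h3⟩
        · exact hQ.noncrossing V hV X hX.1 hX.2.symm ⟨p, hp, q, hq, r, hr, s, hs, h1, h2, h3⟩
    · have b1 := hP.mem_bounds hW hp
      have b2 := hP.mem_bounds hW hr
      rcases Finset.mem_insert.1 hq with rfl | hq
      · omega
      · have := hQ.mem_bounds hV hq; omega
    · exact hP.noncrossing W hW X hX hne ⟨p, hp, q, hq, r, hr, s, hs, h1, h2, h3⟩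
    · have := hP.mem_bounds hW hr; have := hQ.mem_bounds hX.1 hq; omega
    · have b1 := hQ.mem_bounds hW.1 hp
      rcases Finset.mem_insert.1 hq with rfl | hq
      · omega
      · rcases Finset.mem_insert.1 hs with rfl | hs
        · omega
        · exact hQ.noncrossing W hW.1 V hV hW.2 ⟨p, hp, q, hq, r, hr, s, hs, h1, h2, h3⟩
    · have := hQ.mem_bounds hW.1 hp; have := hP.mem_bounds hX hq; omega
    · exact hQ.noncrossing W hW.1 X hX.1 hne ⟨p, hp, q, hq, r, hr, s, hs, h1, h2, h3⟩

/-- Removing the first point, if it is a block of its own. -/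
lemma erase_singleton (h : IsNCPart P a b) (ha : {a} ∈ P) : IsNCPart (P.erase {a}) (a + 1) b where
  nonempty W hW := h.nonempty W (Finset.mem_of_mem_erase hW)
  cover i := by
    constructor
    · rintro ⟨W, hW, hi⟩
      have := h.mem_bounds (Finset.mem_of_mem_erase hW) hi
      have : i ≠ a := by
        rintro rfl
        exact Finset.ne_of_mem_erase hW
          (h.disj _ (Finset.mem_of_mem_erase hW) _ ha i hi (Finset.mem_singleton_self i))
      omega
    · rintro ⟨h1, h2⟩
      obtain ⟨W, hW, hi⟩ := (h.cover i).2 ⟨by omega, h2⟩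
      refine ⟨W, Finset.mem_erase.2 ⟨?_, hW⟩, hi⟩
      rintro rfl
      simp at hi
      omega
  disj W hW X hX := h.disj W (Finset.mem_of_mem_erase hW) X (Finset.mem_of_mem_erase hX)
  noncrossing W hW X hX :=
    h.noncrossing W (Finset.mem_of_mem_erase hW) X (Finset.mem_of_mem_erase hX)

/-- Decomposition of a non-crossing partition whose first block has a second point `m`: the blocks
before `m`, and the blocks after `m` together with the rest of the first block. -/
lemma exists_decomposition (h : IsNCPart P a b) (hV : insert a V ∈ P) (hm : m ∈ V)
    (hmin : ∀ i ∈ V, m ≤ i) (ham : a < m) :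
    ∃ P₁ P₂, IsNCPart P₁ (a + 1) m ∧ IsNCPart P₂ m b ∧ V ∈ P₂ ∧
      P = insert (insert a V) (P₁ ∪ P₂.erase V) := by
  have hmV : m ∈ insert a V := Finset.mem_insert_of_mem hm
  have haV : a ∈ insert a V := Finset.mem_insert_self a V
  have hmb := h.mem_bounds hV hmV
  -- No other block passes over `m`: it would cross the block of `a` and `m`.
  have key : ∀ W ∈ P, W ≠ insert a V → (∀ i ∈ W, a < i ∧ i < m) ∨ ∀ i ∈ W, m < i := by
    intro W hW hne
    by_contra! hcon
    obtain ⟨⟨i, hi, hi'⟩, j, hj, hj'⟩ := hcon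
    have hia : i ≠ a := fun e => hne (h.disj W hW _ hV i hi (e ▸ haV))
    have hja : j ≠ a := fun e => hne (h.disj W hW _ hV j hj (e ▸ haV))
    have him : i ≠ m := fun e => hne (h.disj W hW _ hV i hi (e ▸ hmV))
    have hjm : j ≠ m := fun e => hne (h.disj W hW _ hV j hj (e ▸ hmV))
    have b1 := h.mem_bounds hW hi
    have b2 := h.mem_bounds hW hj
    have := hi' (by omega)
    exact h.noncrossing _ hV W hW hne.symm ⟨a, haV, j, hj, m, hmV, i, hi, by omega⟩
  have hVb : ∀ i ∈ V, m ≤ i ∧ i < b := fun i hi =>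
    ⟨hmin i hi, (h.mem_bounds hV (Finset.mem_insert_of_mem hi)).2⟩
  set P₁ := P.filter fun W => W ≠ insert a V ∧ ∀ i ∈ W, i < m with hP₁
  set P₃ := P.filter fun W => W ≠ insert a V ∧ ∀ i ∈ W, m < i with hP₃
  have m1 : ∀ {W}, W ∈ P₁ ↔ W ∈ P ∧ W ≠ insert a V ∧ ∀ i ∈ W, i < m := by simp [hP₁]
  have m3 : ∀ {W}, W ∈ P₃ ↔ W ∈ P ∧ W ≠ insert a V ∧ ∀ i ∈ W, m < i := by simp [hP₃]
  have hVnot : V ∉ P₃ := fun hc => (lt_irrefl m) ((m3.1 hc).2.2 m hm)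
  refine ⟨P₁, insert V P₃, ⟨fun W hW => h.nonempty W (m1.1 hW).1, fun i => ?_,
    fun W hW X hX => h.disj W (m1.1 hW).1 X (m1.1 hX).1,
    fun W hW X hX => h.noncrossing W (m1.1 hW).1 X (m1.1 hX).1⟩,
    ⟨fun W hW => ?_, fun i => ?_, fun W hW X hX i hi hi' => ?_, fun W hW X hX hne => ?_⟩,
    Finset.mem_insert_self _ _, ?_⟩
  · constructor
    · rintro ⟨W, hW, hi⟩
      obtain ⟨h1, h2, h3⟩ := m1.1 hW
      have := h.mem_bounds h1 hi
      have : i ≠ a := fun e => h2 (h.disj W h1 _ hV i hi (e ▸ haV))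
      exact ⟨by omega, h3 i hi⟩
    · rintro ⟨h1, h2⟩
      obtain ⟨W, hW, hi⟩ := (h.cover i).2 ⟨by omega, by omega⟩
      have hne : W ≠ insert a V := by
        rintro rfl
        rcases Finset.mem_insert.1 hi with rfl | hi
        · omega
        · have := hmin i hi; omega
      refine ⟨W, m1.2 ⟨hW, hne, ?_⟩, hi⟩
      rcases key W hW hne with hk | hk
      · exact fun j hj => (hk j hj).2
      · have := hk i hi; omega
  · rcases Finset.mem_insert.1 hW with rfl | hW
    · exact ⟨m, hm⟩
    · exact h.nonempty W (m3.1 hW).1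
  · constructor
    · rintro ⟨W, hW, hi⟩
      rcases Finset.mem_insert.1 hW with rfl | hW
      · exact hVb i hi
      · obtain ⟨h1, h2, h3⟩ := m3.1 hW
        exact ⟨(h3 i hi).le, (h.mem_bounds h1 hi).2⟩
    · rintro ⟨h1, h2⟩
      obtain ⟨W, hW, hi⟩ := (h.cover i).2 ⟨by omega, by omega⟩
      by_cases hne : W = insert a V
      · subst hne
        rcases Finset.mem_insert.1 hi with rfl | hi
        · omega
        · exact ⟨V, Finset.mem_insert_self _ _, hi⟩
      · refine ⟨W, Finset.mem_insert_of_mem (m3.2 ⟨hW, hne, ?_⟩), hi⟩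
        rcases key W hW hne with hk | hk
        · have := (hk i hi).2; omega
        · exact hk
  · rcases Finset.mem_insert.1 hW with rfl | hW <;> rcases Finset.mem_insert.1 hX with rfl | hX
    · rfl
    · exact absurd (h.disj _ (m3.1 hX).1 _ hV i hi' (Finset.mem_insert_of_mem hi)) (m3.1 hX).2.1
    · exact absurd (h.disj _ (m3.1 hW).1 _ hV i hi (Finset.mem_insert_of_mem hi')) (m3.1 hW).2.1
    · exact h.disj W (m3.1 hW).1 X (m3.1 hX).1 i hi hi'
  · rintro ⟨p, hp, q, hq, r, hr, s, hs, h1, h2, h3⟩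
    rcases Finset.mem_insert.1 hW with rfl | hW <;> rcases Finset.mem_insert.1 hX with rfl | hX
    · exact hne rfl
    · exact h.noncrossing _ hV X (m3.1 hX).1 (m3.1 hX).2.1.symm
        ⟨p, Finset.mem_insert_of_mem hp, q, hq, r, Finset.mem_insert_of_mem hr, s, hs, h1, h2, h3⟩
    · exact h.noncrossing W (m3.1 hW).1 _ hV (m3.1 hW).2.1
        ⟨p, hp, q, Finset.mem_insert_of_mem hq, r, hr, s, Finset.mem_insert_of_mem hs, h1, h2, h3⟩
    · exact h.noncrossing W (m3.1 hW).1 X (m3.1 hX).1 hne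
        ⟨p, hp, q, hq, r, hr, s, hs, h1, h2, h3⟩
  · rw [Finset.erase_insert hVnot]
    ext W
    simp only [Finset.mem_insert, Finset.mem_union, m1, m3]
    constructor
    · intro hW
      by_cases hne : W = insert a V
      · exact Or.inl hne
      · rcases key W hW hne with hk | hk
        · exact Or.inr (Or.inl ⟨hW, hne, fun i hi => (hk i hi).2⟩)
        · exact Or.inr (Or.inr ⟨hW, hne, hk⟩)
    · rintro (rfl | hW | hW)
      · exact hV
      · exact hW.1
      · exact hW.1

end IsNCPart

namespace NCTree

open BinaryTree

/-- The first block of the partition encoded by a tree, if the letters are numbered from `o`. -/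
def spine : NCTree → ℕ → Finset ℕ
  | nil, _ => ∅
  | node _ G R, o => insert o (spine R (o + 1 + G.numNodes))

/-- The blocks different from the first one, if the letters are numbered from `o`. -/
def restBlocks : NCTree → ℕ → Finset (Finset ℕ)
  | nil, _ => ∅
  | node _ G R, o =>
    (if G = nil then ∅ else insert (spine G (o + 1)) (restBlocks G (o + 1))) ∪
      restBlocks R (o + 1 + G.numNodes)

/-- The blocks of the partition encoded by a tree, if the letters are numbered from `o`. -/
def blocks (T : NCTree) (o : ℕ) : Finset (Finset ℕ) :=
  if T = nil then ∅ else insert (spine T o) (restBlocks T o)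

@[simp] lemma blocks_nil (o : ℕ) : blocks nil o = ∅ := rfl

lemma blocks_of_ne_nil {T : NCTree} (hT : T ≠ nil) (o : ℕ) :
    blocks T o = insert (spine T o) (restBlocks T o) := if_neg hT

lemma spine_node (a : Unit) (G R : NCTree) (o : ℕ) :
    spine (node a G R) o = insert o (spine R (o + 1 + G.numNodes)) := rfl

lemma restBlocks_node (a : Unit) (G R : NCTree) (o : ℕ) : restBlocks (node a G R) o =
    blocks G (o + 1) ∪ restBlocks R (o + 1 + G.numNodes) := rfl

lemma blocks_node (a : Unit) (G R : NCTree) (o : ℕ) : blocks (node a G R) o =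
    insert (insert o (spine R (o + 1 + G.numNodes)))
      (blocks G (o + 1) ∪ restBlocks R (o + 1 + G.numNodes)) := rfl

lemma mem_spine_self {T : NCTree} (hT : T ≠ nil) (o : ℕ) : o ∈ spine T o := by
  cases T with
  | nil => exact absurd rfl hT
  | node a G R => exact Finset.mem_insert_self _ _

lemma spine_bounds {T : NCTree} {o i : ℕ} (hi : i ∈ spine T o) : o ≤ i ∧ i < o + T.numNodes := by
  induction T generalizing o with
  | nil => simp [spine] at hi
  | node a G R _ hR =>
    rw [spine_node, Finset.mem_insert] at hi
    simp only [numNodes]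
    rcases hi with rfl | hi
    · omega
    · have := hR hi; omega

lemma restBlocks_bounds {T : NCTree} {o i : ℕ} {V : Finset ℕ} (hV : V ∈ restBlocks T o)
    (hi : i ∈ V) : o < i ∧ i < o + T.numNodes := by
  induction T generalizing o with
  | nil => simp [restBlocks] at hV
  | node a G R hG hR =>
    rw [restBlocks_node, Finset.mem_union] at hV
    simp only [numNodes]
    rcases hV with hV | hV
    · by_cases h : G = nil
      · simp [h] at hV
      · rw [blocks_of_ne_nil h, Finset.mem_insert] at hV
        rcases hV with rfl | hV
        · have := spine_bounds hi; omega
        · have := hG hV; omega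
    · have := hR hV; omega

lemma blocks_bounds {T : NCTree} {o i : ℕ} {V : Finset ℕ} (hV : V ∈ blocks T o)
    (hi : i ∈ V) : o ≤ i ∧ i < o + T.numNodes := by
  by_cases h : T = nil
  · simp [h] at hV
  · rw [blocks_of_ne_nil h, Finset.mem_insert] at hV
    rcases hV with rfl | hV
    · exact spine_bounds hi
    · have := restBlocks_bounds hV hi; omega

lemma spine_notMem_restBlocks {T : NCTree} (hT : T ≠ nil) (o : ℕ) :
    spine T o ∉ restBlocks T o := fun h =>
  lt_irrefl o (restBlocks_bounds h (mem_spine_self hT o)).1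

lemma restBlocks_eq_erase {T : NCTree} (hT : T ≠ nil) (o : ℕ) :
    restBlocks T o = (blocks T o).erase (spine T o) := by
  rw [blocks_of_ne_nil hT, Finset.erase_insert (spine_notMem_restBlocks hT o)]

/-- The blocks of a tree form a non-crossing partition. -/
lemma blocks_isNCPart (T : NCTree) (o : ℕ) : IsNCPart (blocks T o) o (o + T.numNodes) := by
  induction T generalizing o with
  | nil => exact IsNCPart.empty o
  | node a G R hG hR =>
    rw [blocks_node]
    by_cases h : R = nil
    · subst h
      have := (hG (o + 1)).insert_singleton (a := o) (by omega)
      have e : o + (node a G nil).numNodes = o + 1 + G.numNodes := by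
        simp only [numNodes]; omega
      rw [e]
      simpa [spine, restBlocks] using this
    · rw [restBlocks_eq_erase h]
      have := (hG (o + 1)).insert_insert (hR (o + 1 + G.numNodes))
        (by rw [blocks_of_ne_nil h]; exact Finset.mem_insert_self _ _) (mem_spine_self h _)
        (by omega)
      convert this using 1
      simp only [numNodes]
      omega

/-- Every non-crossing partition is encoded by a tree. -/
lemma exists_blocks_eq {P : Finset (Finset ℕ)} {a b : ℕ} (hab : a ≤ b) (h : IsNCPart P a b) :
    ∃ T : NCTree, a + T.numNodes = b ∧ blocks T a = P := by
  induction hn : b - a using Nat.strong_induction_on generalizing P a b with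
  | _ n ih =>
    rcases hab.eq_or_lt with rfl | hab
    · exact ⟨nil, rfl, h.eq_empty.symm⟩
    obtain ⟨V, hV, ha⟩ := (h.cover a).2 ⟨le_rfl, hab⟩
    by_cases hVa : V.erase a = ∅
    · have hVs : V = {a} := by rw [← Finset.insert_erase ha, hVa]; rfl
      subst hVs
      obtain ⟨G, hG1, hG2⟩ := ih (b - (a + 1)) (by omega) hab (h.erase_singleton hV) rfl
      refine ⟨node () G nil, by simp only [numNodes]; omega, ?_⟩
      rw [blocks_node, hG2]
      simp [spine, restBlocks, Finset.insert_erase hV]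
    · have hne := Finset.nonempty_iff_ne_empty.2 hVa
      -- The second point of the first block separates the left from the right subtree.
      set m := (V.erase a).min' hne with hmdef
      have hm : m ∈ V.erase a := Finset.min'_mem _ hne
      have hb := h.mem_bounds hV (Finset.mem_of_mem_erase hm)
      have ham : a < m := lt_of_le_of_ne hb.1 (Finset.ne_of_mem_erase hm).symm
      obtain ⟨P₁, P₂, h1, h2, h3, h4⟩ := h.exists_decomposition (V := V.erase a) (m := m)
        (by rwa [Finset.insert_erase ha]) hm (fun i hi => Finset.min'_le _ i hi) ham
      obtain ⟨G, hG1, hG2⟩ := ih (m - (a + 1)) (by omega) (b := m) ham h1 rfl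
      obtain ⟨R, hR1, hR2⟩ := ih (b - m) (by omega) hb.2.le h2 rfl
      have hR : R ≠ nil := by rintro rfl; simp at hR1; omega
      have hs : spine R m = V.erase a := by
        refine h2.disj _ ?_ _ h3 m (mem_spine_self hR m) hm
        rw [← hR2, blocks_of_ne_nil hR]
        exact Finset.mem_insert_self _ _
      refine ⟨node () G R, by simp only [numNodes]; omega, ?_⟩
      rw [blocks_node, hG1, hG2, hs, restBlocks_eq_erase hR, hs, hR2, h4]

/-- The blocks determine the tree. -/
lemma blocks_injective {T T' : NCTree} {o : ℕ} (hn : T.numNodes = T'.numNodes)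
    (h : blocks T o = blocks T' o) : T = T' := by
  induction T generalizing T' o with
  | nil =>
    cases T' with
    | nil => rfl
    | node _ _ _ => simp at hn
  | node a G R hG hR =>
    cases T' with
    | nil => simp at hn
    | node a' G' R' =>
      have hs : spine (node a G R) o = spine (node a' G' R') o := by
        refine (blocks_isNCPart (node a' G' R') o).disj _ ?_ _ ?_ o
          (mem_spine_self (by simp) o) (mem_spine_self (by simp) o)
        · rw [← h, blocks_of_ne_nil (by simp)]
          exact Finset.mem_insert_self _ _
        · rw [blocks_of_ne_nil (by simp)]
          exact Finset.mem_insert_self _ _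
      have hr : restBlocks (node a G R) o = restBlocks (node a' G' R') o := by
        rw [restBlocks_eq_erase (by simp), restBlocks_eq_erase (by simp), hs, h]
      rw [restBlocks_node, restBlocks_node] at hr
      have hs' : spine R (o + 1 + G.numNodes) = spine R' (o + 1 + G'.numNodes) := by
        have h1 : ∀ (R : NCTree) (k : ℕ), o ∉ spine R (o + 1 + k) := fun R k hc => by
          have := spine_bounds hc; omega
        rw [spine_node, spine_node] at hs
        rw [← Finset.erase_insert (h1 R _), hs, Finset.erase_insert (h1 R' _)]
      simp only [numNodes] at hn
      have hRR : R = nil ↔ R' = nil := by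
        constructor
        · rintro rfl
          by_contra hc
          have := mem_spine_self hc (o + 1 + G'.numNodes)
          rw [← hs'] at this
          simp [spine] at this
        · rintro rfl
          by_contra hc
          have := mem_spine_self hc (o + 1 + G.numNodes)
          rw [hs'] at this
          simp [spine] at this
      by_cases hRn : R = nil
      · obtain rfl := hRn
        obtain rfl := hRR.1 rfl
        simp only [restBlocks, Finset.union_empty] at hr
        rw [hG (by simpa using hn) hr]
      · have hRn' : R' ≠ nil := fun hc => hRn (hRR.2 hc)
        -- The second point of the first block determines the length of the gap.
        have hGG : G.numNodes = G'.numNodes := by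
          have h1 := mem_spine_self hRn (o + 1 + G.numNodes)
          have h2 := mem_spine_self hRn' (o + 1 + G'.numNodes)
          rw [hs'] at h1
          rw [← hs'] at h2
          have := spine_bounds h1
          have := spine_bounds h2
          omega
        rw [hGG] at hr hs'
        -- The two parts of `restBlocks` are told apart by the position of their points.
        have hlt : ∀ {K : NCTree}, K.numNodes = G'.numNodes → ∀ V ∈ blocks K (o + 1),
            ∃ i ∈ V, i < o + 1 + G'.numNodes := by
          intro K hK V hV
          obtain ⟨i, hi⟩ := (blocks_isNCPart K (o + 1)).nonempty V hV
          exact ⟨i, hi, hK ▸ (blocks_bounds hV hi).2⟩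
        have hge : ∀ {K : NCTree}, ∀ V ∈ restBlocks K (o + 1 + G'.numNodes), ∀ i ∈ V,
            o + 1 + G'.numNodes < i := fun V hV i hi => (restBlocks_bounds hV hi).1
        have e1 : blocks G (o + 1) = blocks G' (o + 1) := by
          ext V
          constructor
          · intro hV
            obtain ⟨i, hi, hi'⟩ := hlt hGG V hV
            rcases Finset.mem_union.1 (hr ▸ Finset.mem_union_left _ hV) with h1 | h1
            · exact h1
            · have := hge V h1 i hi; omega
          · intro hV
            obtain ⟨i, hi, hi'⟩ := hlt rfl V hV
            rcases Finset.mem_union.1 (hr.symm ▸ Finset.mem_union_left _ hV) with h1 | h1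
            · exact h1
            · have := hge V h1 i hi; omega
        have e2 : restBlocks R (o + 1 + G'.numNodes) = restBlocks R' (o + 1 + G'.numNodes) := by
          ext V
          constructor
          · intro hV
            rcases Finset.mem_union.1 (hr ▸ Finset.mem_union_right _ hV) with h1 | h1
            · obtain ⟨i, hi, hi'⟩ := hlt rfl V h1
              have := hge V hV i hi; omega
            · exact h1
          · intro hV
            rcases Finset.mem_union.1 (hr.symm ▸ Finset.mem_union_right _ hV) with h1 | h1
            · obtain ⟨i, hi, hi'⟩ := hlt hGG V h1
              have := hge V hV i hi; omega
            · exact h1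
        have e3 : blocks R (o + 1 + G'.numNodes) = blocks R' (o + 1 + G'.numNodes) := by
          rw [blocks_of_ne_nil hRn, blocks_of_ne_nil hRn', hs', e2]
        rw [hG hGG e1, hR (by omega) e3]

lemma disjoint_blocks_restBlocks (G R : NCTree) (o : ℕ) :
    Disjoint (blocks G (o + 1)) (restBlocks R (o + 1 + G.numNodes)) := by
  rw [Finset.disjoint_left]
  intro V h1 h2
  obtain ⟨i, hi⟩ := (blocks_isNCPart G (o + 1)).nonempty V h1
  have := blocks_bounds h1 hi
  have := restBlocks_bounds h2 hi
  omega

lemma card_blocks_of {T : NCTree} {o : ℕ} (h : (restBlocks T o).card = numRest T) :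
    (blocks T o).card = numBlocks T := by
  by_cases hT : T = nil
  · simp [hT]
  · rw [blocks_of_ne_nil hT, Finset.card_insert_of_notMem (spine_notMem_restBlocks hT o), h,
      numBlocks_of_ne_nil hT]

lemma card_restBlocks (T : NCTree) (o : ℕ) : (restBlocks T o).card = numRest T := by
  induction T generalizing o with
  | nil => rfl
  | node a G R hG hR =>
    rw [restBlocks_node, Finset.card_union_of_disjoint (disjoint_blocks_restBlocks G R o),
      card_blocks_of (hG (o + 1)), hR, numRest_node]

lemma card_blocks (T : NCTree) (o : ℕ) : (blocks T o).card = numBlocks T :=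
  card_blocks_of (card_restBlocks T o)

/-! ### Irreducible and interval partitions as trees -/

lemma last_mem_spine {T : NCTree} (hT : T ≠ nil) (o : ℕ) :
    o + T.numNodes - 1 ∈ spine T o ↔ tail T = nil := by
  induction T generalizing o with
  | nil => exact absurd rfl hT
  | node a G R _ hR =>
    rw [spine_node, tail, Finset.mem_insert]
    by_cases h : R = nil
    · subst h
      simp only [spine, numNodes, if_true]
      cases G with
      | nil => simp
      | node _ _ _ => simp
    · have : 0 < R.numNodes := by
        cases R with
        | nil => exact absurd rfl h
        | node _ _ _ => simp
      rw [if_neg h, ← hR h (o + 1 + G.numNodes)]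
      have e : o + (node a G R).numNodes - 1 = o + 1 + G.numNodes + R.numNodes - 1 := by
        simp only [numNodes]; omega
      rw [e]
      constructor
      · rintro (h | h)
        · omega
        · exact h
      · exact Or.inr

/-- A finite set of natural numbers is an interval. -/
def IsConvex (V : Finset ℕ) : Prop := ∀ i ∈ V, ∀ j ∈ V, ∀ k, i ≤ k → k ≤ j → k ∈ V

lemma blocks_isConvex (T : NCTree) (o : ℕ) :
    (∀ V ∈ blocks T o, IsConvex V) ↔ IsInterval T = true := by
  induction T generalizing o with
  | nil => simp [IsInterval]
  | node a G R hG hR =>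
    rw [blocks_node, isInterval_node]
    by_cases h : R = nil
    · subst h
      rw [if_pos rfl, ← hG (o + 1)]
      simp only [spine, restBlocks, Finset.union_empty, Finset.forall_mem_insert]
      refine and_iff_right fun i hi j hj k h1 h2 => ?_
      simp at hi hj ⊢
      omega
    · rw [if_neg h, Bool.and_eq_true, decide_eq_true_iff]
      have hm := mem_spine_self h (o + 1 + G.numNodes)
      constructor
      · intro H
        have hG0 : G = nil := by
          have := H _ (Finset.mem_insert_self _ _) o (Finset.mem_insert_self _ _) _
            (Finset.mem_insert_of_mem hm) (o + 1) (by omega) (by omega)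
          rcases Finset.mem_insert.1 this with h1 | h1
          · omega
          · have := spine_bounds h1
            cases G with
            | nil => rfl
            | node _ _ _ => simp only [numNodes] at this; omega
        subst hG0
        refine ⟨rfl, (hR (o + 1)).1 fun V hV => ?_⟩
        rw [blocks_of_ne_nil h] at hV
        rcases Finset.mem_insert.1 hV with rfl | hV
        · intro i hi j hj k h1 h2
          have := H _ (Finset.mem_insert_self _ _) i (Finset.mem_insert_of_mem hi) j
            (Finset.mem_insert_of_mem hj) k h1 h2
          rcases Finset.mem_insert.1 this with rfl | h3
          · have := spine_bounds hi; omega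
          · exact h3
        · exact H V (by simp [numNodes, hV])
      · rintro ⟨rfl, hI⟩
        have H := (hR (o + 1)).2 hI
        rw [blocks_of_ne_nil h] at H
        intro V hV
        simp only [blocks_nil, Finset.empty_union, numNodes, add_zero, Finset.mem_insert] at hV
        rcases hV with rfl | hV
        · intro i hi j hj k h1 h2
          rcases Nat.lt_or_ge k (o + 1) with hk | hk
          · have : o ≤ i := by
              rcases Finset.mem_insert.1 hi with rfl | hi
              · exact le_rfl
              · have := spine_bounds hi; omega
            have : k = o := by omega
            simp [this]
          · rcases Finset.mem_insert.1 hj with rfl | hj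
            · omega
            · exact Finset.mem_insert_of_mem (H _ (Finset.mem_insert_self _ _) (o + 1)
                (by simpa using hm) j hj k hk h2)
        · exact H V (Finset.mem_insert_of_mem hV)

end NCTree

/-! ### Nesting of blocks and the tree factorial -/

/-- Every element of `W` lies between two elements of `V`. -/
def NestedIn (W V : Finset ℕ) : Prop := ∀ w ∈ W, ∃ a ∈ V, ∃ b ∈ V, a ≤ w ∧ w ≤ b

instance (W V : Finset ℕ) : Decidable (NestedIn W V) := by unfold NestedIn; infer_instance

lemma NestedIn.refl (V : Finset ℕ) : NestedIn V V := fun w hw => ⟨w, hw, w, hw, le_rfl, le_rfl⟩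

lemma not_nestedIn_of_lt {V W : Finset ℕ} (hV : V.Nonempty) (h : ∀ i ∈ V, ∀ j ∈ W, i < j) :
    ¬ NestedIn V W := by
  intro hn
  obtain ⟨v, hv⟩ := hV
  obtain ⟨a, ha, -, -, h1, -⟩ := hn v hv
  have := h v hv a ha
  omega

lemma not_nestedIn_of_gt {V W : Finset ℕ} (hW : W.Nonempty) (h : ∀ i ∈ V, ∀ j ∈ W, i < j) :
    ¬ NestedIn W V := by
  intro hn
  obtain ⟨w, hw⟩ := hW
  obtain ⟨-, -, b, hb, -, h2⟩ := hn w hw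
  have := h b hb w hw
  omega

namespace NCTree

open BinaryTree

lemma blocks_nonempty {T : NCTree} {o : ℕ} {V : Finset ℕ} (hV : V ∈ blocks T o) : V.Nonempty :=
  (blocks_isNCPart T o).nonempty V hV

lemma restBlocks_subset (T : NCTree) (o : ℕ) : restBlocks T o ⊆ blocks T o := by
  by_cases hT : T = nil
  · subst hT; exact Finset.Subset.refl _
  · rw [blocks_of_ne_nil hT]; exact Finset.subset_insert _ _

lemma spine_mem_blocks {T : NCTree} (hT : T ≠ nil) (o : ℕ) : spine T o ∈ blocks T o := by
  rw [blocks_of_ne_nil hT]; exact Finset.mem_insert_self _ _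

lemma restBlocks_nonempty {T : NCTree} {o : ℕ} {V : Finset ℕ} (hV : V ∈ restBlocks T o) :
    V.Nonempty := blocks_nonempty (restBlocks_subset T o hV)

/-- The blocks different from the first one that are nested inside it. -/
lemma card_nested_spine (T : NCTree) (o : ℕ) :
    ((restBlocks T o).filter fun W => NestedIn W (spine T o)).card = numInner T := by
  induction T generalizing o with
  | nil => rfl
  | node a G R hG hR =>
    rw [numInner]
    split_ifs with h
    · subst h
      rw [Finset.card_eq_zero, Finset.filter_eq_empty_iff]
      intro W hW
      refine not_nestedIn_of_gt (restBlocks_nonempty hW) fun i hi j hj => ?_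
      have := restBlocks_bounds hW hj
      simp [spine] at hi
      omega
    · have hm := mem_spine_self h (o + 1 + G.numNodes)
      rw [restBlocks_node, Finset.filter_union, Finset.card_union_of_disjoint, ← hR,
        ← card_blocks G (o + 1)]
      · congr 1
        · congr 1
          refine Finset.filter_true_of_mem fun W hW w hw => ?_
          have := blocks_bounds hW hw
          exact ⟨o, Finset.mem_insert_self _ _, _, Finset.mem_insert_of_mem hm, by omega, by omega⟩
        · congr 1
          refine Finset.filter_congr fun W hW => ⟨fun hn w hw => ?_, fun hn w hw => ?_⟩
          · obtain ⟨-, -, b, hb, -, h2⟩ := hn w hw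
            have hw' := restBlocks_bounds hW hw
            rw [spine_node, Finset.mem_insert] at hb
            rcases hb with rfl | hb
            · omega
            · exact ⟨_, hm, b, hb, hw'.1.le, h2⟩
          · obtain ⟨c, hc, b, hb, h1, h2⟩ := hn w hw
            exact ⟨c, Finset.mem_insert_of_mem hc, b, Finset.mem_insert_of_mem hb, h1, h2⟩
      · exact Finset.disjoint_filter_filter (disjoint_blocks_restBlocks G R o)

lemma prod_nested_blocks_of {T : NCTree} {o : ℕ}
    (h : ∏ V ∈ restBlocks T o, ((blocks T o).filter fun W => NestedIn W V).card = hookProd T) :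
    ∏ V ∈ blocks T o, ((blocks T o).filter fun W => NestedIn W V).card = hook T := by
  by_cases hT : T = nil
  · subst hT; rfl
  · rw [← Finset.mul_prod_erase _ _ (spine_mem_blocks hT o), ← restBlocks_eq_erase hT, h, hook,
      ← card_nested_spine T o]
    congr 1
    rw [blocks_of_ne_nil hT, Finset.filter_insert, if_pos (NestedIn.refl _),
      Finset.card_insert_of_notMem]
    exact fun hc => spine_notMem_restBlocks hT o (Finset.mem_of_mem_filter _ hc)

lemma prod_nested_restBlocks (T : NCTree) (o : ℕ) :
    ∏ V ∈ restBlocks T o, ((blocks T o).filter fun W => NestedIn W V).card = hookProd T := by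
  induction T generalizing o with
  | nil => rfl
  | node a G R hG hR =>
    rw [hookProd_node, ← prod_nested_blocks_of (hG (o + 1)), ← hR (o + 1 + G.numNodes),
      restBlocks_node, Finset.prod_union (disjoint_blocks_restBlocks G R o)]
    congr 1
    · refine Finset.prod_congr rfl fun V hV => congrArg Finset.card ?_
      rw [blocks_node]
      ext W
      simp only [Finset.mem_filter, Finset.mem_insert, Finset.mem_union]
      -- Nothing outside the gap is nested inside a block of the gap.
      refine ⟨?_, fun hW => ⟨Or.inr (Or.inl hW.1), hW.2⟩⟩
      rintro ⟨rfl | hW | hW, hn⟩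
      · obtain ⟨c, hc, -, -, h1, -⟩ := hn o (Finset.mem_insert_self _ _)
        have := blocks_bounds hV hc
        omega
      · exact ⟨hW, hn⟩
      · refine absurd hn (not_nestedIn_of_gt (restBlocks_nonempty hW) fun i hi j hj => ?_)
        have := blocks_bounds hV hi
        have := restBlocks_bounds hW hj
        omega
    · refine Finset.prod_congr rfl fun V hV => congrArg Finset.card ?_
      -- Here the point `o` is absent from `spine R`, but the first block is nested in none of the others.
      have hRn : R ≠ nil := by rintro rfl; simp [restBlocks] at hV
      rw [blocks_node, blocks_of_ne_nil hRn]
      ext W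
      simp only [Finset.mem_filter, Finset.mem_insert, Finset.mem_union]
      constructor
      · rintro ⟨rfl | hW | hW, hn⟩
        · obtain ⟨c, hc, -, -, h1, -⟩ := hn o (Finset.mem_insert_self _ _)
          have := restBlocks_bounds hV hc
          omega
        · refine absurd hn (not_nestedIn_of_lt (blocks_nonempty hW) fun i hi j hj => ?_)
          have := blocks_bounds hW hi
          have := restBlocks_bounds hV hj
          omega
        · exact ⟨Or.inr hW, hn⟩
      · rintro ⟨rfl | hW, hn⟩
        · obtain ⟨c, hc, -, -, h1, -⟩ := hn _ (mem_spine_self hRn _)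
          have := restBlocks_bounds hV hc
          omega
        · exact ⟨Or.inr (Or.inr hW), hn⟩

lemma prod_nested_blocks (T : NCTree) (o : ℕ) :
    ∏ V ∈ blocks T o, ((blocks T o).filter fun W => NestedIn W V).card = hook T :=
  prod_nested_blocks_of (prod_nested_restBlocks T o)

end NCTree

/-! ### Increasing colorings -/

/-- `f` is an increasing coloring of `P` with `N` colors, extended by `0` to sets that are not blocks,
so that it is determined by the colors of the blocks. -/
structure IsColoring (N : ℕ) (P : Finset (Finset ℕ)) (f : Finset ℕ → ℕ) : Prop where
  lt : ∀ V ∈ P, f V < N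
  mono : ∀ V ∈ P, ∀ W ∈ P, V ≠ W → NestedIn V W → f V < f W
  zero : ∀ V, V ∉ P → f V = 0

/-- The number of increasing colorings of `P` with `N` colors. -/
noncomputable def numColorings (N : ℕ) (P : Finset (Finset ℕ)) : ℕ :=
  Nat.card {f // IsColoring N P f}

instance (N : ℕ) (P : Finset (Finset ℕ)) : Finite {f // IsColoring N P f} := by
  refine Finite.of_injective
    (fun f (V : P) => (⟨f.1 V, f.2.lt V V.2⟩ : Fin N)) fun f g hfg => Subtype.ext (funext fun V => ?_)
  by_cases hV : V ∈ P
  · exact congrArg Fin.val (congrFun hfg ⟨V, hV⟩)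
  · rw [f.2.zero V hV, g.2.zero V hV]

lemma numColorings_empty (N : ℕ) : numColorings N ∅ = 1 := by
  have : Unique {f // IsColoring N ∅ f} :=
    { default := ⟨fun _ => 0, by simp, by simp, by simp⟩
      uniq := fun f => Subtype.ext (funext fun V => f.2.zero V (by simp)) }
  exact Nat.card_unique

/-- Families without nesting between them are colored independently. -/
lemma numColorings_union {N : ℕ} {P Q : Finset (Finset ℕ)} (hd : Disjoint P Q)
    (h1 : ∀ V ∈ P, ∀ W ∈ Q, ¬ NestedIn V W) (h2 : ∀ V ∈ P, ∀ W ∈ Q, ¬ NestedIn W V) :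
    numColorings N (P ∪ Q) = numColorings N P * numColorings N Q := by
  rw [numColorings, numColorings, numColorings, ← Nat.card_prod]
  have hd' : ∀ {V}, V ∈ Q → V ∉ P := fun hQ hP => Finset.disjoint_left.1 hd hP hQ
  refine Nat.card_congr ⟨fun f => (⟨fun V => if V ∈ P then f.1 V else 0, ?_, ?_, ?_⟩,
    ⟨fun V => if V ∈ Q then f.1 V else 0, ?_, ?_, ?_⟩),
    fun p => ⟨fun V => if V ∈ P then p.1.1 V else p.2.1 V, ?_, ?_, ?_⟩, ?_, ?_⟩
  · intro V hV
    simpa [hV] using f.2.lt V (Finset.mem_union_left _ hV)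
  · intro V hV W hW
    simpa [hV, hW] using
      f.2.mono V (Finset.mem_union_left _ hV) W (Finset.mem_union_left _ hW)
  · intro V hV; simp [hV]
  · intro V hV
    simpa [hV] using f.2.lt V (Finset.mem_union_right _ hV)
  · intro V hV W hW
    simpa [hV, hW] using
      f.2.mono V (Finset.mem_union_right _ hV) W (Finset.mem_union_right _ hW)
  · intro V hV; simp [hV]
  · intro V hV
    by_cases hP : V ∈ P
    · simpa [hP] using p.1.2.lt V hP
    · simpa [hP] using p.2.2.lt V ((Finset.mem_union.1 hV).resolve_left hP)
  · intro V hV W hW hne hn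
    rcases Finset.mem_union.1 hV with hV | hV <;> rcases Finset.mem_union.1 hW with hW | hW
    · simpa [hV, hW] using p.1.2.mono V hV W hW hne hn
    · exact absurd hn (h1 V hV W hW)
    · exact absurd hn (h2 W hW V hV)
    · simpa [hd' hV, hd' hW] using p.2.2.mono V hV W hW hne hn
  · intro V hV
    rw [Finset.mem_union, not_or] at hV
    simpa [hV.1] using p.2.2.zero V hV.2
  · intro f
    refine Subtype.ext (funext fun V => ?_)
    by_cases hP : V ∈ P <;> by_cases hQ : V ∈ Q <;> simp [hP, hQ]
    exact (f.2.zero V (by simp [hP, hQ])).symm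
  · intro p
    refine Prod.ext (Subtype.ext (funext fun V => ?_)) (Subtype.ext (funext fun V => ?_))
    · by_cases hP : V ∈ P
      · simp [hP]
      · simp [hP, p.1.2.zero V hP]
    · by_cases hQ : V ∈ Q
      · simp [hQ, hd' hQ]
      · simp [hQ, p.2.2.zero V hQ]

/-- Colorings of a family with a largest element `s`, by the color of `s`. -/
lemma numColorings_insert {N : ℕ} {P : Finset (Finset ℕ)} {s : Finset ℕ} (hs : s ∉ P)
    (h1 : ∀ V ∈ P, NestedIn V s) (h2 : ∀ V ∈ P, ¬ NestedIn s V) :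
    numColorings N (insert s P) = ∑ c ∈ Finset.range N, numColorings c P := by
  have hsP : ∀ {V}, V ∈ P → V ≠ s := fun hV he => hs (he ▸ hV)
  rw [← Fin.sum_univ_eq_sum_range (fun c => numColorings c P)]
  simp only [numColorings]
  rw [← Nat.card_sigma]
  refine Nat.card_congr ⟨fun f => ⟨⟨f.1 s, f.2.lt s (Finset.mem_insert_self _ _)⟩,
    ⟨fun V => if V ∈ P then f.1 V else 0, ?_, ?_, ?_⟩⟩,
    fun p => ⟨fun V => if V = s then p.1 else p.2.1 V, ?_, ?_, ?_⟩, ?_, ?_⟩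
  · intro V hV
    simpa [hV] using f.2.mono V (Finset.mem_insert_of_mem hV) s (Finset.mem_insert_self _ _)
      (hsP hV) (h1 V hV)
  · intro V hV W hW
    simpa [hV, hW] using
      f.2.mono V (Finset.mem_insert_of_mem hV) W (Finset.mem_insert_of_mem hW)
  · intro V hV; simp [hV]
  · intro V hV
    rcases Finset.mem_insert.1 hV with rfl | hV
    · simp
    · simpa [hsP hV] using (p.2.2.lt V hV).trans p.1.2
  · intro V hV W hW hne hn
    rcases Finset.mem_insert.1 hV with hVs | hV <;> rcases Finset.mem_insert.1 hW with hWs | hW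
    · exact absurd (hVs.trans hWs.symm) hne
    · exact absurd (hVs ▸ hn) (h2 W hW)
    · simpa [hsP hV, hWs] using p.2.2.lt V hV
    · simpa [hsP hV, hsP hW] using p.2.2.mono V hV W hW hne hn
  · intro V hV
    rw [Finset.mem_insert, not_or] at hV
    simpa [hV.1] using p.2.2.zero V hV.2
  · intro f
    refine Subtype.ext (funext fun V => ?_)
    by_cases hV : V = s
    · simp [hV]
    · by_cases hP : V ∈ P
      · simp [hV, hP]
      · simpa [hV, hP] using (f.2.zero V (by simp [hV, hP])).symm
  · rintro ⟨c, f⟩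
    have e : (fun V => if V ∈ P then (if V = s then (c : ℕ) else f.1 V) else 0) = f.1 := by
      funext V
      by_cases hP : V ∈ P
      · simp [hP, hsP hP]
      · simp [hP, f.2.zero V hP]
    refine Sigma.ext (Fin.ext (by simp)) ?_
    obtain ⟨f, hf⟩ := f
    simp only at e ⊢
    congr 1
    all_goals simp [e]

namespace NCTree

open BinaryTree

/-- The blocks strictly nested inside the first block. -/
def innerBlocks : NCTree → ℕ → Finset (Finset ℕ)
  | nil, _ => ∅
  | node _ G R, o =>
    if R = nil then ∅ else blocks G (o + 1) ∪ innerBlocks R (o + 1 + G.numNodes)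

lemma core_numNodes_pos {T : NCTree} (hT : T ≠ nil) : 0 < (core T).numNodes := by
  have := core_ne_nil hT
  cases h : core T with
  | nil => exact absurd h this
  | node _ _ _ => simp

lemma restBlocks_eq_union (T : NCTree) (o : ℕ) :
    restBlocks T o = innerBlocks T o ∪ blocks (tail T) (o + (core T).numNodes) := by
  induction T generalizing o with
  | nil => rfl
  | node a G R _ hR =>
    rw [restBlocks_node, innerBlocks, tail, core]
    split_ifs with h
    · subst h; simp [restBlocks]
    · rw [hR, Finset.union_assoc]
      congr 3
      simp only [numNodes]; omega

lemma innerBlocks_bounds {T : NCTree} {o i : ℕ} {V : Finset ℕ} (hV : V ∈ innerBlocks T o)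
    (hi : i ∈ V) : o < i ∧ i + 1 < o + (core T).numNodes := by
  induction T generalizing o with
  | nil => simp [innerBlocks] at hV
  | node a G R _ hR =>
    rw [innerBlocks] at hV
    rw [core]
    split_ifs at hV ⊢ with h
    · simp at hV
    · have := core_numNodes_pos h
      simp only [numNodes]
      rcases Finset.mem_union.1 hV with hV | hV
      · have := blocks_bounds hV hi; omega
      · have := hR hV; omega

lemma spine_core (T : NCTree) (o : ℕ) : spine (core T) o = spine T o := by
  induction T generalizing o with
  | nil => rfl
  | node a G R _ hR =>
    rw [core]
    split_ifs with h
    · subst h; simp [spine]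
    · rw [spine_node, spine_node, hR]

lemma innerBlocks_subset (T : NCTree) (o : ℕ) : innerBlocks T o ⊆ restBlocks T o := by
  rw [restBlocks_eq_union]; exact Finset.subset_union_left

lemma numColorings_blocks_of {T : NCTree} {o N : ℕ}
    (hI : ∀ c, numColorings c (innerBlocks T o) = gapProd (colorings c) T)
    (hT : numColorings N (blocks (tail T) (o + (core T).numNodes)) = colorings N (tail T)) :
    numColorings N (blocks T o) = colorings N T := by
  by_cases h : T = nil
  · subst h; exact numColorings_empty N
  have hlast : o + (core T).numNodes - 1 ∈ spine T o := by
    rw [← spine_core, last_mem_spine (core_ne_nil h)]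
    exact (core_isIrr h).2
  have hpos := core_numNodes_pos h
  have hIne : ∀ {V}, V ∈ innerBlocks T o → V.Nonempty := fun hV =>
    restBlocks_nonempty (innerBlocks_subset T o hV)
  have hlt : ∀ V ∈ insert (spine T o) (innerBlocks T o),
      ∀ W ∈ blocks (tail T) (o + (core T).numNodes), ∀ i ∈ V, ∀ j ∈ W, i < j := by
    intro V hV W hW i hi j hj
    have h2 := blocks_bounds hW hj
    rcases Finset.mem_insert.1 hV with rfl | hV
    · rw [← spine_core] at hi
      have := spine_bounds hi
      omega
    · have := innerBlocks_bounds hV hi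
      omega
  have hne : ∀ V ∈ insert (spine T o) (innerBlocks T o), V.Nonempty := by
    intro V hV
    rcases Finset.mem_insert.1 hV with rfl | hV
    · exact ⟨o, mem_spine_self h o⟩
    · exact hIne hV
  rw [blocks_of_ne_nil h, restBlocks_eq_union, ← Finset.insert_union, numColorings_union,
    numColorings_insert, hT, colorings_eq h]
  · simp only [hI]
  · exact fun hc => spine_notMem_restBlocks h o (innerBlocks_subset T o hc)
  · intro V hV v hv
    have := innerBlocks_bounds hV hv
    exact ⟨o, mem_spine_self h o, _, hlast, by omega, by omega⟩
  · intro V hV hn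
    obtain ⟨c, hc, -, -, h1, -⟩ := hn o (mem_spine_self h o)
    have := innerBlocks_bounds hV hc
    omega
  · rw [Finset.disjoint_left]
    intro V hV hV'
    obtain ⟨i, hi⟩ := hne V hV
    exact lt_irrefl i (hlt V hV V hV' i hi i hi)
  · exact fun V hV W hW => not_nestedIn_of_lt (hne V hV) (hlt V hV W hW)
  · exact fun V hV W hW => not_nestedIn_of_gt (blocks_nonempty hW) (hlt V hV W hW)

/-- The blocks inside the first one are colored gap by gap. Both statements are needed together, since
a left subtree is colored by way of its own inner blocks and tail. -/
lemma numColorings_inner_and_tail (T : NCTree) (o N : ℕ) :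
    numColorings N (innerBlocks T o) = gapProd (colorings N) T ∧
      numColorings N (blocks (tail T) (o + (core T).numNodes)) = colorings N (tail T) := by
  induction T generalizing o N with
  | nil => exact ⟨numColorings_empty N, numColorings_empty N⟩
  | node a G R hG hR =>
    have hG' : numColorings N (blocks G (o + 1)) = colorings N G :=
      numColorings_blocks_of (fun c => (hG (o + 1) c).1) (hG (o + 1) N).2
    rw [innerBlocks, tail, core, gapProd]
    split_ifs with h
    · exact ⟨numColorings_empty N, by simpa using hG'⟩
    · obtain ⟨h1, h2⟩ := hR (o + 1 + G.numNodes) N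
      refine ⟨?_, ?_⟩
      · have hlt : ∀ V ∈ blocks G (o + 1), ∀ W ∈ innerBlocks R (o + 1 + G.numNodes),
            ∀ i ∈ V, ∀ j ∈ W, i < j := by
          intro V hV W hW i hi j hj
          have := blocks_bounds hV hi
          have := innerBlocks_bounds hW hj
          omega
        rw [numColorings_union, hG', h1]
        · exact (disjoint_blocks_restBlocks G R o).mono_right (innerBlocks_subset _ _)
        · exact fun V hV W hW => not_nestedIn_of_lt (blocks_nonempty hV) (hlt V hV W hW)
        · exact fun V hV W hW => not_nestedIn_of_gt
            (restBlocks_nonempty (innerBlocks_subset _ _ hW)) (hlt V hV W hW)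
      · rw [← h2]
        congr 2
        simp only [numNodes]; omega

lemma numColorings_blocks (T : NCTree) (o N : ℕ) :
    numColorings N (blocks T o) = colorings N T :=
  numColorings_blocks_of (fun c => (numColorings_inner_and_tail T o c).1)
    (numColorings_inner_and_tail T o N).2

end NCTree

/-! ### Evaluation of trees by blocks -/

section Segment

variable {α : Type*} (x : ℕ → α)

/-- The word `x_o, …, x_{o+n-1}`. -/
def segment (o n : ℕ) : List α := (List.range' o n).map x

lemma segment_succ (o n : ℕ) : segment x o (n + 1) = x o :: segment x (o + 1) n := by
  simp [segment, List.range'_succ]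

lemma segment_append (o m n : ℕ) :
    segment x o (m + n) = segment x o m ++ segment x (o + m) n := by
  rw [segment, segment, segment, ← List.map_append, List.range'_append_1]

@[simp] lemma length_segment (o n : ℕ) : (segment x o n).length = n := by simp [segment]

/-- If only prefixes of length `n` contribute, the sum has a single term. -/
lemma splitSum_append_of_length {W : Type*} [AddCommMonoid W] {Φ : List α → List α → W} {n : ℕ}
    (h : ∀ u v, u.length ≠ n → Φ u v = 0) (u v : List α) (hu : u.length = n) :
    splitSum Φ (u ++ v) = Φ u v := by
  induction u generalizing Φ n with
  | nil =>
    cases v with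
    | nil => rfl
    | cons y ys =>
      rw [List.nil_append, splitSum_cons, splitSum_eq_zero, add_zero]
      intro a b _
      exact h _ _ (by rw [← hu]; simp)
  | cons y ys ih =>
    rw [List.cons_append, splitSum_cons, h [] _ (by rw [← hu]; simp), zero_add]
    exact ih (n := ys.length) (Φ := fun u v => Φ (y :: u) v)
      (fun a b hab => h _ _ (by rw [← hu]; simpa using hab)) rfl

lemma sort_insert_of_lt {o : ℕ} {s : Finset ℕ} (h : ∀ i ∈ s, o < i) :
    (insert o s).sort (· ≤ ·) = o :: s.sort (· ≤ ·) :=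
  Finset.sort_insert _ (fun i hi => (h i hi).le) fun hc => lt_irrefl o (h o hc)

lemma map_sort_congr {y z : ℕ → α} {s : Finset ℕ} (h : ∀ i ∈ s, y i = z i) :
    (s.sort (· ≤ ·)).map y = (s.sort (· ≤ ·)).map z :=
  List.map_congr_left fun i hi => h i ((Finset.mem_sort _).1 hi)

end Segment

section Fill

open BinaryTree NCTree

variable {A : Type*} [Ring A] [Algebra ℂ A] {B : Subalgebra ℂ A} (g : MLF B) (x : ℕ → A)

/-- The letters `x_i`, each multiplied from the right by the value of the partition of the gap that
follows it. -/
def filledLetter : NCTree → ℕ → ℕ → A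
  | nil, _, i => x i
  | node _ G R, o, i =>
    if i = o then x o * (treeVal g G (segment x (o + 1) G.numNodes) g : A)
    else if i < o + 1 + G.numNodes then filledLetter G (o + 1) i
    else filledLetter R (o + 1 + G.numNodes) i

/-- The value of a tree is obtained from the filled letters of the first block. -/
lemma treeVal_segment (T : NCTree) (o : ℕ) (f : MLF B) :
    treeVal g T (segment x o T.numNodes) f =
      f (((spine T o).sort (· ≤ ·)).map (filledLetter g x T o)) := by
  induction T generalizing o f with
  | nil => simp [segment, treeVal_nil_nil, spine]
  | node a G R _ hR =>
    have hgt : ∀ i ∈ spine R (o + 1 + G.numNodes), o < i := fun i hi => by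
      have := spine_bounds hi; omega
    rw [numNodes, segment_succ, segment_append, treeVal_cons,
      splitSum_append_of_length (n := G.numNodes) _ _ _ (length_segment x _ _), hR, plug_apply,
      spine_node, sort_insert_of_lt hgt, List.map_cons]
    · refine congrArg (f : List A → B) (congrArg₂ List.cons ?_ ?_)
      · simp [filledLetter]
      · refine map_sort_congr fun i hi => ?_
        have := spine_bounds hi
        rw [filledLetter, if_neg (by omega), if_neg (by omega)]
    · intro u v hu
      rw [treeVal_eq_zero g hu]; simp

/-- The recursive description of the filled letters: the letter in front of a block. -/
lemma filledLetter_of_min (T : NCTree) (o : ℕ) {V : Finset ℕ} (hV : V ∈ restBlocks T o)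
    {v : ℕ} (hv : v ∈ V) (hmin : ∀ i ∈ V, v ≤ i) :
    filledLetter g x T o (v - 1) =
      x (v - 1) * (g ((V.sort (· ≤ ·)).map (filledLetter g x T o)) : A) := by
  induction T generalizing o with
  | nil => simp [restBlocks] at hV
  | node a G R hG hR =>
    have hvb := restBlocks_bounds hV hv
    rw [restBlocks_node, Finset.mem_union] at hV
    rcases hV with hV | hV
    · have hb : ∀ i ∈ V, filledLetter g x (node a G R) o i = filledLetter g x G (o + 1) i := by
        intro i hi
        have := blocks_bounds hV hi
        rw [filledLetter, if_neg (by omega), if_pos (by omega)]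
      rw [map_sort_congr hb]
      have hGn : G ≠ nil := by rintro rfl; simp at hV
      rw [blocks_of_ne_nil hGn, Finset.mem_insert] at hV
      rcases hV with rfl | hV
      · have h1 := hmin _ (mem_spine_self hGn (o + 1))
        have : v - 1 = o := by omega
        rw [this, filledLetter, if_pos rfl, treeVal_segment]
      · have h1 := restBlocks_bounds hV hv
        rw [filledLetter, if_neg (by omega), if_pos (by omega), hG (o + 1) hV]
    · have h1 := restBlocks_bounds hV hv
      have hb : ∀ i ∈ V, filledLetter g x (node a G R) o i =
          filledLetter g x R (o + 1 + G.numNodes) i := by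
        intro i hi
        have := restBlocks_bounds hV hi
        rw [filledLetter, if_neg (by omega), if_neg (by omega)]
      rw [map_sort_congr hb, filledLetter, if_neg (by omega), if_neg (by omega),
        hR _ hV]

/-- The recursive description of the filled letters: a letter not in front of a block. -/
lemma filledLetter_of_not_min (hg1 : g [] = 1) (T : NCTree) (o i : ℕ)
    (h : ∀ V ∈ restBlocks T o, i + 1 ∈ V → ∃ j ∈ V, j < i + 1) :
    filledLetter g x T o i = x i := by
  induction T generalizing o with
  | nil => rfl
  | node a G R hG hR =>
    rw [filledLetter]
    rw [restBlocks_node] at h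
    split_ifs with h1 h2
    · subst h1
      have hGn : G = nil := by
        by_contra hGn
        obtain ⟨j, hj, hj'⟩ := h _ (Finset.mem_union_left _ (spine_mem_blocks hGn (i + 1)))
          (mem_spine_self hGn (i + 1))
        have := spine_bounds hj
        omega
      subst hGn
      simp [segment, treeVal_nil_nil, hg1]
    · exact hG (o + 1) fun V hV =>
        h V (Finset.mem_union_left _ (restBlocks_subset G (o + 1) hV))
    · exact hR _ fun V hV => h V (Finset.mem_union_right _ hV)

end Fill

/-! ### Non-crossing partitions as trees -/

section Transfer

variable {n : ℕ}

/-- A block of a partition of `Fin n`, as a set of natural numbers. -/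
def natBlock : Finset (Fin n) ↪ Finset ℕ := (Finset.mapEmbedding Fin.valEmbedding).toEmbedding

/-- The blocks of a partition of `Fin n`, as sets of natural numbers. -/
def natParts (π : SetPart n) : Finset (Finset ℕ) := π.parts.map natBlock

lemma natBlock_apply (V : Finset (Fin n)) : natBlock V = V.map Fin.valEmbedding := rfl

lemma mem_natBlock {V : Finset (Fin n)} {i : ℕ} :
    i ∈ natBlock V ↔ ∃ j ∈ V, (j : ℕ) = i := by
  simp [natBlock_apply]

@[simp] lemma val_mem_natBlock {V : Finset (Fin n)} {i : Fin n} :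
    (i : ℕ) ∈ natBlock V ↔ i ∈ V :=
  Finset.mem_map' Fin.valEmbedding

lemma mem_natParts {π : SetPart n} {W : Finset ℕ} :
    W ∈ natParts π ↔ ∃ V ∈ π.parts, natBlock V = W := by
  simp [natParts]

@[simp] lemma natBlock_mem_natParts {π : SetPart n} {V : Finset (Fin n)} :
    natBlock V ∈ natParts π ↔ V ∈ π.parts :=
  Finset.mem_map' natBlock

lemma natParts_injective : Function.Injective (natParts : SetPart n → _) := fun _ _ h =>
  Finpartition.ext (Finset.map_injective natBlock h)

lemma natParts_isNCPart {π : SetPart n} (h : π.IsNoncrossing) : IsNCPart (natParts π) 0 n where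
  nonempty W hW := by
    obtain ⟨V, hV, rfl⟩ := mem_natParts.1 hW
    exact (π.nonempty_of_mem_parts hV).map
  cover i := by
    constructor
    · rintro ⟨W, hW, hi⟩
      obtain ⟨V, hV, rfl⟩ := mem_natParts.1 hW
      obtain ⟨j, -, rfl⟩ := mem_natBlock.1 hi
      exact ⟨Nat.zero_le _, j.2⟩
    · rintro ⟨-, hi⟩
      exact ⟨natBlock (π.part ⟨i, hi⟩), natBlock_mem_natParts.2 (π.part_mem.2 (Finset.mem_univ _)),
        mem_natBlock.2 ⟨⟨i, hi⟩, π.mem_part (Finset.mem_univ _), rfl⟩⟩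
  disj W hW W' hW' i hi hi' := by
    obtain ⟨V, hV, rfl⟩ := mem_natParts.1 hW
    obtain ⟨V', hV', rfl⟩ := mem_natParts.1 hW'
    obtain ⟨j, hj, rfl⟩ := mem_natBlock.1 hi
    rw [← π.part_eq_of_mem hV hj, π.part_eq_of_mem hV' (val_mem_natBlock.1 hi')]
  noncrossing W hW W' hW' hne := by
    obtain ⟨V, hV, rfl⟩ := mem_natParts.1 hW
    obtain ⟨V', hV', rfl⟩ := mem_natParts.1 hW'
    rintro ⟨p, hp, q, hq, r, hr, s, hs, h1, h2, h3⟩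
    obtain ⟨p, hp', rfl⟩ := mem_natBlock.1 hp
    obtain ⟨q, hq', rfl⟩ := mem_natBlock.1 hq
    obtain ⟨r, hr', rfl⟩ := mem_natBlock.1 hr
    obtain ⟨s, hs', rfl⟩ := mem_natBlock.1 hs
    exact h V hV V' hV' (fun e => hne (congrArg _ e)) ⟨p, hp', q, hq', r, hr', s, hs', h1, h2, h3⟩

lemma exists_natParts_eq {P : Finset (Finset ℕ)} (h : IsNCPart P 0 n) :
    ∃ π : SetPart n, π.IsNoncrossing ∧ natParts π = P := by
  classical
  -- The set of indices in `Fin n` with value in a given set.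
  let res : Finset ℕ → Finset (Fin n) := fun W => Finset.univ.filter fun i => (i : ℕ) ∈ W
  have hres : ∀ W ∈ P, natBlock (res W) = W := fun W hW => by
    ext i
    rw [mem_natBlock]
    constructor
    · rintro ⟨j, hj, rfl⟩
      exact (Finset.mem_filter.1 hj).2
    · intro hi
      exact ⟨⟨i, (h.mem_bounds hW hi).2⟩, by simpa [res] using hi, rfl⟩
  let π : SetPart n := Finpartition.ofExistsUnique (P.image res) (fun _ _ => Finset.subset_univ _)
    (by
      intro i _
      obtain ⟨W, hW, hi⟩ := (h.cover i).2 ⟨Nat.zero_le _, i.2⟩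
      refine ⟨res W, ⟨Finset.mem_image_of_mem _ hW, by simpa [res] using hi⟩, ?_⟩
      rintro _ ⟨hV, hiV⟩
      obtain ⟨W', hW', rfl⟩ := Finset.mem_image.1 hV
      rw [h.disj W' hW' W hW i (Finset.mem_filter.1 hiV).2 hi])
    (by
      intro he
      obtain ⟨W, hW, hWe⟩ := Finset.mem_image.1 he
      have := h.nonempty W hW
      rw [← hres W hW, hWe] at this
      exact absurd this (by simp [natBlock_apply]))
  have hπ : natParts π = P := by
    ext W
    rw [mem_natParts]
    constructor
    · rintro ⟨V, hV, rfl⟩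
      obtain ⟨W, hW, rfl⟩ := Finset.mem_image.1 hV
      rwa [hres W hW]
    · intro hW
      exact ⟨res W, Finset.mem_image_of_mem _ hW, hres W hW⟩
  refine ⟨π, ?_, hπ⟩
  rintro V hV W hW hne ⟨p, hp, q, hq, r, hr, s, hs, h1, h2, h3⟩
  refine h.noncrossing (natBlock V) ?_ (natBlock W) ?_ (fun e => hne (natBlock.injective e))
    ⟨p, val_mem_natBlock.2 hp, q, val_mem_natBlock.2 hq, r, val_mem_natBlock.2 hr,
      s, val_mem_natBlock.2 hs, h1, h2, h3⟩
  · rw [← hπ]; exact natBlock_mem_natParts.2 hV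
  · rw [← hπ]; exact natBlock_mem_natParts.2 hW

open NCTree in
/-- Sums over non-crossing partitions are sums over trees. -/
lemma sum_NC_eq_sum_trees {W : Type*} [AddCommMonoid W] {Φ : SetPart n → W} {Ψ : NCTree → W}
    (h : ∀ π T, natParts π = blocks T 0 → T.numNodes = n → Φ π = Ψ T) :
    ∑ π ∈ NC n, Φ π = ∑ T ∈ ofSize n, Ψ T := by
  have hex : ∀ π : SetPart n, π.IsNoncrossing →
      ∃ T : NCTree, T.numNodes = n ∧ blocks T 0 = natParts π := fun π hπ => by
    simpa using exists_blocks_eq (Nat.zero_le n) (natParts_isNCPart hπ)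
  choose! F hF hF' using hex
  have hNC : ∀ π, π ∈ NC n ↔ π.IsNoncrossing := fun π => by simp [NC]
  refine Finset.sum_bij (fun π _ => F π) ?_ ?_ ?_ ?_
  · intro π hπ
    exact BinaryTree.mem_treesOfNumNodesEq.2 (hF π ((hNC π).1 hπ))
  · intro π hπ π' hπ' he
    apply natParts_injective
    rw [← hF' π ((hNC π).1 hπ), ← hF' π' ((hNC π').1 hπ'), he]
  · intro T hT
    have hn : T.numNodes = n := BinaryTree.mem_treesOfNumNodesEq.1 hT
    have hT' := blocks_isNCPart T 0
    rw [hn, Nat.zero_add] at hT'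
    obtain ⟨π, hπ, hπT⟩ := exists_natParts_eq hT'
    refine ⟨π, (hNC π).2 hπ, blocks_injective ((hF π hπ).trans hn.symm) ((hF' π hπ).trans hπT)⟩
  · intro π hπ
    exact h π _ (hF' π ((hNC π).1 hπ)).symm (hF π ((hNC π).1 hπ))

lemma nestedIn_natBlock {V W : Finset (Fin n)} :
    NestedIn (natBlock W) (natBlock V) ↔ Nested W V := by
  constructor
  · intro h w hw
    obtain ⟨a, ha, b, hb, h1, h2⟩ := h w (val_mem_natBlock.2 hw)
    obtain ⟨a, ha', rfl⟩ := mem_natBlock.1 ha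
    obtain ⟨b, hb', rfl⟩ := mem_natBlock.1 hb
    exact ⟨a, ha', b, hb', h1, h2⟩
  · intro h w hw
    obtain ⟨w, hw', rfl⟩ := mem_natBlock.1 hw
    obtain ⟨a, ha, b, hb, h1, h2⟩ := h w hw'
    exact ⟨a, val_mem_natBlock.2 ha, b, val_mem_natBlock.2 hb, h1, h2⟩

lemma treeFactorial_eq {π : SetPart n} {T : NCTree} (h : natParts π = NCTree.blocks T 0) :
    treeFactorial π = NCTree.hook T := by
  rw [← NCTree.prod_nested_blocks T 0, ← h, natParts, Finset.prod_map, treeFactorial]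
  refine Finset.prod_congr rfl fun V _ => ?_
  rw [Finset.filter_map, Finset.card_map]
  congr 1
  exact Finset.filter_congr fun W _ => nestedIn_natBlock.symm

lemma card_parts_eq {π : SetPart n} {T : NCTree} (h : natParts π = NCTree.blocks T 0) :
    π.parts.card = NCTree.numBlocks T := by
  rw [← NCTree.card_blocks T 0, ← h, natParts, Finset.card_map]

lemma isInterval_iff {π : SetPart n} {T : NCTree} (h : natParts π = NCTree.blocks T 0) :
    π.IsInterval ↔ NCTree.IsInterval T = true := by
  rw [← NCTree.blocks_isConvex T 0, ← h]
  constructor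
  · intro H W hW i hi j hj k hik hkj
    obtain ⟨V, hV, rfl⟩ := mem_natParts.1 hW
    obtain ⟨i, hi', rfl⟩ := mem_natBlock.1 hi
    obtain ⟨j, hj', rfl⟩ := mem_natBlock.1 hj
    exact mem_natBlock.2 ⟨⟨k, hkj.trans_lt j.2⟩, H V hV i hi' j hj' _ hik hkj, rfl⟩
  · intro H V hV i hi j hj k hik hkj
    exact val_mem_natBlock.1 (H _ (natBlock_mem_natParts.2 hV) i (val_mem_natBlock.2 hi) j
      (val_mem_natBlock.2 hj) k hik hkj)

/-- The block of the first point. -/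
lemma natBlock_part_zero {π : SetPart n} {T : NCTree} (h : natParts π = NCTree.blocks T 0)
    (hn : 0 < n) (hT : T ≠ .nil) : natBlock (π.part ⟨0, hn⟩) = NCTree.spine T 0 := by
  have h1 : natBlock (π.part ⟨0, hn⟩) ∈ NCTree.blocks T 0 := by
    rw [← h]
    exact natBlock_mem_natParts.2 (π.part_mem.2 (Finset.mem_univ _))
  exact (NCTree.blocks_isNCPart T 0).disj _ h1 _ (NCTree.spine_mem_blocks hT 0) 0
    (mem_natBlock.2 ⟨_, π.mem_part (Finset.mem_univ _), rfl⟩) (NCTree.mem_spine_self hT 0)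

lemma isIrreducible_iff {π : SetPart n} {T : NCTree} (h : natParts π = NCTree.blocks T 0)
    (hTn : T.numNodes = n) (hn : 0 < n) : π.IsIrreducible ↔ NCTree.IsIrr T := by
  have hT : T ≠ .nil := by rintro rfl; simp at hTn; omega
  have hs := natBlock_part_zero h hn hT
  have hl := NCTree.last_mem_spine hT 0
  rw [hTn, Nat.zero_add] at hl
  rw [NCTree.IsIrr, ← hl, ← hs]
  constructor
  · rintro ⟨V, hV, H⟩
    refine ⟨hT, ?_⟩
    rw [π.part_eq_of_mem hV (H ⟨0, hn⟩ (Or.inl rfl))]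
    exact mem_natBlock.2 ⟨⟨n - 1, by omega⟩, H _ (Or.inr (by simp; omega)), rfl⟩
  · rintro ⟨-, H⟩
    refine ⟨_, π.part_mem.2 (Finset.mem_univ ⟨0, hn⟩), ?_⟩
    rintro i (hi | hi)
    · rw [show i = ⟨0, hn⟩ from Fin.ext hi]
      exact π.mem_part (Finset.mem_univ _)
    · obtain ⟨j, hj, hjn⟩ := mem_natBlock.1 H
      rwa [show i = j from Fin.ext (by omega)]

/-! ### Counting colorings by the number of colors used -/

/-- There are at most `n` blocks. -/
lemma increasingColorings_eq_zero {k : ℕ} (π : SetPart n) (hk : n < k) :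
    increasingColorings k π = 0 := by
  rw [increasingColorings, Fintype.card_eq_zero_iff]
  refine ⟨fun f => ?_⟩
  have h1 := Fintype.card_le_of_surjective _ f.2.1
  have h2 : π.parts.card ≤ n := by simpa using π.card_parts_le_card
  simp at h1
  omega

/-- Increasing colorings of a partition. -/
def IncColoring (N : ℕ) (π : SetPart n) : Type :=
  {f : π.parts → Fin N // ∀ V W : π.parts, V ≠ W →
    Nested (V : Finset (Fin n)) (W : Finset (Fin n)) → f V < f W}

instance (N : ℕ) (π : SetPart n) : Fintype (IncColoring N π) := by
  unfold IncColoring; infer_instance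

lemma numColorings_natParts (N : ℕ) (π : SetPart n) :
    numColorings N (natParts π) = Fintype.card (IncColoring N π) := by
  classical
  rw [← Nat.card_eq_fintype_card, numColorings]
  refine Nat.card_eq_of_bijective (fun f => (⟨fun V => ⟨f.1 (natBlock V.1),
      f.2.lt _ (natBlock_mem_natParts.2 V.2)⟩, fun V W hne hVW =>
      f.2.mono _ (natBlock_mem_natParts.2 V.2) _ (natBlock_mem_natParts.2 W.2)
        (fun e => hne (Subtype.ext (natBlock.injective e))) (nestedIn_natBlock.2 hVW)⟩ :
      IncColoring N π)) ⟨?_, ?_⟩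
  · intro f g hfg
    refine Subtype.ext (funext fun W => ?_)
    by_cases hW : W ∈ natParts π
    · obtain ⟨V, hV, rfl⟩ := mem_natParts.1 hW
      exact congrArg Fin.val (congrFun (congrArg Subtype.val hfg) ⟨V, hV⟩)
    · rw [f.2.zero W hW, g.2.zero W hW]
  · intro f
    have key : ∃ F : Finset ℕ → ℕ, (∀ V : π.parts, F (natBlock V.1) = f.1 V) ∧
        ∀ W, W ∉ natParts π → F W = 0 := by
      refine ⟨fun W => if h : ∃ V : π.parts, natBlock V.1 = W then f.1 h.choose else 0, ?_, ?_⟩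
      · intro V
        have hex : ∃ V' : π.parts, natBlock V'.1 = natBlock V.1 := ⟨V, rfl⟩
        have : hex.choose = V := Subtype.ext (natBlock.injective hex.choose_spec)
        simp only [dif_pos hex, this]
      · intro W hW
        refine dif_neg ?_
        rintro ⟨V, rfl⟩
        exact hW (natBlock_mem_natParts.2 V.2)
    obtain ⟨F, hF, hF0⟩ := key
    refine ⟨⟨F, ⟨?_, ?_, hF0⟩⟩, ?_⟩
    · intro W hW
      obtain ⟨V, hV, rfl⟩ := mem_natParts.1 hW
      rw [hF ⟨V, hV⟩]
      exact (f.1 _).2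
    · intro W hW W' hW' hne hWW
      obtain ⟨V, hV, rfl⟩ := mem_natParts.1 hW
      obtain ⟨V', hV', rfl⟩ := mem_natParts.1 hW'
      rw [hF ⟨V, hV⟩, hF ⟨V', hV'⟩]
      exact f.2 _ _ (fun e => hne (congrArg (fun U : π.parts => natBlock U.1) e))
        (nestedIn_natBlock.1 hWW)
    · exact Subtype.ext (funext fun V => Fin.ext (hF V))

/-- Colorings with a given set of colors used. -/
lemma card_colorings_image (N : ℕ) (π : SetPart n) (S : Finset (Fin N)) :
    (Finset.univ.filter fun f : IncColoring N π => Finset.univ.image f.1 = S).card =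
      increasingColorings S.card π := by
  rw [increasingColorings, ← Fintype.card_subtype]
  -- Renumbering the colors increasingly preserves the conditions.
  let e : Fin S.card ≃o S := S.orderIsoOfFin rfl
  refine (Fintype.card_congr (Equiv.ofBijective (fun f => (⟨⟨fun V => (e (f.1 V)).1, ?_⟩, ?_⟩ :
    {f : IncColoring N π // Finset.univ.image f.1 = S})) ⟨?_, ?_⟩)).symm
  · intro V W hne hVW
    exact Subtype.coe_lt_coe.2 (e.lt_iff_lt.2 (f.2.2 V W hne hVW))
  · ext c
    simp only [Finset.mem_image, Finset.mem_univ, true_and]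
    constructor
    · rintro ⟨V, rfl⟩
      exact (e (f.1 V)).2
    · intro hc
      obtain ⟨V, hV⟩ := f.2.1 (e.symm ⟨c, hc⟩)
      exact ⟨V, by rw [hV]; simp⟩
  · intro f g hfg
    refine Subtype.ext (funext fun V => e.injective (Subtype.ext ?_))
    exact congrFun (congrArg (fun u => u.1.1) hfg) V
  · rintro ⟨⟨f, hf⟩, rfl⟩
    have hm : ∀ V, f V ∈ Finset.univ.image f := fun V =>
      Finset.mem_image_of_mem _ (Finset.mem_univ V)
    refine ⟨⟨fun V => e.symm ⟨f V, hm V⟩, ?_, ?_⟩, ?_⟩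
    · intro c
      obtain ⟨V, -, hV⟩ := Finset.mem_image.1 (e c).2
      refine ⟨V, e.injective (Subtype.ext ?_)⟩
      rw [e.apply_symm_apply]
      exact hV
    · intro V W hne hVW
      exact e.symm.lt_iff_lt.2 (hf V W hne hVW)
    · refine Subtype.ext (Subtype.ext (funext fun V => ?_))
      exact congrArg Subtype.val (e.apply_symm_apply ⟨f V, hm V⟩)

/-- A coloring with colors from `Fin N` is a choice of the colors that are used and a coloring that
uses all of them. -/
lemma numColorings_eq_sum_choose (N : ℕ) (π : SetPart n) :
    numColorings N (natParts π) =
      ∑ k ∈ Finset.range (n + 1), N.choose k * increasingColorings k π := by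
  rw [numColorings_natParts, ← Finset.card_univ, Finset.card_eq_sum_card_fiberwise
    (f := fun f : IncColoring N π => Finset.univ.image f.1)
    (t := (Finset.univ : Finset (Fin N)).powerset) (fun _ _ => by simp)]
  simp only [card_colorings_image]
  rw [Finset.sum_powerset_apply_card (fun k => increasingColorings k π), Finset.card_univ,
    Fintype.card_fin]
  simp only [smul_eq_mul]
  -- Terms with more colors than points or than available colors vanish.
  rcases le_total n N with h | h
  · symm
    refine Finset.sum_subset (Finset.range_subset_range.2 (by omega)) fun k _ hk => ?_
    rw [increasingColorings_eq_zero π (by simpa using hk), mul_zero]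
  · refine Finset.sum_subset (Finset.range_subset_range.2 (by omega)) fun k _ hk => ?_
    rw [Nat.choose_eq_zero_of_lt (by simpa using hk), zero_mul]

end Transfer

/-! ### The multiplicative family as the value of a tree -/

section MultFamily

variable {A : Type*} [Ring A] [Algebra ℂ A] {B : Subalgebra ℂ A}

/-- The recursion for the multiplicative family computes letters `y` that satisfy the simultaneous
equations `y_{m-1} = x_{m-1} f(y restricted to the block of m)`, for the minima `m` of blocks. At an
intermediate stage, the letters in front of the blocks already deleted agree with `y` and the other
letters with `x`. -/
lemma evalBlocks_eq_blockEval (f : ∀ k, (Fin k → A) → B) {n : ℕ} (π : SetPart n)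
    {x y : Fin n → A} {z : Fin n} (hz : (z : ℕ) = 0)
    (hy : ∀ i m : Fin n, (i : ℕ) + 1 = m → (∀ j ∈ π.part m, m ≤ j) →
      y i = x i * (blockEval f (π.part m) y : A))
    (hy' : ∀ i : Fin n, (∀ m : Fin n, (i : ℕ) + 1 = m → ¬ ∀ j ∈ π.part m, m ≤ j) → y i = x i)
    (L : List (Fin n)) (hL : L.Pairwise (· > ·)) (hmin : ∀ m ∈ L, ∀ j ∈ π.part m, m ≤ j)
    (hzL : z ∈ L) (w : Fin n → A)
    (hw : ∀ i m : Fin n, (i : ℕ) + 1 = m → (∀ j ∈ π.part m, m ≤ j) → m ∉ L → w i = y i)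
    (hw' : ∀ i : Fin n, (∀ m : Fin n, (i : ℕ) + 1 = m → (∀ j ∈ π.part m, m ≤ j) → m ∈ L) →
      w i = x i) :
    evalBlocks f π L w = blockEval f (π.part z) y := by
  induction L generalizing w with
  | nil => simp at hzL
  | cons m L ih =>
    have hle : ∀ m' ∈ m :: L, m' ≤ m := fun m' hm' => by
      rcases List.mem_cons.1 hm' with rfl | h
      · exact le_rfl
      · exact (List.rel_of_pairwise_cons hL h).le
    -- A letter of the block of `m` is in front of a block only if that block starts after `m`, the
    -- largest remaining minimum, hence has been deleted already.
    have hwy : ∀ i ∈ π.part m, w i = y i := by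
      intro i hi
      have hmi := hmin m List.mem_cons_self i hi
      by_cases hc : ∃ m' : Fin n, (i : ℕ) + 1 = m' ∧ ∀ j ∈ π.part m', m' ≤ j
      · obtain ⟨m', h1, h2⟩ := hc
        refine hw i m' h1 h2 fun h3 => ?_
        have := Fin.le_def.1 (hle m' h3)
        have := Fin.le_def.1 hmi
        omega
      · rw [hy' i fun m' h1 h2 => hc ⟨m', h1, h2⟩]
        exact hw' i fun m' h1 h2 => absurd ⟨m', h1, h2⟩ hc
    have hE : blockEval f (π.part m) w = blockEval f (π.part m) y := by
      unfold blockEval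
      congr 1
      funext i
      exact hwy _ (Finset.orderEmbOfFin_mem _ _ _)
    cases L with
    | nil =>
      have hzm : z = m := by simpa using hzL
      rw [hzm]
      exact hE
    | cons m' L =>
      rw [evalBlocks]
      have hm : m ∉ m' :: L := fun h => lt_irrefl m (List.rel_of_pairwise_cons hL h)
      refine ih hL.of_cons (fun k hk => hmin k (List.mem_cons_of_mem _ hk)) ?_ _ ?_ ?_
      · rcases List.mem_cons.1 hzL with h | h
        · have := Fin.lt_def.1 (List.rel_of_pairwise_cons hL (a' := m') List.mem_cons_self)
          rw [← h] at this
          omega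
        · exact h
      · intro i k hik hk hkL
        split_ifs with him
        · have : m = k := Fin.ext (him.symm.trans hik)
          subst this
          rw [hE, hy i m him hk]
          congr 1
          refine hw' i fun k' hik' _ => ?_
          rw [show k' = m from Fin.ext (hik'.symm.trans him)]
          exact List.mem_cons_self
        · refine hw i k hik hk fun h => ?_
          rcases List.mem_cons.1 h with h | h
          · exact him (h ▸ hik)
          · exact hkL h
      · intro i hi
        rw [if_neg fun him => hm (hi m him (hmin m List.mem_cons_self))]
        exact hw' i fun k hik hk => List.mem_cons_of_mem _ (hi k hik hk)

lemma multFamily_eq_blockEval (f : ∀ k, (Fin k → A) → B) {n : ℕ} (hn : 0 < n) (π : SetPart n)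
    {x y : Fin n → A}
    (hy : ∀ i m : Fin n, (i : ℕ) + 1 = m → (∀ j ∈ π.part m, m ≤ j) →
      y i = x i * (blockEval f (π.part m) y : A))
    (hy' : ∀ i : Fin n, (∀ m : Fin n, (i : ℕ) + 1 = m → ¬ ∀ j ∈ π.part m, m ≤ j) → y i = x i) :
    multFamily f π x = blockEval f (π.part ⟨0, hn⟩) y := by
  have hmem : ∀ m, m ∈ blockMinima π ↔ ∀ j ∈ π.part m, m ≤ j := fun m => by simp [blockMinima]
  refine evalBlocks_eq_blockEval f π rfl hy hy' _ ?_ (fun m hm => (hmem m).1 hm) ?_ x ?_ ?_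
  · exact (List.pairwise_reverse.2 (List.pairwise_lt_finRange n)).filter _
  · exact (hmem _).2 fun j _ => Fin.le_def.2 (Nat.zero_le _)
  · exact fun i m _ hm hmL => absurd ((hmem m).2 hm) hmL
  · exact fun i _ => rfl

/-- The evaluation of a block in terms of the sorted list of its points. -/
lemma blockEval_eq {f : ∀ k, (Fin k → A) → B} {g : List A → B}
    (hfg : ∀ k, 1 ≤ k → ∀ z : Fin k → A, f k z = g (List.ofFn z)) {n : ℕ} {V : Finset (Fin n)}
    (hV : V.Nonempty) (y : ℕ → A) :
    blockEval f V (fun i => y i) = g (((natBlock V).sort (· ≤ ·)).map y) := by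
  rw [blockEval, hfg _ hV.card_pos]
  congr 1
  rw [natBlock_apply, ← StrictMonoOn.map_finsetSort Fin.valEmbedding V
      (fun _ _ _ _ h => h), ← Finset.listMap_orderEmbOfFin_finRange V rfl, List.ofFn_eq_map,
    List.map_map, List.map_map]
  rfl

/-- The multiplicative family of a sequence of maps is the value of the tree that encodes the
partition. -/
lemma multFamily_eq_treeVal {f : ∀ k, (Fin k → A) → B} {g : MLF B} (hg1 : g [] = 1)
    (hfg : ∀ k, 1 ≤ k → ∀ z : Fin k → A, f k z = g (List.ofFn z)) {n : ℕ} (hn : 0 < n)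
    {π : SetPart n} {T : NCTree} (h : natParts π = NCTree.blocks T 0) (hTn : T.numNodes = n)
    (a : Fin n → A) : multFamily f π a = treeVal g T (List.ofFn a) g := by
  have hT : T ≠ .nil := by rintro rfl; simp at hTn; omega
  -- The letters beyond `n` are never used.
  let x : ℕ → A := fun i => if hi : i < n then a ⟨i, hi⟩ else 0
  have hx : ∀ i : Fin n, x i = a i := fun i => dif_pos i.2
  have hseg : segment x 0 T.numNodes = List.ofFn a := by
    rw [hTn]
    refine List.ext_getElem (by simp) fun i h1 h2 => ?_
    simp only [segment, List.getElem_map, List.getElem_range', List.getElem_ofFn]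
    simp only [length_segment] at h1
    simp [x, h1]
  have hne : ∀ m, (π.part m).Nonempty := fun m => π.part_nonempty.2 (Finset.mem_univ _)
  have hrest : ∀ m : Fin n, (∀ j ∈ π.part m, m ≤ j) → 0 < (m : ℕ) →
      natBlock (π.part m) ∈ NCTree.restBlocks T 0 := by
    intro m hm h0
    rw [NCTree.restBlocks_eq_erase hT, ← h, Finset.mem_erase]
    refine ⟨fun he => ?_, natBlock_mem_natParts.2 (π.part_mem.2 (Finset.mem_univ _))⟩
    have := NCTree.mem_spine_self hT 0
    rw [← he] at this
    obtain ⟨j, hj, hj0⟩ := mem_natBlock.1 this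
    have := Fin.le_def.1 (hm j hj)
    omega
  rw [← hseg, treeVal_segment, ← natBlock_part_zero h hn hT, ← blockEval_eq hfg (hne _)]
  -- The filled letters of the tree solve the equations for `y`.
  refine multFamily_eq_blockEval f hn π ?_ ?_
  · intro i m him hm
    have := filledLetter_of_min g x T 0 (hrest m hm (by omega))
      (val_mem_natBlock.2 (π.mem_part (Finset.mem_univ m))) (fun k hk => by
        obtain ⟨j, hj, rfl⟩ := mem_natBlock.1 hk
        exact hm j hj)
    rw [← him, Nat.add_sub_cancel, hx] at this
    rw [this, blockEval_eq hfg (hne m)]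
  · intro i hi
    rw [filledLetter_of_not_min g x hg1 T 0 i, hx]
    intro W hW hiW
    have hW' := NCTree.restBlocks_subset T 0 hW
    rw [← h] at hW'
    obtain ⟨V, hV, rfl⟩ := mem_natParts.1 hW'
    obtain ⟨m, hm, him⟩ := mem_natBlock.1 hiW
    have := hi m him.symm
    rw [π.part_eq_of_mem hV hm] at this
    push Not at this
    obtain ⟨j, hj, hjm⟩ := this
    exact ⟨j, val_mem_natBlock.2 hj, by rw [← him]; exact hjm⟩

end MultFamily

/-! ### Sums over partitions as sums over trees -/

section Sums

open NCTree

variable {A : Type*} [Ring A] [Algebra ℂ A] {B : Subalgebra ℂ A}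

/-- The sequence of maps `A^k → B` given by a functional on words. -/
def toSeq (g : MLF B) (k : ℕ) (z : Fin k → A) : B := g (List.ofFn z)

lemma toSeq_eq_unitize (g : MLF B) (k : ℕ) (hk : 1 ≤ k) (z : Fin k → A) :
    toSeq g k z = unitize g (List.ofFn z) := by
  rw [toSeq, unitize_of_ne_nil]
  simp only [ne_eq, List.ofFn_eq_nil_iff]
  omega

variable {f : ∀ k, (Fin k → A) → B} {g : MLF B} {n : ℕ}

lemma sum_NC_multFamily (hg1 : g [] = 1)
    (hfg : ∀ k, 1 ≤ k → ∀ z : Fin k → A, f k z = g (List.ofFn z)) (hn : 0 < n)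
    {w : SetPart n → ℂ} {p : NCTree → ℂ}
    (hwp : ∀ π T, natParts π = blocks T 0 → T.numNodes = n → w π = p T) (a : Fin n → A) :
    ∑ π ∈ NC n, w π • multFamily f π a = treeSum g p (List.ofFn a) g := by
  rw [treeSum, List.length_ofFn]
  exact sum_NC_eq_sum_trees fun π T h hT => by
    rw [hwp π T h hT, multFamily_eq_treeVal hg1 hfg hn h hT]

lemma sum_NCirr_multFamily (hg1 : g [] = 1)
    (hfg : ∀ k, 1 ≤ k → ∀ z : Fin k → A, f k z = g (List.ofFn z)) (hn : 0 < n)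
    {w : SetPart n → ℂ} {p : NCTree → ℂ}
    (hwp : ∀ π T, natParts π = blocks T 0 → T.numNodes = n → w π = p T) (a : Fin n → A) :
    ∑ π ∈ NCirr n, w π • multFamily f π a = irrSum g p (List.ofFn a) g := by
  have h1 : NCirr n = (NC n).filter fun π => π.IsIrreducible := by
    rw [NCirr, NC, Finset.filter_filter]
  rw [irrSum, ← sum_NC_multFamily (w := fun π => if π.IsIrreducible then w π else 0) hg1 hfg hn,
    h1, Finset.sum_filter]
  · simp only [ite_smul, zero_smul]
  · intro π T h hT
    simp only [isIrreducible_iff h hT hn, hwp π T h hT]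

lemma sum_IntPart_multFamily (hg1 : g [] = 1)
    (hfg : ∀ k, 1 ≤ k → ∀ z : Fin k → A, f k z = g (List.ofFn z)) (hn : 0 < n) (a : Fin n → A) :
    ∑ π ∈ IntPart n, multFamily f π a =
      treeSum g (fun T => if IsInterval T then 1 else 0) (List.ofFn a) g := by
  have h1 : IntPart n = (NC n).filter fun π => π.IsInterval := by
    rw [IntPart, NC, Finset.filter_filter]
  rw [← sum_NC_multFamily (w := fun π => if π.IsInterval then 1 else 0) hg1 hfg hn,
    h1, Finset.sum_filter]
  · simp only [ite_smul, zero_smul, one_smul]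
  · intro π T h hT
    simp only [isInterval_iff h]

lemma exists_tree {π : SetPart n} (hπ : π.IsNoncrossing) :
    ∃ T : NCTree, natParts π = blocks T 0 ∧ T.numNodes = n := by
  obtain ⟨T, h1, h2⟩ := exists_blocks_eq (Nat.zero_le n) (natParts_isNCPart hπ)
  exact ⟨T, h2.symm, by simpa using h1⟩

/-! ### Rescaling a functional -/

/-- A non-empty tree evaluates the outer functional once, on a non-empty word. -/
lemma treeVal_smul_root {f f' : MLF B} {s : ℂ} (h : ∀ l, l ≠ [] → f' l = s • f l) {T : NCTree}
    (hT : T ≠ .nil) (l : List A) : treeVal g T l f' = s • treeVal g T l f := by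
  cases T with
  | nil => exact absurd rfl hT
  | node _ G R =>
    cases l with
    | nil => simp [treeVal_node_nil]
    | cons x xs =>
      have hp : ∀ w, plug x w f' = s • plug x w f := fun w =>
        Subtype.ext (funext fun l => h (x * w :: l) (by simp))
      simp only [treeVal_cons, hp, map_smul, smul_splitSum]

/-- Rescaling the inner functional by `s` gives a factor `s` for each block but the first one. -/
lemma treeVal_smul {g' : MLF B} {s : ℂ} (hg1 : g [] = 1) (hg1' : g' [] = 1)
    (h : ∀ l, l ≠ [] → g' l = s • g l) (T : NCTree) (l : List A) (f : MLF B) :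
    treeVal g' T l f = s ^ numRest T • treeVal g T l f := by
  induction T generalizing l f with
  | nil => simp [treeVal, numRest]
  | node a G R ihG ihR =>
    cases l with
    | nil => simp [treeVal_node_nil]
    | cons x xs =>
      have hG : ∀ u, treeVal g' G u g' = s ^ numBlocks G • treeVal g G u g := by
        intro u
        by_cases hG : G = .nil
        · subst hG
          simp only [treeVal, numBlocks, if_true, pow_zero, one_smul]
          split_ifs
          · exact hg1'.trans hg1.symm
          · rfl
        · rw [treeVal_smul_root h hG, ihG, numBlocks_of_ne_nil hG, pow_succ', smul_smul]
      simp only [treeVal_cons, hG, ihR, map_smul, LinearMap.smul_apply, smul_splitSum, smul_smul,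
        numRest_node]
      refine splitSum_congr fun u v _ => ?_
      rw [pow_add, mul_comm]

/-- The multiplicative family is homogeneous of degree `|π|`; here for the factor `-1`. -/
lemma multFamily_neg (g : MLF B) (hn : 0 < n) {π : SetPart n} (hπ : π.IsNoncrossing)
    (a : Fin n → A) : multFamily (toSeq (-g)) π a = (-1 : ℂ) ^ π.parts.card •
      multFamily (toSeq g) π a := by
  obtain ⟨T, h, hT⟩ := exists_tree hπ
  have hT0 : T ≠ .nil := by rintro rfl; simp at hT; omega
  have hneg : ∀ l, l ≠ [] → unitize (-g) l = (-1 : ℂ) • unitize g l := fun l hl => by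
    rw [unitize_of_ne_nil _ hl, unitize_of_ne_nil _ hl, neg_one_smul]; rfl
  rw [multFamily_eq_treeVal (unitize_nil _) (toSeq_eq_unitize _) hn h hT,
    multFamily_eq_treeVal (unitize_nil _) (toSeq_eq_unitize _) hn h hT,
    treeVal_smul (unitize_nil _) (unitize_nil _) hneg, treeVal_smul_root hneg hT0, smul_smul,
    card_parts_eq h, numBlocks_of_ne_nil hT0, pow_succ]

/-! ### Cumulants are multilinear and right modular -/

/-- The functional `x_1 ⋯ x_n ↦ E(x_1 ⋯ x_n)`. -/
def momentFun (E : ConditionalExpectation B) : MLF B :=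
  ⟨fun l => E.toLinearMap l.prod, fun l₁ l₂ => by
    have : (fun y => E.toLinearMap (l₁ ++ y :: l₂).prod) =
        (E.toLinearMap ∘ₗ LinearMap.mulLeft ℂ l₁.prod ∘ₗ LinearMap.mulRight ℂ l₂.prod) := by
      funext y
      simp
    rw [this]
    exact LinearMap.isLinear _⟩

lemma momentFun_apply (E : ConditionalExpectation B) (l : List A) :
    momentFun E l = E.toLinearMap l.prod := rfl

lemma momentFun_isRightModular (E : ConditionalExpectation B) :
    IsRightModular (momentFun E) := by
  intro l x b
  have := E.map_bimodule 1 b (l.prod * x)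
  simpa [momentFun_apply, mul_assoc] using this

/-- The functional that agrees with `f` on words of length `n` and with `g` on the other words. -/
def updateLength (n : ℕ) (f g : MLF B) : MLF B :=
  ⟨fun l => if l.length = n then f l else g l, fun l₁ l₂ => by
    have : ∀ y : A, (l₁ ++ y :: l₂).length = l₁.length + l₂.length + 1 := fun y => by
      simp; omega
    simp only [this]
    split_ifs
    · exact f.2 l₁ l₂
    · exact g.2 l₁ l₂⟩

lemma updateLength_apply (n : ℕ) (f g : MLF B) (l : List A) :
    updateLength n f g l = if l.length = n then f l else g l := rfl

lemma IsRightModular.updateLength {f g : MLF B} (hf : IsRightModular f) (hg : IsRightModular g)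
    (n : ℕ) : IsRightModular (updateLength n f g) := by
  intro l x b
  simp only [updateLength_apply, List.length_append, List.length_singleton]
  split_ifs
  · exact hf l x b
  · exact hg l x b

/-- The value of a fixed tree, as a functional. -/
def treeFun (g : MLF B) (T : NCTree) : MLF B :=
  ⟨fun l => treeVal g T l g, treeVal_isLinearMap g T g⟩

lemma coe_sum_apply {ι : Type*} (s : Finset ι) (F : ι → MLF B) (l : List A) :
    (∑ i ∈ s, F i : MLF B) l = ∑ i ∈ s, F i l := by
  rw [Submodule.coe_sum, Finset.sum_apply]

/-- The cumulants of order less than `n` come from a multilinear and right modular functional. -/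
lemma exists_functional_truncated_cumulant (E : ConditionalExpectation B)
    {C : ∀ n, Finset (SetPart n)} (hC : ∀ n, C n ⊆ NC n) (w : ∀ n, SetPart n → ℂ) (n : ℕ) :
    ∃ c : MLF B, c [] = 1 ∧ IsRightModular c ∧ ∀ k, 1 ≤ k → ∀ z : Fin k → A,
      (if k < n then cumulant E C w k z else 0) = c (List.ofFn z) := by
  induction n with
  | zero =>
    refine ⟨unitize 0, rfl, ?_, fun k hk z => ?_⟩
    · exact IsRightModular.unitize fun _ _ _ => (zero_mul _).symm
    · rw [← toSeq_eq_unitize 0 k hk z]; simp [toSeq]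
  | succ n ih =>
    obtain ⟨c, hc1, hcm, hc⟩ := ih
    rcases Nat.eq_zero_or_pos n with rfl | hn
    · exact ⟨c, hc1, hcm, fun k hk z => by
        rw [← hc k hk z, if_neg (by omega), if_neg (by omega)]⟩
    have hex : ∀ π : SetPart n, π.IsNoncrossing →
        ∃ T : NCTree, natParts π = blocks T 0 ∧ T.numNodes = n := fun π => exists_tree
    choose! F hF hF' using hex
    -- The recursive definition of the cumulant of order `n`, as a functional on words of any length.
    let top : MLF B := momentFun E - ∑ π ∈ (C n).erase ⊤, w n π • treeFun c (F π)
    have htop : ∀ l, top l =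
        momentFun E l - ∑ π ∈ (C n).erase ⊤, w n π • treeVal c (F π) l c := fun l => by
      change momentFun E l - (∑ π ∈ (C n).erase ⊤, w n π • treeFun c (F π) : MLF B) l = _
      rw [coe_sum_apply]
      rfl
    have hm : IsRightModular top := by
      intro l x b
      rw [htop, htop, momentFun_isRightModular, sub_mul, Finset.sum_mul]
      congr 1
      refine Finset.sum_congr rfl fun π _ => ?_
      rw [treeVal_append_mul hc1 hcm _ hcm, smul_mul_assoc]
    refine ⟨updateLength n top c, ?_, hm.updateLength hcm n, fun k hk z => ?_⟩
    · rw [updateLength_apply, if_neg (by simp; omega), hc1]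
    · rw [updateLength_apply, List.length_ofFn]
      by_cases hkn : k = n
      · subst hkn
        rw [if_pos (by omega), if_pos rfl, htop, cumulant, momentFun_apply]
        congr 1
        refine Finset.sum_congr rfl fun π hπ => ?_
        have hπ' : π.IsNoncrossing := by
          simpa [NC] using hC k (Finset.mem_of_mem_erase hπ)
        rw [multFamily_eq_treeVal hc1 (fun j hj y => ?_) hn (hF π hπ') (hF' π hπ')]
        rw [← hc j hj y]
        split_ifs <;> rfl
      · rw [if_neg hkn, ← hc k hk z]
        exact if_congr (by omega) rfl rfl

/-- The cumulants come from a multilinear and right modular functional. -/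
lemma exists_functional_cumulant (E : ConditionalExpectation B)
    {C : ∀ n, Finset (SetPart n)} (hC : ∀ n, C n ⊆ NC n) (w : ∀ n, SetPart n → ℂ) :
    ∃ c : MLF B, c [] = 1 ∧ IsRightModular c ∧ ∀ k, 1 ≤ k → ∀ z : Fin k → A,
      cumulant E C w k z = c (List.ofFn z) := by
  choose c hc1 hcm hc using exists_functional_truncated_cumulant E hC w
  -- The functionals for different orders of truncation agree on short words.
  have hcc : ∀ n l, l.length < n → c (l.length + 1) l = c n l := by
    intro n l hl
    rcases eq_or_ne l [] with rfl | hne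
    · rw [hc1, hc1]
    · have h1 := hc n l.length (List.length_pos_iff.2 hne) l.get
      have h2 := hc (l.length + 1) l.length (List.length_pos_iff.2 hne) l.get
      rw [List.ofFn_get, if_pos hl] at h1
      rw [List.ofFn_get, if_pos (Nat.lt_succ_self _)] at h2
      exact h2.symm.trans h1
  refine ⟨⟨fun l => c (l.length + 1) l, fun l₁ l₂ => ?_⟩, hc1 1, fun l x b => ?_, fun k hk z => ?_⟩
  · have : ∀ y : A, (l₁ ++ y :: l₂).length = l₁.length + l₂.length + 1 := fun y => by
      simp; omega
    simp only [this]
    exact (c _).2 l₁ l₂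
  · simp only [List.length_append, List.length_singleton]
    exact hcm _ l x b
  · have := hc (k + 1) k hk z
    rw [if_pos (Nat.lt_succ_self k)] at this
    simp only [List.length_ofFn]
    exact this

end Sums

/-! ### The cumulants in terms of the flow -/

section Flow

open NCTree

variable {A : Type*} [Ring A] [Algebra ℂ A] {B : Subalgebra ℂ A} {h : MLF B}

/-- The Boolean functionals of the flow generated by `h`. -/
noncomputable def flow (h : MLF B) (t : ℂ) : MLF B := irrFun h (hookWeight t)

/-- The coefficient of `N` in the identity that expresses `b (t N)` as the sum of the values of `b t`
over irreducible partitions, weighted with the number of increasing colorings with `N` colors. -/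
lemma sum_NCirr_muruaOmega (h1 : h [] = 1) (hh : IsRightModular h) (t : ℂ) {n : ℕ} (hn : 1 ≤ n)
    (a : Fin n → A) :
    ∑ π ∈ NCirr n, ((muruaOmega π : ℚ) : ℂ) • multFamily (toSeq (flow h t)) π a =
      t • h (List.ofFn a) := by
  have H := isFlow_hookWeight h1 hh
  set l := List.ofFn a with hl
  have hlen : l.length = n := List.length_ofFn
  have hne : l ≠ [] := List.ne_nil_of_length_pos (by omega)
  let c : ℕ → B := fun k =>
    ∑ π ∈ NCirr n, (increasingColorings k π : ℂ) • multFamily (toSeq (flow h t)) π a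
  let d : ℕ → B := fun k => (t ^ (k + 1) / ((k + 1).factorial : ℂ)) • (insertion h)^[k] h l
  -- Both sides are `b (t N)`, expanded by the number of colors used and in powers of `t N`.
  have key : ∀ N : ℕ, ∑ k ∈ Finset.range (n + 1), (N.choose k : ℂ) • c k =
      ∑ k ∈ Finset.range n, ((N : ℂ) ^ (k + 1)) • d k := by
    intro N
    have e1 : irrSum (unitize (flow h t)) (fun T => (colorings N T : ℂ)) l (unitize (flow h t)) =
        ∑ k ∈ Finset.range n, ((t * N) ^ (k + 1) / ((k + 1).factorial : ℂ)) •
          (insertion h)^[k] h l :=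
      (H.irrSum_colorings hh t (irrFun_isRightModular h1 hh _) N l).trans
        (H.boolean_taylor hh hne hlen.le (t * N))
    have e2 := sum_NCirr_multFamily (f := toSeq (flow h t)) (unitize_nil _) (toSeq_eq_unitize _) hn
      (w := fun π => (numColorings N (natParts π) : ℂ)) (p := fun T => (colorings N T : ℂ))
      (fun π T hπ _ => by rw [hπ, numColorings_blocks]) a
    have e3 : ∑ k ∈ Finset.range (n + 1), (N.choose k : ℂ) • c k =
        ∑ π ∈ NCirr n, (numColorings N (natParts π) : ℂ) •
          multFamily (toSeq (flow h t)) π a := by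
      simp only [c, Finset.smul_sum, smul_smul]
      rw [Finset.sum_comm]
      refine Finset.sum_congr rfl fun π _ => ?_
      rw [numColorings_eq_sum_choose, ← Finset.sum_smul]
      push_cast
      rfl
    rw [e3, e2, ← hl, e1]
    refine Finset.sum_congr rfl fun k _ => ?_
    simp only [d, smul_smul]
    congr 1
    ring
  have h2 := sum_eq_of_choose_eq_pow n hn c d key
  have h3 : d 0 = t • h l := by simp [d]
  rw [← h3, ← h2]
  simp only [c, Finset.smul_sum, smul_smul]
  rw [Finset.sum_comm]
  refine Finset.sum_congr rfl fun π _ => ?_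
  rw [← Finset.sum_smul, muruaOmega]
  push_cast
  rfl

variable {E : ConditionalExpectation B}

/-- The moments are the moment functionals of the flow of the monotone cumulants at time `1`. -/
lemma moment_eq_treeSum (h1 : h [] = 1)
    (hE : ∀ k, 1 ≤ k → ∀ z : Fin k → A, monotoneCumulant E k z = h (List.ofFn z)) {n : ℕ}
    (hn : 1 ≤ n) (a : Fin n → A) :
    E.toLinearMap (List.ofFn a).prod = treeSum h (hookWeight 1) (List.ofFn a) h := by
  rw [moment_monotone E hn, sum_NC_multFamily h1 hE hn]
  intro π T hπ _
  rw [treeFactorial_eq hπ, hookWeight, one_pow]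

/-- The Boolean cumulants are the flow of the monotone cumulants at time `1`. -/
lemma booleanCumulant_eq_flow (h1 : h [] = 1) (hh : IsRightModular h)
    (hE : ∀ k, 1 ≤ k → ∀ z : Fin k → A, monotoneCumulant E k z = h (List.ofFn z)) {n : ℕ}
    (hn : 1 ≤ n) : booleanCumulant E n = toSeq (flow h 1) n := by
  have H := isFlow_hookWeight h1 hh
  refine (cumulant_unique E IntPart (fun _ _ => 1) (fun n hn => ?_) (fun _ _ => rfl)
    (toSeq (flow h 1)) (fun n hn a => ?_) n hn).symm
  · simp [IntPart, isNoncrossing_top hn, isInterval_top hn]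
  · simp only [one_smul]
    rw [moment_eq_treeSum h1 hE hn,
      sum_IntPart_multFamily (unitize_nil _) (toSeq_eq_unitize _) hn]
    exact (treeSum_interval (irrFun_isRightModular h1 hh _) (H.nil 1) (H.moment 1) _).symm

/-- The free cumulants are the negative of the flow of the monotone cumulants at time `-1`. -/
lemma freeCumulant_eq_flow (h1 : h [] = 1) (hh : IsRightModular h)
    (hE : ∀ k, 1 ≤ k → ∀ z : Fin k → A, monotoneCumulant E k z = h (List.ofFn z)) {n : ℕ}
    (hn : 1 ≤ n) : freeCumulant E n = toSeq (-flow h (-1)) n := by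
  have H := isFlow_hookWeight h1 hh
  refine (cumulant_unique E NC (fun _ _ => 1) (fun n hn => ?_) (fun _ _ => rfl)
    (toSeq (-flow h (-1))) (fun n hn a => ?_) n hn).symm
  · simp [NC, isNoncrossing_top hn]
  · rw [moment_eq_treeSum h1 hE hn,
      sum_NC_multFamily (unitize_nil _) (toSeq_eq_unitize _) hn (p := fun _ => 1)
        fun _ _ _ _ => rfl]
    exact (H.treeSum_one hh (irrFun_isRightModular h1 hh _) _).symm

lemma neg_one_pow_sub_one {k : ℕ} (hk : 1 ≤ k) : (-1 : ℂ) ^ (k - 1) = -(-1) ^ k := by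
  obtain ⟨j, rfl⟩ : ∃ j, k = j + 1 := ⟨k - 1, by omega⟩
  rw [Nat.add_sub_cancel, pow_succ]
  ring

lemma card_parts_pos {n : ℕ} (hn : 1 ≤ n) (π : SetPart n) : 1 ≤ π.parts.card :=
  Finset.card_pos.2 ⟨_, π.part_mem.2 (Finset.mem_univ ⟨0, hn⟩)⟩

end Flow

end OVCumulant

open OVCumulant
theorem mainTheorem4 {A : Type*} [Ring A] [Algebra ℂ A] {B : Subalgebra ℂ A}
    (E : ConditionalExpectation B) {n : ℕ} (hn : 1 ≤ n) (a : Fin n → A) :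
    (booleanCumulant E n a =
      ∑ π ∈ NCirr n, (1 / (treeFactorial π : ℂ)) • multFamily (monotoneCumulant E) π a) ∧
    (freeCumulant E n a =
      ∑ π ∈ NCirr n, ((-1) ^ (π.parts.card - 1) / (treeFactorial π : ℂ)) •
        multFamily (monotoneCumulant E) π a) ∧
    (monotoneCumulant E n a =
      ∑ π ∈ NCirr n, ((muruaOmega π : ℚ) : ℂ) • multFamily (booleanCumulant E) π a) ∧
    (monotoneCumulant E n a =
      ∑ π ∈ NCirr n, ((-1) ^ (π.parts.card - 1) * ((muruaOmega π : ℚ) : ℂ)) •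
        multFamily (freeCumulant E) π a) := by
  obtain ⟨h, h1, hh, hE⟩ := exists_functional_cumulant E (C := NC) (fun _ => subset_rfl)
    fun _ π => 1 / (treeFactorial π : ℂ)
  have hE' : ∀ k, 1 ≤ k → ∀ z : Fin k → A, monotoneCumulant E k z = h (List.ofFn z) := hE
  have hsum : ∀ t : ℂ, ∑ π ∈ NCirr n, (t ^ π.parts.card / (treeFactorial π : ℂ)) •
      multFamily (monotoneCumulant E) π a = toSeq (flow h t) n a := fun t =>
    sum_NCirr_multFamily h1 hE' hn (fun π T hπ _ => by
      rw [treeFactorial_eq hπ, card_parts_eq hπ]; rfl) a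
  have hpos : ∀ π : SetPart n, ∀ V ∈ π.parts, 1 ≤ V.card := fun π V hV =>
    (π.nonempty_of_mem_parts hV).card_pos
  refine ⟨?_, ?_, ?_, ?_⟩
  · rw [booleanCumulant_eq_flow h1 hh hE' hn, ← hsum]
    simp only [one_pow]
  · have : toSeq (-flow h (-1)) n a = -toSeq (flow h (-1)) n a := rfl
    rw [freeCumulant_eq_flow h1 hh hE' hn, this, ← hsum, ← Finset.sum_neg_distrib]
    refine Finset.sum_congr rfl fun π _ => ?_
    rw [neg_one_pow_sub_one (card_parts_pos hn π), neg_div, neg_smul]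
  · rw [hE' n hn, ← one_smul ℂ (h (List.ofFn a)), ← sum_NCirr_muruaOmega h1 hh 1 hn]
    refine Finset.sum_congr rfl fun π _ => ?_
    congr 1
    exact multFamily_congr π
      (fun V hV => (booleanCumulant_eq_flow h1 hh hE' (hpos π V hV)).symm) a
  · have hω := sum_NCirr_muruaOmega h1 hh (-1) hn a
    rw [hE' n hn, ← neg_neg (h (List.ofFn a)), ← neg_one_smul ℂ (h (List.ofFn a)), ← hω,
      ← Finset.sum_neg_distrib]
    refine Finset.sum_congr rfl fun π hπ => ?_
    have hnc : π.IsNoncrossing := (Finset.mem_filter.1 hπ).2.1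
    rw [multFamily_congr (f := freeCumulant E) π
        (fun V hV => freeCumulant_eq_flow h1 hh hE' (hpos π V hV)) a,
      multFamily_neg _ hn hnc, smul_smul, neg_one_pow_sub_one (card_parts_pos hn π), ← neg_smul]
    congr 1
    have : (-1 : ℂ) ^ π.parts.card * (-1) ^ π.parts.card = 1 := by
      rw [← mul_pow]; simp
    linear_combination ((muruaOmega π : ℚ) : ℂ) * this
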